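/- Call a decision problem $P$ \emph{3SUM-hard} if, for some $\varepsilon>0$, 3SUM on $n$ numbers can be solved on a real RAM using a constant number of instances of $P$, each of size $O(n)$, and $O(n^{2-\varepsilon})$ additional time. Here 3SUM is the problem: given a set $S$ of $n$ integers, are there $a,b,c\in S$ (not necessarily distinct) with $a+b+c=0$? The real RAM is the random access machine with unit-cost comparisons, addition, subtraction, multiplication and division of real numbers (no rounding and no square roots), and addition and truncated subtraction of natural numbers (used for addresses and counters). The following two problems are 3SUM-hard. (1) \emph{Weak visibility between a pair of edges in a polygonal domain with holes.} The input is a polygonal domain $D\subset\mathbb R^2$ (the closed region bounded by a simple polygon, minus the interiors of finitely many pairwise disjoint simple polygons, the holes, that lie in the interior of the region) and two different edges $e,e'$ of its boundary. The question is whether there are points $p\in e$, $p'\in e'$ with segment $pp'\subseteq D$. (2) \emph{Weak visibility between a pair of edges in a terrain.} The input is a terrain (a triangulated polyhedral surface in $\mathbb R^3$ whose triangles project to nondegenerate triangles that meet face to face and cover a bounded convex region of the $xy$-plane; so every vertical line meets the surface at most once) and two different edges $e,e'$ of its triangulation. The question is whether there are points $p\in e$, $p'\in e'$ such that no point of the segment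 $pp'$ lies strictly below the surface. The size of an input is the number of integers and reals in its description: for (1) the vertex coordinates of the boundary polygons in cyclic order, their numbers of vertices, and the names of the two edges; for (2) the vertex coordinates, the index triples of the triangles, and the names of the two edges. -/

import Mathlib

noncomputable section

namespace ThreeSumVis

/-! ### Decision problems on words of integers and reals -/

/-- An input word: integer data (counters, indices) and real data (numbers, coordinates). -/
structure Word where
  nats : List ℕ
  reals : List ℝ

/-- Input size: the number of cells that the word occupies. -/
def Word.size (w : Word) : ℕ := w.nats.length + w.reals.length

/-- A decision problem whose instances are unambiguously encoded by words. -/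
structure Problem where
  Inst : Type
  encode : Inst → Word
  encode_injective : Function.Injective encode
  Yes : Inst → Prop

/-! ### The real RAM, with an oracle for a decision problem -/

/-- A state of the machine: directly addressed registers and indirectly addressed memory cells, for
natural numbers and for reals. -/
structure State where
  nreg : ℕ → ℕ
  rreg : ℕ → ℝ
  nmem : ℕ → ℕ
  rmem : ℕ → ℝ

/-- Unit-cost instructions. There are no square roots, no rounding and no conversion of a real to an
integer. -/
inductive Instr where
  /-- put the natural number `k` into integer register `d` -/
  | nconst (d k : ℕ)
  | nadd (d a b : ℕ)
  /-- truncated subtraction of natural numbers -/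
  | nsub (d a b : ℕ)
  /-- read the integer cell whose address is in integer register `a` -/
  | nload (d a : ℕ)
  /-- write integer register `b` into the integer cell whose address is in integer register `a` -/
  | nstore (a b : ℕ)
  /-- put the integer `k` into real register `d` -/
  | rconst (d : ℕ) (k : ℤ)
  /-- copy integer register `a` into real register `d` -/
  | rofNat (d a : ℕ)
  | radd (d a b : ℕ)
  | rsub (d a b : ℕ)
  | rmul (d a b : ℕ)
  /-- division of reals (the quotient by zero is zero) -/
  | rdiv (d a b : ℕ)
  /-- read the real cell whose address is in integer register `a` -/
  | rload (d a : ℕ)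
  /-- write real register `b` into the real cell whose address is in integer register `a` -/
  | rstore (a b : ℕ)

/-- The effect of an instruction. -/
def Instr.apply : Instr → State → State
  | .nconst d k, s => { s with nreg := Function.update s.nreg d k }
  | .nadd d a b, s => { s with nreg := Function.update s.nreg d (s.nreg a + s.nreg b) }
  | .nsub d a b, s => { s with nreg := Function.update s.nreg d (s.nreg a - s.nreg b) }
  | .nload d a, s => { s with nreg := Function.update s.nreg d (s.nmem (s.nreg a)) }
  | .nstore a b, s => { s with nmem := Function.update s.nmem (s.nreg a) (s.nreg b) }
  | .rconst d k, s => { s with rreg := Function.update s.rreg d (k : ℝ) }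
  | .rofNat d a, s => { s with rreg := Function.update s.rreg d (s.nreg a : ℝ) }
  | .radd d a b, s => { s with rreg := Function.update s.rreg d (s.rreg a + s.rreg b) }
  | .rsub d a b, s => { s with rreg := Function.update s.rreg d (s.rreg a - s.rreg b) }
  | .rmul d a b, s => { s with rreg := Function.update s.rreg d (s.rreg a * s.rreg b) }
  | .rdiv d a b, s => { s with rreg := Function.update s.rreg d (s.rreg a / s.rreg b) }
  | .rload d a, s => { s with rreg := Function.update s.rreg d (s.rmem (s.nreg a)) }
  | .rstore a b, s => { s with rmem := Function.update s.rmem (s.nreg a) (s.rreg b) }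

/-- Unit-cost comparisons of two integer registers or of two real registers. -/
inductive Test where
  | nlt (a b : ℕ)
  | nle (a b : ℕ)
  | rlt (a b : ℕ)
  | rle (a b : ℕ)

/-- The outcome of a comparison. -/
def Test.Holds : Test → State → Prop
  | .nlt a b, s => s.nreg a < s.nreg b
  | .nle a b, s => s.nreg a ≤ s.nreg b
  | .rlt a b, s => s.rreg a < s.rreg b
  | .rle a b, s => s.rreg a ≤ s.rreg b

/-- Programs. `query d a m b k` asks the oracle about the word that is stored in the block of integer
cells with start address `nreg a` and length `nreg m` and in the block of real cells with start
address `nreg b` and length `nreg k`; the answer (`1` for yes, `0` for no) goes to `nreg d`. -/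
inductive Prog where
  | skip
  | instr (i : Instr)
  | query (d a m b k : ℕ)
  | seq (p q : Prog)
  | ite (c : Test) (p q : Prog)
  | while (c : Test) (p : Prog)

/-- The word that a query submits to the oracle. -/
def State.queryWord (s : State) (a m b k : ℕ) : Word where
  nats := (List.range (s.nreg m)).map fun i => s.nmem (s.nreg a + i)
  reals := (List.range (s.nreg k)).map fun i => s.rmem (s.nreg b + i)

open Classical in
/-- `Exec P L p s t q s'`: the program `p`, started in state `s`, halts in state `s'` after `t` steps,
`q` of which are queries to the oracle for `P`; every query submits an instance of `P` of size at
most `L`. -/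
inductive Exec (P : Problem) (L : ℕ) : Prog → State → ℕ → ℕ → State → Prop where
  | skip (s : State) : Exec P L .skip s 0 0 s
  | instr (i : Instr) (s : State) : Exec P L (.instr i) s 1 0 (i.apply s)
  | query (d a m b k : ℕ) (s : State) (I : P.Inst)
      (hI : P.encode I = s.queryWord a m b k) (hL : (s.queryWord a m b k).size ≤ L) :
      Exec P L (.query d a m b k) s 1 1
        { s with nreg := Function.update s.nreg d (if P.Yes I then 1 else 0) }
  | seq {p p' : Prog} {s s' s'' : State} {t t' q q' : ℕ}
      (h : Exec P L p s t q s') (h' : Exec P L p' s' t' q' s'') :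
      Exec P L (.seq p p') s (t + t') (q + q') s''
  | ite_true {c : Test} {p p' : Prog} {s s' : State} {t q : ℕ}
      (hc : c.Holds s) (h : Exec P L p s t q s') :
      Exec P L (.ite c p p') s (t + 1) q s'
  | ite_false {c : Test} {p p' : Prog} {s s' : State} {t q : ℕ}
      (hc : ¬ c.Holds s) (h : Exec P L p' s t q s') :
      Exec P L (.ite c p p') s (t + 1) q s'
  | while_true {c : Test} {p : Prog} {s s' s'' : State} {t t' q q' : ℕ}
      (hc : c.Holds s) (h : Exec P L p s t q s')
      (h' : Exec P L (.while c p) s' t' q' s'') :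
      Exec P L (.while c p) s (t + t' + 1) (q + q') s''
  | while_false {c : Test} {p : Prog} {s : State} (hc : ¬ c.Holds s) :
      Exec P L (.while c p) s 1 0 s

/-- The start state on input `w`: the word is stored from address `0` on, and its two lengths are in
the integer registers `0` and `1`; everything else is zero. -/
def State.start (w : Word) : State where
  nreg := Function.update (Function.update (fun _ => 0) 0 w.nats.length) 1 w.reals.length
  rreg := fun _ => 0
  nmem := fun i => w.nats.getD i 0
  rmem := fun i => w.reals.getD i 0

/-- `A.SolvableUsing P f`: every instance of `A` of size `n` is solved, by one program of the real RAM,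
using a constant number of instances of `P` of size `O(n)` and `O(f n)` additional time. The answer
is returned in the integer register `0`. -/
def Problem.SolvableUsing (A P : Problem) (f : ℕ → ℝ) : Prop :=
  ∃ (p : Prog) (K C : ℕ) (c : ℝ), ∀ x : A.Inst, ∃ (t q : ℕ) (s : State),
    Exec P (C * ((A.encode x).size + 1)) p (State.start (A.encode x)) t q s ∧
    q ≤ K ∧ (t : ℝ) ≤ c * f (A.encode x).size ∧
    (A.Yes x → s.nreg 0 = 1) ∧ (¬ A.Yes x → s.nreg 0 = 0)

/-! ### 3SUM -/

/-- 3SUM: given a set `S` of integers (listed in any order), are there `a, b, c ∈ S` with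
`a + b + c = 0`? -/
def threeSum : Problem where
  Inst := {l : List ℤ // l.Nodup}
  encode l := ⟨[], l.1.map fun a : ℤ => (a : ℝ)⟩
  encode_injective := by
    intro l l' h
    have h1 : l.1.map (fun a : ℤ => (a : ℝ)) = l'.1.map fun a : ℤ => (a : ℝ) :=
      congrArg Word.reals h
    exact Subtype.ext (List.map_injective_iff.2 Int.cast_injective h1)
  Yes l := ∃ a ∈ l.1, ∃ b ∈ l.1, ∃ c ∈ l.1, a + b + c = 0

/-- A problem is 3SUM-hard if 3SUM is solvable using it (a constant number of instances of linear
size) in strongly subquadratic additional time. -/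
def IsThreeSumHard (P : Problem) : Prop :=
  ∃ ε : ℝ, 0 < ε ∧ threeSum.SolvableUsing P fun n => ((n : ℝ) + 1) ^ (2 - ε)

/-! ### Weak visibility -/

/-- Two sets are weakly visible in `D` if some point of the one sees some point of the other, that is,
the segment between the two points lies in `D`. -/
def WeaklyVisible {E : Type*} [AddCommGroup E] [Module ℝ E] (D e e' : Set E) : Prop :=
  ∃ p ∈ e, ∃ p' ∈ e', segment ℝ p p' ⊆ D

/-! ### Polygonal domains with holes -/

/-- Vertex `j` of a closed polygon, given by the cyclic list of its vertices. -/
def vertex (V : List (ℝ × ℝ)) (j : ℕ) : ℝ × ℝ := V.getD (j % V.length) 0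

/-- Edge `j` of a closed polygon. -/
def edge (V : List (ℝ × ℝ)) (j : ℕ) : Set (ℝ × ℝ) := segment ℝ (vertex V j) (vertex V (j + 1))

/-- The closed polygonal curve. -/
def boundary (V : List (ℝ × ℝ)) : Set (ℝ × ℝ) := ⋃ j ∈ Finset.range V.length, edge V j

/-- A simple polygon: at least three vertices, all distinct, and two different edges have no points in
common besides common endpoints. -/
def IsSimplePolygon (V : List (ℝ × ℝ)) : Prop :=
  3 ≤ V.length ∧ V.Nodup ∧ ∀ i < V.length, ∀ j < V.length, i ≠ j →
    edge V i ∩ edge V j ⊆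
      {vertex V i, vertex V (i + 1)} ∩ {vertex V j, vertex V (j + 1)}

/-- The open set enclosed by the curve: the union of the bounded components of its complement. -/
def inside (V : List (ℝ × ℝ)) : Set (ℝ × ℝ) :=
  {x | x ∉ boundary V ∧ Bornology.IsBounded (connectedComponentIn (boundary V)ᶜ x)}

/-- The closed region bounded by the curve. -/
def region (V : List (ℝ × ℝ)) : Set (ℝ × ℝ) := boundary V ∪ inside V

/-- A polygonal domain with holes: a simple polygon, and pairwise disjoint simple polygons inside
it. -/
structure PolygonalDomain where
  outer : List (ℝ × ℝ)
  holes : List (List (ℝ × ℝ))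
  outer_simple : IsSimplePolygon outer
  holes_simple : ∀ H ∈ holes, IsSimplePolygon H
  holes_inside : ∀ H ∈ holes, region H ⊆ inside outer
  holes_disjoint : holes.Pairwise fun H H' => Disjoint (region H) (region H')

namespace PolygonalDomain

/-- The points of the (closed) domain: the holes' interiors are removed. -/
def carrier (D : PolygonalDomain) : Set (ℝ × ℝ) := region D.outer \ ⋃ H ∈ D.holes, inside H

/-- The boundary polygons: number `0` is the outer one, the others are the holes. -/
def polys (D : PolygonalDomain) : List (List (ℝ × ℝ)) := D.outer :: D.holes

/-- `(i, j)` names edge `j` of boundary polygon `i`. -/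
def IsEdge (D : PolygonalDomain) (e : ℕ × ℕ) : Prop :=
  e.1 < D.polys.length ∧ e.2 < (D.polys.getD e.1 []).length

/-- The segment named by `e`. -/
def edgeSet (D : PolygonalDomain) (e : ℕ × ℕ) : Set (ℝ × ℝ) := edge (D.polys.getD e.1 []) e.2

theorem ext_polys {D D' : PolygonalDomain} (h : D.polys = D'.polys) : D = D' := by
  cases D; cases D'
  simp only [polys, List.cons.injEq] at h
  obtain ⟨rfl, rfl⟩ := h
  rfl

end PolygonalDomain

/-- A polygonal domain with two different edges. -/
structure DomainInstance where
  dom : PolygonalDomain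
  e : ℕ × ℕ
  e' : ℕ × ℕ
  isEdge : dom.IsEdge e
  isEdge' : dom.IsEdge e'
  ne : e ≠ e'

/-- The coordinates of a list of points in the plane. -/
def coords (V : List (ℝ × ℝ)) : List ℝ := V.flatMap fun p => [p.1, p.2]

theorem coords_injective : Function.Injective coords := by
  intro V
  induction V with
  | nil => intro V' h; cases V' <;> simp_all [coords]
  | cons p V ih =>
    intro V' h
    cases V' with
    | nil => simp [coords] at h
    | cons p' V' =>
      simp only [coords, List.flatMap_cons, List.cons_append, List.nil_append,
        List.cons.injEq] at h
      rw [Prod.ext h.1 h.2.1, ih h.2.2]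

theorem flatten_injective_of_lengths {α : Type*} :
    ∀ L L' : List (List α), L.map List.length = L'.map List.length →
      L.flatten = L'.flatten → L = L'
  | [], [], _, _ => rfl
  | [], _ :: _, h, _ => by simp at h
  | _ :: _, [], h, _ => by simp at h
  | a :: L, b :: L', h, h' => by
    simp only [List.map_cons, List.cons.injEq] at h
    simp only [List.flatten_cons] at h'
    obtain ⟨h1, h2⟩ := List.append_inj h' h.1
    rw [h1, flatten_injective_of_lengths L L' h.2 h2]

/-- Weak visibility between a pair of edges of a polygonal domain with holes. The input consists of the
names of the two edges, the numbers of vertices of the boundary polygons, and the coordinates of all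
vertices in cyclic order, polygon by polygon. -/
def domainEdgeVisibility : Problem where
  Inst := DomainInstance
  encode I :=
    { nats := [I.e.1, I.e.2, I.e'.1, I.e'.2] ++ I.dom.polys.map List.length
      reals := coords I.dom.polys.flatten }
  encode_injective := by
    rintro ⟨D, ⟨a, b⟩, ⟨a', b'⟩, _, _, _⟩ ⟨D', ⟨c, d⟩, ⟨c', d'⟩, _, _, _⟩ h
    simp only [Word.mk.injEq, List.cons_append, List.nil_append, List.cons.injEq] at h
    obtain ⟨⟨rfl, rfl, rfl, rfl, h1⟩, h2⟩ := h
    obtain rfl := PolygonalDomain.ext_polys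
      (flatten_injective_of_lengths _ _ h1 (coords_injective h2))
    rfl
  Yes I := WeaklyVisible I.dom.carrier (I.dom.edgeSet I.e) (I.dom.edgeSet I.e')

/-! ### Terrains -/

/-- The three vertices of a triangle, as a set of indices. -/
def triIdx (t : ℕ × ℕ × ℕ) : Set ℕ := {t.1, t.2.1, t.2.2}

/-- A (triangulated) terrain over a bounded convex region of the `xy`-plane. A point of `(ℝ × ℝ) × ℝ`
is a pair of its projection to the `xy`-plane and its height. The projected triangles are
nondegenerate, they meet face to face, and they cover a convex region. -/
structure Terrain where
  verts : List ((ℝ × ℝ) × ℝ)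
  tris : List (ℕ × ℕ × ℕ)
  tris_ne_nil : tris ≠ []
  idx_lt : ∀ t ∈ tris, ∀ i ∈ triIdx t, i < verts.length
  idx_used : ∀ i < verts.length, ∃ t ∈ tris, i ∈ triIdx t
  nondegenerate : ∀ t ∈ tris, AffineIndependent ℝ
    ![(verts.getD t.1 0).1, (verts.getD t.2.1 0).1, (verts.getD t.2.2 0).1]
  face_to_face : ∀ t ∈ tris, ∀ t' ∈ tris,
    convexHull ℝ ((fun i => (verts.getD i 0).1) '' triIdx t) ∩
      convexHull ℝ ((fun i => (verts.getD i 0).1) '' triIdx t') ⊆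
    convexHull ℝ ((fun i => (verts.getD i 0).1) '' (triIdx t ∩ triIdx t'))
  convex_region :
    Convex ℝ (⋃ t ∈ tris, convexHull ℝ ((fun i => (verts.getD i 0).1) '' triIdx t))

namespace Terrain

/-- The polyhedral surface. -/
def surface (T : Terrain) : Set ((ℝ × ℝ) × ℝ) :=
  ⋃ t ∈ T.tris, convexHull ℝ ((fun i => T.verts.getD i 0) '' triIdx t)

/-- The free space: the points on or above the surface. -/
def carrier (T : Terrain) : Set ((ℝ × ℝ) × ℝ) :=
  {x | ∃ y ∈ T.surface, y.1 = x.1 ∧ y.2 ≤ x.2}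

/-- `(i, j)` names an edge if the vertices `i` and `j` are different vertices of one triangle. -/
def IsEdge (T : Terrain) (e : ℕ × ℕ) : Prop :=
  e.1 ≠ e.2 ∧ ∃ t ∈ T.tris, e.1 ∈ triIdx t ∧ e.2 ∈ triIdx t

/-- The segment named by `e`. -/
def edgeSet (T : Terrain) (e : ℕ × ℕ) : Set ((ℝ × ℝ) × ℝ) :=
  segment ℝ (T.verts.getD e.1 0) (T.verts.getD e.2 0)

end Terrain

/-- A terrain with two different edges. -/
structure TerrainInstance where
  ter : Terrain
  e : ℕ × ℕ
  e' : ℕ × ℕ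
  isEdge : ter.IsEdge e
  isEdge' : ter.IsEdge e'
  ne : s(e.1, e.2) ≠ s(e'.1, e'.2)

/-- The coordinates of a list of points in space. -/
def coordsThree (V : List ((ℝ × ℝ) × ℝ)) : List ℝ := V.flatMap fun p => [p.1.1, p.1.2, p.2]

/-- The vertex indices of a list of triangles. -/
def triCode (L : List (ℕ × ℕ × ℕ)) : List ℕ := L.flatMap fun t => [t.1, t.2.1, t.2.2]

theorem coordsThree_injective : Function.Injective coordsThree := by
  intro V
  induction V with
  | nil => intro V' h; cases V' <;> simp_all [coordsThree]
  | cons p V ih =>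
    intro V' h
    cases V' with
    | nil => simp [coordsThree] at h
    | cons p' V' =>
      simp only [coordsThree, List.flatMap_cons, List.cons_append, List.nil_append,
        List.cons.injEq] at h
      rw [Prod.ext (Prod.ext h.1 h.2.1) h.2.2.1, ih h.2.2.2]

theorem triCode_injective : Function.Injective triCode := by
  intro V
  induction V with
  | nil => intro V' h; cases V' <;> simp_all [triCode]
  | cons p V ih =>
    intro V' h
    cases V' with
    | nil => simp [triCode] at h
    | cons p' V' =>
      simp only [triCode, List.flatMap_cons, List.cons_append, List.nil_append,
        List.cons.injEq] at h
      rw [Prod.ext h.1 (Prod.ext h.2.1 h.2.2.1), ih h.2.2.2]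

/-- Weak visibility between a pair of edges of a terrain. The input consists of the names of the two
edges, the vertex indices of the triangles, and the coordinates of the vertices. -/
def terrainEdgeVisibility : Problem where
  Inst := TerrainInstance
  encode I :=
    { nats := [I.e.1, I.e.2, I.e'.1, I.e'.2] ++ triCode I.ter.tris
      reals := coordsThree I.ter.verts }
  encode_injective := by
    rintro ⟨T, ⟨a, b⟩, ⟨a', b'⟩, _, _, _⟩ ⟨T', ⟨c, d⟩, ⟨c', d'⟩, _, _, _⟩ h
    simp only [Word.mk.injEq, List.cons_append, List.nil_append, List.cons.injEq] at h
    obtain ⟨⟨rfl, rfl, rfl, rfl, h1⟩, h2⟩ := h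
    cases T; cases T'
    obtain rfl := triCode_injective h1
    obtain rfl := coordsThree_injective h2
    rfl
  Yes I := WeaklyVisible I.ter.carrier (I.ter.edgeSet I.e) (I.ter.edgeSet I.e')

end ThreeSumVis

end

noncomputable section

namespace ThreeSumVis

/-! ### A program logic for total correctness with step counts -/

/-! Both problems are hard because collinearity encodes addition. Put points at abscissas `16 a`,
`-8 c`, `16 b` on three equidistant horizontal lines, at heights `32 M`, `64 M`, `96 M`. They are
collinear exactly when the middle abscissa is the mean of the outer two, that is, when `a + b + c =
0`. So let each line be blocked by a wall with one gap for every entry of the list. Two long edges,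
one before the first wall and one behind the last, then see each other if and only if some line
passes through a gap of each wall. Here `M` exceeds all absolute values of the entries, so a
relevant line has slope at most `1/2` against the vertical and hits both edges.

In the plane (`wallInstance_yes_iff`) the walls are rows of rectangular holes of half-thickness 1,
and the gaps have half-width 1. A sight line through three gaps gives `|16 (a + b + c)| ≤ 4`, so the
integer `a + b + c` is zero. Conversely the line through the three gap centers drifts by less than
`1/2` while it crosses a wall. The two edges are sides of two further holes, and sentinel gaps lie
outside of the reach of the sight lines.

In the terrain (`terrainInstance_yes_iff`) everything happens at height zero. The surface is
nonnegative, and on the middle line of a wall it vanishes only at the gap centers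
(`Grid.exists_vertex_of_mem_carrier`), so that the condition is exact. Around each gap center two
zero-height triangles form a double cone, which contains every line of slope at most 1 through the
center. The triangulation is a sheared grid. Its triangles meet face to face because any two are
separated by a line (`MeetFaceToFace.of_separated`), and each strip is covered cell by cell
(`Grid.cover_strip`).

The reduction itself has one form for both problems. Once the list is sorted, the description of the
instance is a head, a block for each entry whose numbers are integer linear forms in 1, `M`, the
current and the previous entries of the increasing and of the decreasing order, and a tail. Such a
`Template` can be written in one linear sweep. The machine sorts by bottom-up merge sort, writes the
word, and asks a single query (`Template.runs_prog`). This takes `O(n log n)` steps, which is `O((n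
+ 1) ^ (3 / 2))`, so `ε = 1 / 2` works (`isThreeSumHard_of_template`). It remains to match the
geometric instances with their templates (`encode_wallInstance`, `encode_terrainInstance`). -/

/-- `p`, started in `s`, halts after at most `T` steps and `Q` queries in a state satisfying `post`. -/
def Runs (P : Problem) (L : ℕ) (p : Prog) (s : State) (T Q : ℕ) (post : State → Prop) : Prop :=
  ∃ t q s', Exec P L p s t q s' ∧ t ≤ T ∧ q ≤ Q ∧ post s'

section Logic

variable {P : Problem} {L : ℕ}

theorem Runs.mono {p : Prog} {s : State} {T T' Q Q' : ℕ} {post post' : State → Prop}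
    (h : Runs P L p s T Q post) (hT : T ≤ T') (hQ : Q ≤ Q') (hp : ∀ s', post s' → post' s') :
    Runs P L p s T' Q' post' := by
  obtain ⟨t, q, s', he, ht, hq, hs⟩ := h
  exact ⟨t, q, s', he, ht.trans hT, hq.trans hQ, hp _ hs⟩

theorem Runs.seq {p p' : Prog} {s : State} {T T' Q Q' : ℕ} {post post' : State → Prop}
    (h : Runs P L p s T Q post) (h' : ∀ s', post s' → Runs P L p' s' T' Q' post') :
    Runs P L (.seq p p') s (T + T') (Q + Q') post' := by
  obtain ⟨t, q, s', he, ht, hq, hs⟩ := h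
  obtain ⟨t', q', s'', he', ht', hq', hs'⟩ := h' s' hs
  exact ⟨_, _, _, .seq he he', by omega, by omega, hs'⟩

theorem runs_ite {c : Test} {p p' : Prog} {s : State} {T Q : ℕ} {post : State → Prop}
    (h : c.Holds s → Runs P L p s T Q post) (h' : ¬ c.Holds s → Runs P L p' s T Q post) :
    Runs P L (.ite c p p') s (T + 1) Q post := by
  by_cases hc : c.Holds s
  · obtain ⟨t, q, s', he, ht, hq, hs⟩ := h hc
    exact ⟨_, _, _, .ite_true hc he, by omega, hq, hs⟩
  · obtain ⟨t, q, s', he, ht, hq, hs⟩ := h' hc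
    exact ⟨_, _, _, .ite_false hc he, by omega, hq, hs⟩

theorem runs_while_done {c : Test} {p : Prog} {s : State} {post : State → Prop}
    (hc : ¬ c.Holds s) (h : post s) : Runs P L (.while c p) s 1 0 post :=
  ⟨_, _, _, .while_false hc, le_rfl, le_rfl, h⟩

/-- The query bound is zero because no loop of the reduction contains the query. -/
theorem runs_while_step {c : Test} {p : Prog} {s : State} {T T' : ℕ} {post post' : State → Prop}
    (hc : c.Holds s) (h : Runs P L p s T 0 post)
    (h' : ∀ s', post s' → Runs P L (.while c p) s' T' 0 post') :
    Runs P L (.while c p) s (T + T' + 1) 0 post' := by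
  obtain ⟨t, q, s', he, ht, hq, hs⟩ := h
  obtain ⟨t', q', s'', he', ht', hq', hs'⟩ := h' s' hs
  exact ⟨_, _, _, .while_true hc he he', by omega, by omega, hs'⟩

/-- A loop with an invariant that is indexed by the number of the iteration. -/
theorem runs_while_count {c : Test} {p : Prog} (Inv : ℕ → State → Prop) (T m : ℕ)
    (hstep : ∀ k s, k < m → Inv k s → c.Holds s ∧ Runs P L p s T 0 (Inv (k + 1)))
    (hdone : ∀ s, Inv m s → ¬ c.Holds s) {s : State} (h0 : Inv 0 s) :
    Runs P L (.while c p) s (m * (T + 1) + 1) 0 (Inv m) := by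
  -- Induction on the number `d` of remaining iterations, since a loop unrolls at its front.
  have key : ∀ d k s, k + d = m → Inv k s →
      Runs P L (.while c p) s (d * (T + 1) + 1) 0 (Inv m) := by
    intro d
    induction d with
    | zero =>
      intro k s hk hI
      obtain rfl : k = m := by omega
      simpa using runs_while_done (hdone s hI) hI
    | succ d ih =>
      intro k s hk hI
      obtain ⟨hc, hr⟩ := hstep k s (by omega) hI
      refine (runs_while_step hc hr fun s' hs' => ih (k + 1) s' (by omega) hs').mono ?_ le_rfl
        fun _ h => h
      ring_nf; omega
  exact key m 0 s (by omega) h0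

/-- A straight-line program. -/
def block : List Instr → Prog
  | [] => .skip
  | i :: l => .seq (.instr i) (block l)

/-- The effect of a straight-line program. -/
def runBlock : List Instr → State → State
  | [], s => s
  | i :: l, s => runBlock l (i.apply s)

theorem runs_block {post : State → Prop} :
    ∀ (l : List Instr) (s : State), post (runBlock l s) → Runs P L (block l) s l.length 0 post
  | [], s, h => ⟨_, _, _, .skip s, le_rfl, le_rfl, h⟩
  | i :: l, s, h => by
    have h1 : Runs P L (.instr i) s 1 0 (· = i.apply s) := ⟨_, _, _, .instr i s, le_rfl, le_rfl, rfl⟩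
    refine (h1.seq (post' := post) (T' := l.length) (Q' := 0) ?_).mono ?_ le_rfl fun _ h => h
    · rintro _ rfl
      exact runs_block l _ h
    · simp; omega

end Logic

/-! ### Lists in memory -/

/-- The cells from address `i` on hold the list. -/
def Seg {α : Type*} (m : ℕ → α) : ℕ → List α → Prop
  | _, [] => True
  | i, x :: l => m i = x ∧ Seg m (i + 1) l

theorem seg_append {α : Type*} {m : ℕ → α} {l l' : List α} :
    ∀ {i : ℕ}, Seg m i (l ++ l') ↔ Seg m i l ∧ Seg m (i + l.length) l' := by
  induction l with
  | nil => simp [Seg]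
  | cons x l ih =>
    intro i
    simp only [List.cons_append, Seg, ih, List.length_cons, and_assoc]
    rw [show i + 1 + l.length = i + (l.length + 1) by omega]

theorem Seg.congr {α : Type*} {m m' : ℕ → α} {l : List α} :
    ∀ {i : ℕ}, Seg m i l → (∀ a, i ≤ a → a < i + l.length → m' a = m a) → Seg m' i l := by
  induction l with
  | nil => simp [Seg]
  | cons x l ih =>
    intro i h hm
    simp only [List.length_cons] at hm
    exact ⟨(hm i le_rfl (by omega)).trans h.1, ih h.2 fun a h1 h2 => hm a (by omega) (by omega)⟩

theorem Seg.get {α : Type*} {m : ℕ → α} {l : List α} :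
    ∀ {i : ℕ}, Seg m i l → ∀ k (hk : k < l.length), m (i + k) = l[k] := by
  induction l with
  | nil => simp
  | cons x l ih =>
    intro i h k hk
    cases k with
    | zero => exact h.1
    | succ k =>
      have := ih h.2 k (by simpa using hk)
      rw [show i + (k + 1) = i + 1 + k by omega]
      simpa using this

theorem seg_of_get {α : Type*} {m : ℕ → α} {l : List α} :
    ∀ {i : ℕ}, (∀ k (hk : k < l.length), m (i + k) = l[k]) → Seg m i l := by
  induction l with
  | nil => simp [Seg]
  | cons x l ih =>
    intro i h
    refine ⟨h 0 (by simp), ih fun k hk => ?_⟩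
    have := h (k + 1) (by simpa using hk)
    rw [show i + 1 + k = i + (k + 1) by omega]
    simpa using this

theorem Seg.range_map {α : Type*} {m : ℕ → α} {l : List α} {i : ℕ} (h : Seg m i l) :
    ((List.range l.length).map fun k => m (i + k)) = l := by
  refine List.ext_getElem (by simp) fun k h1 h2 => ?_
  simpa using h.get k h2

/-- The real cells below the pointer `nreg 2` are kept, and `out` is written from the pointer on. -/
structure Appends (s s' : State) (out : List ℝ) : Prop where
  ptr : s'.nreg 2 = s.nreg 2 + out.length
  below : ∀ a < s.nreg 2, s'.rmem a = s.rmem a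
  seg : Seg s'.rmem (s.nreg 2) out

/-- Memory is written only upward from the pointer, so earlier output survives all later writing. -/
theorem Appends.trans {s s' s'' : State} {o o' : List ℝ} (h : Appends s s' o)
    (h' : Appends s' s'' o') : Appends s s'' (o ++ o') where
  ptr := by rw [h'.ptr, h.ptr, List.length_append]; omega
  below a ha := by rw [h'.below a (by rw [h.ptr]; omega), h.below a ha]
  seg := by
    rw [seg_append]
    refine ⟨h.seg.congr fun a _ h2 => h'.below a (by rw [h.ptr]; omega), ?_⟩
    rw [← h.ptr]
    exact h'.seg

theorem Appends.seg_below {s s' : State} {o l : List ℝ} {i : ℕ} (h : Appends s s' o)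
    (hs : Seg s.rmem i l) (hi : i + l.length ≤ s.nreg 2) : Seg s'.rmem i l :=
  hs.congr fun a _ h2 => h.below a (by omega)

/-- The same for natural numbers; the pointer is `nreg 3`. -/
structure NAppends (s s' : State) (out : List ℕ) : Prop where
  ptr : s'.nreg 3 = s.nreg 3 + out.length
  below : ∀ a < s.nreg 3, s'.nmem a = s.nmem a
  seg : Seg s'.nmem (s.nreg 3) out

theorem NAppends.trans {s s' s'' : State} {o o' : List ℕ} (h : NAppends s s' o)
    (h' : NAppends s' s'' o') : NAppends s s'' (o ++ o') where
  ptr := by rw [h'.ptr, h.ptr, List.length_append]; omega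
  below a ha := by rw [h'.below a (by rw [h.ptr]; omega), h.below a ha]
  seg := by
    rw [seg_append]
    refine ⟨h.seg.congr fun a _ h2 => h'.below a (by rw [h.ptr]; omega), ?_⟩
    rw [← h.ptr]
    exact h'.seg

/-! ### Merge sort

Registers: `2` end of the written real memory, `4`, `5` rest of the first run, `6`, `7` rest of the
second run, `8` length of the runs, `9` end of the current list, `10` end of the merged runs, `11`
the constant one, `12` scratch, `13` start of the current list. -/

/-- Move the real cell with address `nreg r` to the end of the written memory. -/
def moveCell (r : ℕ) : Prog :=
  block [.rload 0 r, .rstore 2 0, .nadd 2 2 11, .nadd r r 11]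

/-- Merge the two runs. -/
def mergeLoop : Prog :=
  .while (.nlt 2 10)
    (.ite (.nlt 6 7)
      (.ite (.nlt 4 5)
        (.seq (block [.rload 0 4, .rload 1 6]) (.ite (.rle 0 1) (moveCell 4) (moveCell 6)))
        (moveCell 6))
      (moveCell 4))

/-! ### Merging two sorted runs -/

section Merging

variable {P : Problem} {L : ℕ}

theorem runs_moveCell {r : ℕ} {s : State} (hr : r ≠ 2) (h1 : s.nreg 11 = 1) :
    Runs P L (moveCell r) s 4 0 fun s' =>
      Appends s s' [s.rmem (s.nreg r)] ∧ s'.nreg r = s.nreg r + 1 ∧ s'.nmem = s.nmem ∧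
        ∀ d, d ≠ 2 → d ≠ r → s'.nreg d = s.nreg d := by
  refine runs_block _ _ ⟨⟨?_, ?_, ?_⟩, ?_, ?_, ?_⟩
  · simp [runBlock, Instr.apply, h1, hr, hr.symm]
  · intro a ha
    simp [runBlock, Instr.apply, ha.ne]
  · simp [runBlock, Instr.apply, Seg]
  · simp [runBlock, Instr.apply, h1, hr]
  · simp [runBlock, Instr.apply]
  · intro d h2 h3
    simp [runBlock, Instr.apply, h2, h3]

/-- Both runs lie below the write pointer, so writing does not destroy them, and each iteration
brings the pointer one cell closer to the end address in register 10. An iteration costs at most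
four tests, two loads and the four instructions of `moveCell`, hence the factor 10. -/
theorem runs_mergeLoop (m : ℕ) : ∀ (xs ys : List ℝ) (s : State), xs.length + ys.length = m →
    Seg s.rmem (s.nreg 4) xs → Seg s.rmem (s.nreg 6) ys →
    s.nreg 4 + xs.length = s.nreg 5 → s.nreg 6 + ys.length = s.nreg 7 →
    s.nreg 5 ≤ s.nreg 2 → s.nreg 7 ≤ s.nreg 2 → s.nreg 10 = s.nreg 2 + m → s.nreg 11 = 1 →
    Runs P L mergeLoop s (10 * m + 1) 0 fun s' =>
      Appends s s' (xs.merge ys fun a b => decide (a ≤ b)) ∧ s'.nmem = s.nmem ∧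
        ∀ d, d ≠ 2 → d ≠ 4 → d ≠ 6 → s'.nreg d = s.nreg d := by
  induction m with
  | zero =>
    intro xs ys s hm _ _ _ _ _ _ h10 _
    obtain rfl : xs = [] := List.length_eq_zero_iff.1 (by omega)
    obtain rfl : ys = [] := List.length_eq_zero_iff.1 (by simpa using hm)
    refine runs_while_done (by simp [Test.Holds, h10]) ⟨⟨?_, ?_, ?_⟩, rfl, ?_⟩ <;> simp [Seg]
  | succ m ih =>
    intro xs ys s hm hx hy h5 h7 h52 h72 h10 h11
    -- the two ways to make one step
    have stepX : ∀ x xs', xs = x :: xs' →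
        (xs.merge ys fun a b => decide (a ≤ b)) = x :: (xs'.merge ys fun a b => decide (a ≤ b)) →
        ∀ s1 : State, (s1.nreg = s.nreg ∧ s1.rmem = s.rmem ∧ s1.nmem = s.nmem) →
        Runs P L (moveCell 4) s1 4 0 fun s' => Runs P L mergeLoop s' (10 * m + 1) 0 fun s' =>
          Appends s s' (xs.merge ys fun a b => decide (a ≤ b)) ∧ s'.nmem = s.nmem ∧
          ∀ d, d ≠ 2 → d ≠ 4 → d ≠ 6 → s'.nreg d = s.nreg d := by
      rintro x xs' rfl he s1 ⟨e1, e2, e3⟩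
      have hl : (x :: xs').length = xs'.length + 1 := rfl
      refine (runs_moveCell (r := 4) (by decide) (by rw [e1, h11])).mono le_rfl le_rfl ?_
      rintro s' ⟨ha, h4', hn, hf⟩
      rw [e1, e2, hx.1] at ha
      have ha : Appends s s' [x] := ⟨by rw [ha.ptr, e1],
        fun a h => by rw [ha.below a (by rwa [e1]), e2], by simpa [e1] using ha.seg⟩
      have hp := ha.ptr
      simp only [List.length_singleton] at hp
      rw [e1] at h4' hf
      refine (ih xs' ys s' (by omega) ?_ ?_ ?_ ?_ ?_ ?_ ?_ ?_).mono le_rfl le_rfl ?_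
      · rw [h4']
        exact ha.seg_below hx.2 (by omega)
      · rw [hf 6 (by decide) (by decide)]
        exact ha.seg_below hy (by omega)
      · rw [h4', hf 5 (by decide) (by decide)]; omega
      · rw [hf 6 (by decide) (by decide), hf 7 (by decide) (by decide)]; omega
      · rw [hf 5 (by decide) (by decide)]; omega
      · rw [hf 7 (by decide) (by decide)]; omega
      · rw [hf 10 (by decide) (by decide)]; omega
      · rw [hf 11 (by decide) (by decide)]; omega
      · rintro s'' ⟨ha', hn', hf'⟩
        refine ⟨?_, by rw [hn', hn, e3], fun d h2 h4 h6 => by rw [hf' d h2 h4 h6, hf d h2 h4]⟩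
        rw [he]
        exact ha.trans ha'
    have stepY : ∀ y ys', ys = y :: ys' →
        (xs.merge ys fun a b => decide (a ≤ b)) = y :: (xs.merge ys' fun a b => decide (a ≤ b)) →
        ∀ s1 : State, (s1.nreg = s.nreg ∧ s1.rmem = s.rmem ∧ s1.nmem = s.nmem) →
        Runs P L (moveCell 6) s1 4 0 fun s' => Runs P L mergeLoop s' (10 * m + 1) 0 fun s' =>
          Appends s s' (xs.merge ys fun a b => decide (a ≤ b)) ∧ s'.nmem = s.nmem ∧
          ∀ d, d ≠ 2 → d ≠ 4 → d ≠ 6 → s'.nreg d = s.nreg d := by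
      rintro y ys' rfl he s1 ⟨e1, e2, e3⟩
      have hl : (y :: ys').length = ys'.length + 1 := rfl
      refine (runs_moveCell (r := 6) (by decide) (by rw [e1, h11])).mono le_rfl le_rfl ?_
      rintro s' ⟨ha, h6', hn, hf⟩
      rw [e1, e2, hy.1] at ha
      have ha : Appends s s' [y] := ⟨by rw [ha.ptr, e1],
        fun a h => by rw [ha.below a (by rwa [e1]), e2], by simpa [e1] using ha.seg⟩
      have hp := ha.ptr
      simp only [List.length_singleton] at hp
      rw [e1] at h6' hf
      refine (ih xs ys' s' (by omega) ?_ ?_ ?_ ?_ ?_ ?_ ?_ ?_).mono le_rfl le_rfl ?_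
      · rw [hf 4 (by decide) (by decide)]
        exact ha.seg_below hx (by omega)
      · rw [h6']
        exact ha.seg_below hy.2 (by omega)
      · rw [hf 4 (by decide) (by decide), hf 5 (by decide) (by decide)]; omega
      · rw [h6', hf 7 (by decide) (by decide)]; omega
      · rw [hf 5 (by decide) (by decide)]; omega
      · rw [hf 7 (by decide) (by decide)]; omega
      · rw [hf 10 (by decide) (by decide)]; omega
      · rw [hf 11 (by decide) (by decide)]; omega
      · rintro s'' ⟨ha', hn', hf'⟩
        refine ⟨?_, by rw [hn', hn, e3], fun d h2 h4 h6 => by rw [hf' d h2 h4 h6, hf d h2 h6]⟩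
        rw [he]
        exact ha.trans ha'
    refine (runs_while_step (T := 9) (T' := 10 * m + 1) (post := fun s' =>
      Runs P L mergeLoop s' (10 * m + 1) 0 fun s' =>
          Appends s s' (xs.merge ys fun a b => decide (a ≤ b)) ∧ s'.nmem = s.nmem ∧
          ∀ d, d ≠ 2 → d ≠ 4 → d ≠ 6 → s'.nreg d = s.nreg d)
      (by simp [Test.Holds, h10]) ?_ fun s' h => h).mono (by omega) le_rfl fun _ h => h
    refine runs_ite (T := 8) (fun h6 => ?_) fun h6 => ?_
    · have h6 : s.nreg 6 < s.nreg 7 := h6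
      obtain ⟨y, ys', rfl⟩ := List.exists_cons_of_length_pos (l := ys) (by omega)
      refine runs_ite (T := 7) (fun h4 => ?_) fun h4 => ?_
      · have h4 : s.nreg 4 < s.nreg 5 := h4
        obtain ⟨x, xs', rfl⟩ := List.exists_cons_of_length_pos (l := xs) (by omega)
        refine Runs.seq (T := 2) (T' := 5) (Q := 0) (Q' := 0) (post := fun s1 =>
          (s1.nreg = s.nreg ∧ s1.rmem = s.rmem ∧ s1.nmem = s.nmem) ∧
            s1.rreg 0 = x ∧ s1.rreg 1 = y) (runs_block _ _ ?_) ?_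
        · simp [runBlock, Instr.apply, hx.1, hy.1]
        · rintro s1 ⟨e, hx1, hy1⟩
          refine runs_ite (T := 4) (fun hle => ?_) fun hle => ?_
          · have hle : s1.rreg 0 ≤ s1.rreg 1 := hle
            rw [hx1, hy1] at hle
            exact stepX x xs' rfl (by rw [List.cons_merge_cons, if_pos (by simpa using hle)]) s1 e
          · have hle : ¬ s1.rreg 0 ≤ s1.rreg 1 := hle
            rw [hx1, hy1] at hle
            exact stepY y ys' rfl (by rw [List.cons_merge_cons, if_neg (by simpa using hle)]) s1 e
      · have h4 : ¬ s.nreg 4 < s.nreg 5 := h4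
        obtain rfl : xs = [] := List.length_eq_zero_iff.1 (by omega)
        exact (stepY y ys' rfl (by simp) s ⟨rfl, rfl, rfl⟩).mono (by omega) le_rfl fun _ h => h
    · have h6 : ¬ s.nreg 6 < s.nreg 7 := h6
      obtain rfl : ys = [] := List.length_eq_zero_iff.1 (by omega)
      obtain ⟨x, xs', rfl⟩ := List.exists_cons_of_length_pos (l := xs) (by simp at hm; omega)
      exact (stepX x xs' rfl (by simp) s ⟨rfl, rfl, rfl⟩).mono (by omega) le_rfl fun _ h => h

end Merging

/-- The list is a concatenation of sorted runs of length `w`, of which the last may be shorter. -/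
inductive Chunked (w : ℕ) : List ℝ → Prop where
  | last {l : List ℝ} (hs : l.Pairwise (· ≤ ·)) (hl : l.length ≤ w) : Chunked w l
  | app {l l' : List ℝ} (hs : l.Pairwise (· ≤ ·)) (hl : l.length = w) (h : Chunked w l') :
      Chunked w (l ++ l')

theorem chunked_one (l : List ℝ) : Chunked 1 l := by
  induction l with
  | nil => exact .last .nil (by simp)
  | cons x l ih => exact .app (l := [x]) (List.pairwise_singleton _ _) rfl ih

/-- The exit condition of the sorting loop: once the run length reaches the list length, there is
only one run. -/
theorem Chunked.pairwise {w : ℕ} {l : List ℝ} (h : Chunked w l) (hl : l.length ≤ w) :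
    l.Pairwise (· ≤ ·) := by
  cases h with
  | last hs _ => exact hs
  | @app l l' hs hl' _ =>
    rw [List.length_append] at hl
    obtain rfl : l' = [] := List.length_eq_zero_iff.1 (by omega)
    simpa using hs

/-- The first run of a nonempty list. -/
theorem Chunked.uncons {w : ℕ} {l : List ℝ} (h : Chunked w l) :
    ∃ x l', l = x ++ l' ∧ x.Pairwise (· ≤ ·) ∧ x.length = min w l.length ∧ Chunked w l' := by
  cases h with
  | last hs hl => exact ⟨l, [], by simp, hs, by omega, .last .nil (by simp)⟩
  | app hs hl h => exact ⟨_, _, rfl, hs, by simp [hl], h⟩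

theorem pairwise_merge_le {l l' : List ℝ} (h : l.Pairwise (· ≤ ·)) (h' : l'.Pairwise (· ≤ ·)) :
    (l.merge l' fun a b => decide (a ≤ b)).Pairwise (· ≤ ·) := by
  have := List.pairwise_merge (le := fun a b : ℝ => decide (a ≤ b))
    (fun a b c h1 h2 => by simp at *; linarith) (fun a b => by simpa using le_total a b) l l'
    (by simpa using h) (by simpa using h')
  simpa using this

/-- Merge the runs of the current list pairwise. -/
def mergePass : Prog :=
  .while (.nlt 4 9)
    (.seq (block [
        -- `nreg 5 := min (nreg 4 + nreg 8) (nreg 9)`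
        .nadd 5 4 8, .nsub 12 5 9, .nsub 5 5 12,
        -- `nreg 7 := min (nreg 5 + nreg 8) (nreg 9)`
        .nadd 7 5 8, .nsub 12 7 9, .nsub 7 7 12,
        .nconst 12 0, .nadd 6 5 12,
        .nsub 10 7 4, .nadd 10 10 2])
      (.seq mergeLoop (block [.nconst 12 0, .nadd 4 7 12])))

/-! ### Bottom-up merge sort: one pass, and the doubling of the run length -/

section Passes

variable {P : Problem} {L : ℕ}

/-- A round merges the next two runs and leaves the rest for the induction; `m` only bounds the
length. The fixed overhead of 14 steps per round is charged to the at least one entry that the round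
consumes, which turns 10 steps per entry into 24. -/
theorem runs_mergePass {w : ℕ} (hw : 0 < w) (m : ℕ) : ∀ (l : List ℝ) (s : State), l.length ≤ m →
    Chunked w l → Seg s.rmem (s.nreg 4) l → s.nreg 4 + l.length = s.nreg 9 →
    s.nreg 9 ≤ s.nreg 2 → s.nreg 8 = w → s.nreg 11 = 1 →
    Runs P L mergePass s (24 * l.length + 1) 0 fun s' =>
      (∃ l', Appends s s' l' ∧ l'.Perm l ∧ Chunked (2 * w) l') ∧ s'.nmem = s.nmem ∧
        ∀ d, d = 1 ∨ d = 3 ∨ d = 8 ∨ d = 9 ∨ d = 11 ∨ d = 13 → s'.nreg d = s.nreg d := by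
  induction m with
  | zero =>
    intro l s hl _ _ h9 _ _ _
    obtain rfl : l = [] := List.length_eq_zero_iff.1 (by omega)
    refine (runs_while_done (by simp at h9; simp [Test.Holds, h9]) ?_).mono (by simp) le_rfl
      fun _ h => h
    refine ⟨⟨[], ⟨by simp, by simp, trivial⟩, .nil, .last .nil (by simp)⟩, rfl, by simp⟩
  | succ m ih =>
    intro l s hlm hc hs h9 h92 h8 h11
    rcases l.eq_nil_or_concat with rfl | ⟨_, _, hne⟩
    · exact (ih [] s (by simp) hc hs h9 h92 h8 h11)
    have hpos : 0 < l.length := by rw [hne]; simp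
    clear hne
    obtain ⟨x, l1, e1, hx, hxl, hc1⟩ := hc.uncons
    obtain ⟨y, l2, e2, hy, hyl, hc2⟩ := hc1.uncons
    have hl1 : l.length = x.length + l1.length := by rw [e1, List.length_append]
    have hl2 : l1.length = y.length + l2.length := by rw [e2, List.length_append]
    have hs1 := hs
    rw [e1, seg_append, e2, seg_append] at hs1
    obtain ⟨sx, sy, sl⟩ := hs1
    have hmerge : (x.merge y fun a b => decide (a ≤ b)).length = x.length + y.length :=
      List.length_merge ..
    refine (runs_while_step (T := 10 + (10 * (x.length + y.length) + 1 + 2))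
      (T' := 24 * l2.length + 1) (by simp only [Test.Holds]; omega)
      (post := fun s' => Appends s s' (x.merge y fun a b => decide (a ≤ b)) ∧ s'.nmem = s.nmem ∧
        s'.nreg 4 = s.nreg 4 + x.length + y.length ∧
        ∀ d, d = 1 ∨ d = 3 ∨ d = 8 ∨ d = 9 ∨ d = 11 ∨ d = 13 → s'.nreg d = s.nreg d)
      ?_ ?_).mono (by omega) le_rfl fun _ h => h
    · refine Runs.seq (Q := 0) (Q' := 0) (post := fun s1 => s1.rmem = s.rmem ∧ s1.nmem = s.nmem ∧
        s1.nreg 4 = s.nreg 4 ∧ s1.nreg 5 = s.nreg 4 + x.length ∧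
        s1.nreg 6 = s.nreg 4 + x.length ∧ s1.nreg 7 = s.nreg 4 + x.length + y.length ∧
        s1.nreg 10 = s.nreg 2 + (x.length + y.length) ∧ s1.nreg 2 = s.nreg 2 ∧
        ∀ d, d = 1 ∨ d = 3 ∨ d = 8 ∨ d = 9 ∨ d = 11 ∨ d = 13 → s1.nreg d = s.nreg d)
        (runs_block _ _ ?_) ?_
      -- The minimum of `a` and `b` is computed as `a - (a - b)` with truncated subtraction;
      -- `Chunked.uncons` gives the lengths of the runs as the same minima.
      · simp [runBlock, Instr.apply]
        omega
      · rintro s1 ⟨e1, e2, e4, e5, e6, e7, e10, ep, ef⟩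
        refine Runs.seq (Q := 0) (Q' := 0) (runs_mergeLoop (x.length + y.length) x y s1 rfl
          ?_ ?_ ?_ ?_ ?_ ?_ ?_ ?_) ?_
        · rwa [e1, e4]
        · rwa [e1, e6]
        · omega
        · omega
        · omega
        · omega
        · omega
        · rw [ef 11 (by simp), h11]
        · rintro s2 ⟨ha, hn, hf⟩
          refine runs_block _ _ ⟨⟨?_, ?_, ?_⟩, ?_, ?_, ?_⟩
          · simpa [runBlock, Instr.apply, ep] using ha.ptr
          · intro a h
            simpa [runBlock, Instr.apply, e1] using ha.below a (by omega)
          · simpa [runBlock, Instr.apply, ep] using ha.seg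
          · simp [runBlock, Instr.apply, hn, e2]
          · simp [runBlock, Instr.apply]
            rw [hf 7 (by decide) (by decide) (by decide), e7]
          · rintro d hd
            have : d ≠ 4 ∧ d ≠ 12 ∧ d ≠ 2 ∧ d ≠ 6 := by omega
            simp [runBlock, Instr.apply, this.1, this.2.1]
            rw [hf d this.2.2.1 this.1 this.2.2.2, ef d hd]
    · rintro s' ⟨ha, hn, h4, hf⟩
      have hp := ha.ptr
      rw [hmerge] at hp
      refine (ih l2 s' ?_ hc2 ?_ ?_ ?_ ?_ ?_).mono le_rfl le_rfl ?_
      · omega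
      · rw [h4]
        exact ha.seg_below sl (by omega)
      · rw [h4, hf 9 (by simp)]; omega
      · rw [hf 9 (by simp)]; omega
      · rw [hf 8 (by simp), h8]
      · rw [hf 11 (by simp), h11]
      · rintro s'' ⟨⟨l', ha', hperm, hch⟩, hn', hf'⟩
        refine ⟨⟨_, ha.trans ha', ?_, ?_⟩, by rw [hn', hn], fun d hd => by rw [hf' d hd, hf d hd]⟩
        · rw [e1, e2, ← List.append_assoc]
          exact (List.merge_perm_append ..).append hperm
        · have hlen' := hperm.length_eq
          -- If nothing remains, the merged run is the last one and may be short. Otherwise `x` and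
          -- `y` both have full length `w`, so the merged run has length exactly `2 * w`.
          by_cases h0 : l2.length = 0
          · obtain rfl : l' = [] := List.length_eq_zero_iff.1 (by omega)
            exact .last (by simpa using pairwise_merge_le hx hy) (by simp; omega)
          · exact .app (pairwise_merge_le hx hy) (by rw [hmerge]; omega) hch

/-- Sort the list of length `nreg 1` that starts at address `0` and ends at address `nreg 2`. -/
def sortProg : Prog :=
  .seq (block [.nconst 11 1, .nconst 8 1, .nconst 13 0])
    (.while (.nlt 8 1)
      (.seq (block [.nconst 12 0, .nadd 4 13 12, .nadd 9 2 12])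
        (.seq mergePass (block [.nconst 12 0, .nadd 13 9 12, .nadd 8 8 8]))))

/-- `k` bounds the number of remaining passes: `w` doubles in each pass and `w * 2 ^ k` stays at
least the length of the list. Each pass writes a fresh copy behind the old one, so the current list
always ends at the write pointer and its start moves. -/
theorem runs_sortLoop (l0 : List ℝ) (k : ℕ) : ∀ (l : List ℝ) (w : ℕ) (s : State), 0 < w →
    l0.length ≤ w * 2 ^ k → l.Perm l0 → Chunked w l → Seg s.rmem (s.nreg 13) l →
    s.nreg 13 + l.length = s.nreg 2 → s.nreg 8 = w → s.nreg 1 = l.length → s.nreg 11 = 1 →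
    Runs P L (.while (.nlt 8 1)
      (.seq (block [.nconst 12 0, .nadd 4 13 12, .nadd 9 2 12])
        (.seq mergePass (block [.nconst 12 0, .nadd 13 9 12, .nadd 8 8 8])))) s
      (k * (24 * l0.length + 8) + 1) 0 fun s' =>
      (∃ l', l'.Perm l0 ∧ l'.Pairwise (· ≤ ·) ∧ Seg s'.rmem (s'.nreg 13) l' ∧
        s'.nreg 13 + l'.length = s'.nreg 2) ∧ s'.nreg 1 = s.nreg 1 ∧ s'.nreg 3 = s.nreg 3 ∧
        s'.nreg 11 = 1 := by
  have done : ∀ (l : List ℝ) (s : State), l.Perm l0 → l.Pairwise (· ≤ ·) →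
      Seg s.rmem (s.nreg 13) l → s.nreg 13 + l.length = s.nreg 2 → s.nreg 11 = 1 →
      (∃ l' : List ℝ, l'.Perm l0 ∧ l'.Pairwise (· ≤ ·) ∧ Seg s.rmem (s.nreg 13) l' ∧
        s.nreg 13 + l'.length = s.nreg 2) ∧ s.nreg 1 = s.nreg 1 ∧ s.nreg 3 = s.nreg 3 ∧
        s.nreg 11 = 1 := fun l s h1 h2 h3 h4 h5 => ⟨⟨l, h1, h2, h3, h4⟩, rfl, rfl, h5⟩
  induction k with
  | zero =>
    intro l w s hw hlw hp hc hs h2 h8 h1 h11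
    have hpl := hp.length_eq
    refine (runs_while_done (by simp only [Test.Holds]; omega)
      (done l s hp (hc.pairwise (by omega)) hs h2 h11)).mono (by simp) le_rfl fun _ h => h
  | succ k ih =>
    intro l w s hw hlw hp hc hs h2 h8 h1 h11
    have hpl := hp.length_eq
    by_cases hwl : w < l.length
    swap
    · exact (runs_while_done (by simp only [Test.Holds]; omega)
        (done l s hp (hc.pairwise (by omega)) hs h2 h11)).mono (by omega) le_rfl fun _ h => h
    refine (runs_while_step (T := 3 + (24 * l.length + 1 + 3))
      (T' := k * (24 * l0.length + 8) + 1) (by simp only [Test.Holds]; omega)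
      (post := fun s' => (∃ l' : List ℝ, l'.Perm l ∧ Chunked (2 * w) l' ∧
        Seg s'.rmem (s'.nreg 13) l' ∧ s'.nreg 13 + l'.length = s'.nreg 2) ∧ s'.nreg 8 = 2 * w ∧
        s'.nreg 1 = s.nreg 1 ∧ s'.nreg 3 = s.nreg 3 ∧ s'.nreg 11 = 1)
      ?_ ?_).mono (by rw [← hpl]; ring_nf; omega) le_rfl fun _ h => h
    · refine Runs.seq (Q := 0) (Q' := 0) (post := fun s1 => s1.rmem = s.rmem ∧
        s1.nreg 4 = s.nreg 13 ∧ s1.nreg 9 = s.nreg 2 ∧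
        ∀ d, d = 1 ∨ d = 2 ∨ d = 3 ∨ d = 8 ∨ d = 11 ∨ d = 13 → s1.nreg d = s.nreg d)
        (runs_block _ _ ?_) ?_
      · refine ⟨?_, ?_, ?_, ?_⟩ <;> simp [runBlock, Instr.apply]
      · rintro s1 ⟨e1, e4, e9, ef⟩
        have f2 := ef 2 (by simp)
        have f8 := ef 8 (by simp)
        refine Runs.seq (Q := 0) (Q' := 0) (runs_mergePass hw l.length l s1 le_rfl hc
          (by rwa [e1, e4]) (by omega) (by omega) (by omega)
          (by rw [ef 11 (by simp), h11])) ?_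
        rintro s2 ⟨⟨l', ha, hperm, hch⟩, hn, hf⟩
        have g9 := hf 9 (by simp)
        have g8 := hf 8 (by simp)
        have hap := ha.ptr
        refine runs_block _ _ ⟨⟨l', hperm, hch, ?_, ?_⟩, ?_, ?_, ?_, ?_⟩
        · have := ha.seg
          rw [f2, ← e9, ← g9] at this
          simpa [runBlock, Instr.apply] using this
        · simp [runBlock, Instr.apply]; omega
        · simp [runBlock, Instr.apply]; omega
        · simp [runBlock, Instr.apply, hf, ef]
        · simp [runBlock, Instr.apply, hf, ef]
        · simp [runBlock, Instr.apply, hf, ef, h11]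
    · rintro s' ⟨⟨l', hp', hc', hs', he'⟩, g8, g1, g3, g11⟩
      refine (ih l' (2 * w) s' (by omega) ?_ (hp'.trans hp) hc' hs' he' g8
        (by rw [g1, h1, hp'.length_eq]) g11).mono le_rfl le_rfl ?_
      · rw [pow_succ] at hlw; linarith
      · rintro s'' ⟨h1, h2, h3, h4⟩
        exact ⟨h1, by rw [h2, g1], by rw [h3, g3], h4⟩

theorem runs_sortProg (l : List ℝ) (k : ℕ) (hk : l.length ≤ 2 ^ k) (s : State)
    (hs : Seg s.rmem 0 l) (h1 : s.nreg 1 = l.length) (h2 : s.nreg 2 = l.length) :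
    Runs P L sortProg s (k * (24 * l.length + 8) + 4) 0 fun s' =>
      (∃ l' : List ℝ, l'.Perm l ∧ l'.Pairwise (· ≤ ·) ∧ Seg s'.rmem (s'.nreg 13) l' ∧
        s'.nreg 13 + l'.length = s'.nreg 2) ∧ s'.nreg 1 = l.length ∧ s'.nreg 3 = s.nreg 3 ∧
        s'.nreg 11 = 1 := by
  refine (Runs.seq (T := 3) (T' := k * (24 * l.length + 8) + 1) (Q := 0) (Q' := 0)
    (post := fun s1 => s1.rmem = s.rmem ∧ s1.nreg 13 = 0 ∧ s1.nreg 8 = 1 ∧ s1.nreg 11 = 1 ∧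
      s1.nreg 1 = s.nreg 1 ∧ s1.nreg 2 = s.nreg 2 ∧ s1.nreg 3 = s.nreg 3)
    (runs_block _ _ ?_) ?_).mono (by omega) le_rfl fun _ h => h
  · simp [runBlock, Instr.apply]
  · rintro s1 ⟨em, e13, e8, e11, e1, e2, e3⟩
    refine (runs_sortLoop l k l 1 s1 one_pos (by simpa using hk) (.refl _) (chunked_one l)
      (by rwa [em, e13]) (by omega) e8 (by omega) e11).mono le_rfl le_rfl ?_
    rintro s' ⟨ha, hb, hc, hd⟩
    exact ⟨ha, by rw [hb, e1, h1], by rw [hc, e3], hd⟩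

end Passes

/-! ### Words that depend linearly on a sorted list -/

/-- Coefficients of a linear expression. -/
structure Lin where
  one : ℤ := 0
  big : ℤ := 0
  a : ℤ := 0
  b : ℤ := 0
  p : ℤ := 0
  q : ℤ := 0

/-- The value of a linear expression. -/
def Lin.eval (e : Lin) (M a b p q : ℝ) : ℝ :=
  e.one + e.big * M + e.a * a + e.b * b + e.p * p + e.q * q

/-- A bound for the absolute values of the entries of a sorted list. -/
def bigM (l : List ℤ) : ℤ :=
  1 + l.getD 0 0 * l.getD 0 0 + l.getD (l.length - 1) 0 * l.getD (l.length - 1) 0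

/-- The entries in increasing order. -/
def up (l : List ℤ) (i : ℕ) : ℤ := l.getD i 0

/-- The entries in decreasing order. -/
def down (l : List ℤ) (i : ℕ) : ℤ := l.getD (l.length - 1 - i) 0

/-- The previous entry in increasing order, or a sentinel. -/
def prevUp (l : List ℤ) (i : ℕ) : ℤ := if i = 0 then -10 * bigM l else up l (i - 1)

/-- The previous entry in decreasing order, or a sentinel. -/
def prevDown (l : List ℤ) (i : ℕ) : ℤ := if i = 0 then 10 * bigM l else down l (i - 1)

/-- A linear description of a word: a head, a part that is repeated for every entry of the list, and
a tail. The repeated natural numbers are shifted by `stride` every time. -/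
structure Template where
  realHead : List Lin
  realBody : List Lin
  realTail : List Lin
  natHead : List ℕ
  natBody : List ℕ
  natTail : List ℕ
  stride : ℕ

namespace Template

/-- The real part of the head. -/
def headReals (D : Template) (l : List ℤ) : List ℝ :=
  D.realHead.map fun e => e.eval (bigM l) 0 0 (prevUp l 0) (prevDown l 0)

/-- The real part of copy `i` of the body. -/
def bodyReals (D : Template) (l : List ℤ) (i : ℕ) : List ℝ :=
  D.realBody.map fun e => e.eval (bigM l) (up l i) (down l i) (prevUp l i) (prevDown l i)

/-- The real part of the tail. -/
def tailReals (D : Template) (l : List ℤ) : List ℝ :=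
  D.realTail.map fun e => e.eval (bigM l) 0 0 (prevUp l l.length) (prevDown l l.length)

/-- The word that is described by the template and the list. -/
def word (D : Template) (l : List ℤ) : Word where
  nats := D.natHead ++ (List.range l.length).flatMap (fun i => D.natBody.map (· + i * D.stride)) ++
    D.natTail.map (· + l.length * D.stride)
  reals := D.headReals l ++ (List.range l.length).flatMap (D.bodyReals l) ++ D.tailReals l

theorem length_flatMap_range {α : Type*} (f : ℕ → List α) (c n : ℕ) (h : ∀ i, (f i).length = c) :
    ((List.range n).flatMap f).length = n * c := by
  induction n with
  | zero => simp
  | succ n ih => rw [List.range_succ, List.flatMap_append]; simp [ih, h]; ring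

/-- The factor in the size of the word. -/
def sizeFactor (D : Template) : ℕ :=
  D.realHead.length + D.realBody.length + D.realTail.length +
    (D.natHead.length + D.natBody.length + D.natTail.length)

theorem size_word_le (D : Template) (l : List ℤ) :
    (D.word l).size ≤ D.sizeFactor * (l.length + 1) := by
  have h1 : (D.word l).reals.length =
      D.realHead.length + l.length * D.realBody.length + D.realTail.length := by
    simp only [word, List.length_append, headReals, tailReals, List.length_map]
    rw [length_flatMap_range _ D.realBody.length]
    intro i
    simp [bodyReals]
  have h2 : (D.word l).nats.length =
      D.natHead.length + l.length * D.natBody.length + D.natTail.length := by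
    simp only [word, List.length_append, List.length_map]
    rw [length_flatMap_range _ D.natBody.length]
    simp
  rw [Word.size, h1, h2, sizeFactor]
  nlinarith [Nat.zero_le (l.length * D.realHead.length), Nat.zero_le (l.length * D.realTail.length),
    Nat.zero_le (l.length * D.natHead.length), Nat.zero_le (l.length * D.natTail.length)]

end Template

/-! ### The program that writes such a word

Integer registers: `2`, `3` ends of the written real and integer memory, `11` the constant one, `12`
scratch, `13` start of the sorted list, `14`, `17` addresses of the current entries in increasing and
decreasing order, `15` shift, `16` start of the word, `18` end of the sorted list. Real registers: `3`
to `7` the arguments of the linear expressions. -/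

/-- Append the value of a linear expression. -/
def emit (e : Lin) : List Instr :=
  [.rconst 0 e.one, .rconst 1 e.big, .rmul 1 1 3, .radd 0 0 1, .rconst 1 e.a, .rmul 1 1 4,
    .radd 0 0 1, .rconst 1 e.b, .rmul 1 1 5, .radd 0 0 1, .rconst 1 e.p, .rmul 1 1 6, .radd 0 0 1,
    .rconst 1 e.q, .rmul 1 1 7, .radd 0 0 1, .rstore 2 0, .nadd 2 2 11]

/-- Append the values of linear expressions. -/
def emits : List Lin → Prog
  | [] => .skip
  | e :: es => .seq (block (emit e)) (emits es)

/-- Append shifted natural numbers. -/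
def nemits : List ℕ → Prog
  | [] => .skip
  | c :: cs => .seq (block [.nconst 12 c, .nadd 12 12 15, .nstore 3 12, .nadd 3 3 11]) (nemits cs)

/-! ### Writing linear expressions and shifted indices -/

section Emission

variable {P : Problem} {L : ℕ}

theorem runs_skip {s : State} {post : State → Prop} (h : post s) : Runs P L .skip s 0 0 post :=
  ⟨_, _, _, .skip s, le_rfl, le_rfl, h⟩

theorem runs_emits (es : List Lin) : ∀ s : State, s.nreg 11 = 1 →
    Runs P L (emits es) s (18 * es.length) 0 fun s' =>
      Appends s s' (es.map fun e =>
        e.eval (s.rreg 3) (s.rreg 4) (s.rreg 5) (s.rreg 6) (s.rreg 7)) ∧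
      s'.nmem = s.nmem ∧ (∀ d, 2 ≤ d → s'.rreg d = s.rreg d) ∧ ∀ d, d ≠ 2 → s'.nreg d = s.nreg d := by
  induction es with
  | nil => exact fun s _ => runs_skip ⟨⟨by simp, by simp, trivial⟩, rfl, by simp, by simp⟩
  | cons e es ih =>
    intro s h11
    refine (Runs.seq (T := 18) (T' := 18 * es.length) (Q := 0) (Q' := 0) (post := fun s1 =>
      Appends s s1 [e.eval (s.rreg 3) (s.rreg 4) (s.rreg 5) (s.rreg 6) (s.rreg 7)] ∧
      s1.nmem = s.nmem ∧ (∀ d, 2 ≤ d → s1.rreg d = s.rreg d) ∧ ∀ d, d ≠ 2 → s1.nreg d = s.nreg d)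
      (runs_block _ _ ?_) ?_).mono (by simp; omega) le_rfl fun _ h => h
    · refine ⟨⟨?_, ?_, ?_⟩, ?_, ?_, ?_⟩
      · simp [emit, runBlock, Instr.apply, h11]
      · intro a ha
        simp [emit, runBlock, Instr.apply, ha.ne]
      · simp [emit, runBlock, Instr.apply, Seg, Lin.eval]
      · simp [emit, runBlock, Instr.apply]
      · intro d hd
        have : d ≠ 0 ∧ d ≠ 1 := by omega
        simp [emit, runBlock, Instr.apply, this]
      · intro d hd
        simp [emit, runBlock, Instr.apply, hd]
    · rintro s1 ⟨ha, hn, hr, hf⟩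
      refine (ih s1 (by rw [hf 11 (by decide), h11])).mono le_rfl le_rfl ?_
      rintro s2 ⟨ha', hn', hr', hf'⟩
      refine ⟨?_, by rw [hn', hn], fun d hd => by rw [hr' d hd, hr d hd],
        fun d hd => by rw [hf' d hd, hf d hd]⟩
      have := ha.trans ha'
      rw [hr 3 (by decide), hr 4 (by decide), hr 5 (by decide), hr 6 (by decide),
        hr 7 (by decide)] at this
      simpa using this

theorem runs_nemits (cs : List ℕ) : ∀ s : State, s.nreg 11 = 1 →
    Runs P L (nemits cs) s (4 * cs.length) 0 fun s' =>
      NAppends s s' (cs.map (· + s.nreg 15)) ∧ s'.rmem = s.rmem ∧ s'.rreg = s.rreg ∧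
        ∀ d, d ≠ 3 → d ≠ 12 → s'.nreg d = s.nreg d := by
  induction cs with
  | nil => exact fun s _ => runs_skip ⟨⟨by simp, by simp, trivial⟩, rfl, rfl, by simp⟩
  | cons c cs ih =>
    intro s h11
    refine (Runs.seq (T := 4) (T' := 4 * cs.length) (Q := 0) (Q' := 0) (post := fun s1 =>
      NAppends s s1 [c + s.nreg 15] ∧ s1.rmem = s.rmem ∧ s1.rreg = s.rreg ∧
        ∀ d, d ≠ 3 → d ≠ 12 → s1.nreg d = s.nreg d)
      (runs_block _ _ ?_) ?_).mono (by simp; omega) le_rfl fun _ h => h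
    · refine ⟨⟨?_, ?_, ?_⟩, ?_, ?_, ?_⟩
      · simp [runBlock, Instr.apply, h11]
      · intro a ha
        simp [runBlock, Instr.apply, ha.ne]
      · simp [runBlock, Instr.apply, Seg]
      · simp [runBlock, Instr.apply]
      · simp [runBlock, Instr.apply]
      · intro d hd hd'
        simp [runBlock, Instr.apply, hd, hd']
    · rintro s1 ⟨ha, hn, hr, hf⟩
      refine (ih s1 (by rw [hf 11 (by decide) (by decide), h11])).mono le_rfl le_rfl ?_
      rintro s2 ⟨ha', hn', hr', hf'⟩
      refine ⟨?_, by rw [hn', hn], by rw [hr', hr],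
        fun d hd hd' => by rw [hf' d hd hd', hf d hd hd']⟩
      have := ha.trans ha'
      rw [hf 15 (by decide) (by decide)] at this
      simpa using this

end Emission

namespace Template

/-- Preparation of the registers. -/
def setup : List Instr :=
  [.nconst 12 0, .nadd 14 13 12, .nsub 17 2 11, .nadd 18 2 12, .nadd 16 2 12, .nconst 15 0,
    -- The squares of the first and last entry give `bigM`. The sentinels go to registers 6 and 7,
    -- and registers 4 and 5 are cleared because the head has no current entry.
    .rload 4 14, .rload 5 17, .rmul 4 4 4, .rmul 5 5 5, .rconst 3 1, .radd 3 3 4, .radd 3 3 5,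
    .rconst 6 (-10), .rmul 6 6 3, .rconst 7 10, .rmul 7 7 3, .rconst 4 0, .rconst 5 0]

/-- Write one copy of the body. -/
def bodyProg (D : Template) : Prog :=
  .seq (block [.rload 4 14, .rload 5 17]) (.seq (emits D.realBody) (.seq (nemits D.natBody)
    (block [.rconst 0 0, .radd 6 4 0, .radd 7 5 0, .nadd 14 14 11, .nsub 17 17 11,
      .nconst 12 D.stride, .nadd 15 15 12])))

/-- Write the word. -/
def writeProg (D : Template) : Prog :=
  .seq (block setup) (.seq (emits D.realHead) (.seq (nemits D.natHead)
    (.seq (.while (.nlt 14 18) D.bodyProg)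
      (.seq (block [.rconst 4 0, .rconst 5 0]) (.seq (emits D.realTail) (nemits D.natTail))))))

/-- Sort, write the word, and ask. -/
def prog (D : Template) : Prog :=
  .ite (.nlt 0 1)
    (.seq (block [.nadd 2 1 0]) (.seq sortProg (.seq D.writeProg
      (.seq (block [.nconst 12 0, .nsub 19 2 16]) (.query 0 12 3 16 19)))))
    .skip

/-- The invariant of the main loop, before iteration `k`; `s0` is the state before the writing. -/
structure Inv (D : Template) (l : List ℤ) (s0 : State) (k : ℕ) (s : State) : Prop where
  app : Appends s0 s (D.headReals l ++ (List.range k).flatMap (D.bodyReals l))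
  napp : NAppends s0 s
    (D.natHead ++ (List.range k).flatMap fun i => D.natBody.map (· + i * D.stride))
  r3 : s.rreg 3 = bigM l
  r6 : s.rreg 6 = prevUp l k
  r7 : s.rreg 7 = prevDown l k
  n11 : s.nreg 11 = 1
  n14 : s.nreg 14 = s0.nreg 13 + k
  n15 : s.nreg 15 = k * D.stride
  n16 : s.nreg 16 = s0.nreg 2
  n17 : s.nreg 17 = s0.nreg 13 + l.length - 1 - k
  n18 : s.nreg 18 = s0.nreg 2

variable {P : Problem} {L : ℕ}

/-- The sorted list lies below the start of the word, so it can still be read while the word grows.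
At the end of the iteration the current entries become the previous ones, which is why two registers
suffice for the look-back. -/
theorem runs_body (D : Template) (l : List ℤ) (s0 : State)
    (hs : Seg s0.rmem (s0.nreg 13) (l.map fun a : ℤ => (a : ℝ)))
    (he : s0.nreg 13 + l.length = s0.nreg 2) (k : ℕ) (s : State) (hk : k < l.length)
    (hI : D.Inv l s0 k s) :
    Runs P L D.bodyProg s (18 * D.realBody.length + 4 * D.natBody.length + 9) 0
      (D.Inv l s0 (k + 1)) := by
  have get : ∀ j < l.length, s.rmem (s0.nreg 13 + j) = ((l.getD j 0 : ℤ) : ℝ) := by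
    intro j hj
    rw [hI.app.below _ (by omega), hs.get j (by simpa using hj)]
    simp [hj]
  have g4 : s.rmem (s.nreg 14) = up l k := by rw [hI.n14, get k hk, up]
  have g5 : s.rmem (s.nreg 17) = down l k := by
    rw [hI.n17, show s0.nreg 13 + l.length - 1 - k = s0.nreg 13 + (l.length - 1 - k) by omega,
      get _ (by omega), down]
  refine (Runs.seq (T := 2) (Q := 0)
    (T' := 18 * D.realBody.length + (4 * D.natBody.length + 7)) (Q' := 0)
    (post := fun s1 => s1.nreg = s.nreg ∧ s1.rmem = s.rmem ∧ s1.nmem = s.nmem ∧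
      s1.rreg 3 = s.rreg 3 ∧ s1.rreg 6 = s.rreg 6 ∧ s1.rreg 7 = s.rreg 7 ∧
      s1.rreg 4 = up l k ∧ s1.rreg 5 = down l k)
    (runs_block _ _ ?_) ?_).mono (by omega) le_rfl fun _ h => h
  · simp [runBlock, Instr.apply, g4, g5]
  rintro s1 ⟨en, em, enm, e3, e6, e7, e4, e5⟩
  refine Runs.seq (Q := 0) (Q' := 0) (runs_emits _ s1 (by rw [en, hI.n11])) ?_
  rintro s2 ⟨ha, hn, hr, hf⟩
  refine Runs.seq (Q := 0) (Q' := 0) (runs_nemits _ s2 (by rw [hf 11 (by decide), en, hI.n11])) ?_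
  rintro s3 ⟨ha', hm', hr', hf'⟩
  have hreg : ∀ d, d ≠ 2 → d ≠ 3 → d ≠ 12 → s3.nreg d = s.nreg d := fun d h2 h3 h12 => by
    rw [hf' d h3 h12, hf d h2, en]
  have hrr : ∀ d, 2 ≤ d → s3.rreg d = s1.rreg d := fun d hd => by rw [hr', hr d hd]
  rw [e3, e4, e5, e6, e7, hI.r3, hI.r6, hI.r7] at ha
  have haS : Appends s s3 (D.bodyReals l k) := by
    refine ⟨?_, ?_, ?_⟩
    · rw [hf' 2 (by decide) (by decide), ha.ptr, en]; rfl
    · intro a h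
      rw [hm', ha.below a (by rwa [en]), em]
    · rw [hm', ← en]; exact ha.seg
  have hnS : NAppends s s3 (D.natBody.map (· + k * D.stride)) := by
    have h15 : s2.nreg 15 = k * D.stride := by rw [hf 15 (by decide), en, hI.n15]
    rw [h15] at ha'
    have h3 : s2.nreg 3 = s.nreg 3 := by rw [hf 3 (by decide), en]
    refine ⟨by rw [ha'.ptr, h3], fun a h => ?_, by rw [← h3]; exact ha'.seg⟩
    rw [ha'.below a (by rwa [h3]), hn, enm]
  refine runs_block _ _ ?_
  have hA := hI.app.trans haS
  have hN := hI.napp.trans hnS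
  rw [List.append_assoc] at hA hN
  constructor
  · rw [List.range_succ, List.flatMap_append, List.flatMap_singleton]
    exact ⟨by simpa [runBlock, Instr.apply] using hA.ptr,
      fun a h => by simpa [runBlock, Instr.apply] using hA.below a h,
      by simpa [runBlock, Instr.apply] using hA.seg⟩
  · rw [List.range_succ, List.flatMap_append, List.flatMap_singleton]
    exact ⟨by simpa [runBlock, Instr.apply] using hN.ptr,
      fun a h => by simpa [runBlock, Instr.apply] using hN.below a h,
      by simpa [runBlock, Instr.apply] using hN.seg⟩
  · simp [runBlock, Instr.apply, hrr, e3, hI.r3]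
  · simp [runBlock, Instr.apply, hrr, e4, prevUp]
  · simp [runBlock, Instr.apply, hrr, e5, prevDown]
  · simp [runBlock, Instr.apply, hreg, hI.n11]
  · simp [runBlock, Instr.apply, hreg, hI.n11, hI.n14]; omega
  · simp [runBlock, Instr.apply, hreg, hI.n15]; ring
  · simp [runBlock, Instr.apply, hreg, hI.n16]
  · simp [runBlock, Instr.apply, hreg, hI.n17, hI.n11]; omega
  · simp [runBlock, Instr.apply, hreg, hI.n18]

/-- Nonemptiness makes the two loads in `setup`, from the first and from the last cell of the list,
hit actual entries. -/
theorem runs_writeProg (D : Template) (l : List ℤ) (hl : l ≠ []) (s0 : State)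
    (hs : Seg s0.rmem (s0.nreg 13) (l.map fun a : ℤ => (a : ℝ)))
    (he : s0.nreg 13 + l.length = s0.nreg 2) (h11 : s0.nreg 11 = 1) :
    Runs P L D.writeProg s0
      (l.length * (18 * D.realBody.length + 4 * D.natBody.length + 10) +
        18 * (D.realHead.length + D.realTail.length) +
        4 * (D.natHead.length + D.natTail.length) + 22) 0
      fun s => Appends s0 s (D.word l).reals ∧ NAppends s0 s (D.word l).nats ∧
        s.nreg 16 = s0.nreg 2 := by
  have hpos : 0 < l.length := List.length_pos_iff.2 hl
  have get : ∀ j < l.length, s0.rmem (s0.nreg 13 + j) = ((l.getD j 0 : ℤ) : ℝ) := by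
    intro j hj
    rw [hs.get j (by simpa using hj)]
    simp [hj]
  have g0 := get 0 hpos
  have g1 : s0.rmem (s0.nreg 2 - 1) = ((l.getD (l.length - 1) 0 : ℤ) : ℝ) := by
    rw [← get _ (by omega)]; congr 1; omega
  rw [Nat.add_zero] at g0
  refine (Runs.seq (T := 19) (Q := 0) (T' := 18 * D.realHead.length + (4 * D.natHead.length +
      ((l.length * (18 * D.realBody.length + 4 * D.natBody.length + 9 + 1) + 1) +
        (2 + (18 * D.realTail.length + 4 * D.natTail.length))))) (Q' := 0)
    (post := fun s => (s.rmem = s0.rmem ∧ s.nmem = s0.nmem) ∧ (s.nreg 2 = s0.nreg 2 ∧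
      s.nreg 3 = s0.nreg 3) ∧ s.rreg 3 = bigM l ∧ (s.rreg 4 = 0 ∧ s.rreg 5 = 0) ∧
      s.rreg 6 = prevUp l 0 ∧ s.rreg 7 = prevDown l 0 ∧
      s.nreg 11 = 1 ∧ s.nreg 14 = s0.nreg 13 ∧ s.nreg 15 = 0 ∧ s.nreg 16 = s0.nreg 2 ∧
      s.nreg 17 = s0.nreg 2 - 1 ∧ s.nreg 18 = s0.nreg 2)
    (runs_block _ _ ?_) ?_).mono (by ring_nf; omega) le_rfl fun _ h => h
  · simp [setup, runBlock, Instr.apply, h11, g0, g1, bigM, prevUp, prevDown]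
  rintro s1 ⟨⟨em, enm⟩, ⟨e2, en3⟩, e3, ⟨e4, e5⟩, e6, e7, n11, n14, n15, n16, n17, n18⟩
  refine Runs.seq (Q := 0) (Q' := 0) (runs_emits _ s1 n11) ?_
  rintro s2 ⟨ha, hn, hr, hf⟩
  refine Runs.seq (Q := 0) (Q' := 0) (runs_nemits _ s2 (by rw [hf 11 (by decide), n11])) ?_
  rintro s3 ⟨ha', hm', hr', hf'⟩
  have hreg : ∀ d, d ≠ 2 → d ≠ 3 → d ≠ 12 → s3.nreg d = s1.nreg d := fun d h2 h3 h12 => by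
    rw [hf' d h3 h12, hf d h2]
  have hrr : ∀ d, 2 ≤ d → s3.rreg d = s1.rreg d := fun d hd => by rw [hr', hr d hd]
  have h0 : D.Inv l s0 0 s3 := by
    constructor
    · rw [e3, e4, e5, e6, e7] at ha
      refine ⟨?_, fun a h => ?_, ?_⟩
      · rw [hf' 2 (by decide) (by decide), ha.ptr, e2]; simp [headReals]
      · rw [hm', ha.below a (by rwa [e2]), em]
      · rw [hm', ← e2]; simpa [headReals] using ha.seg
    · have h3 : s2.nreg 3 = s0.nreg 3 := by rw [hf 3 (by decide), en3]
      rw [hf 15 (by decide), n15] at ha'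
      refine ⟨by rw [ha'.ptr, h3]; simp, fun a h => ?_, by rw [← h3]; simpa using ha'.seg⟩
      rw [ha'.below a (by rwa [h3]), hn, enm]
    · rw [hrr _ (by decide), e3]
    · rw [hrr _ (by decide), e6]
    · rw [hrr _ (by decide), e7]
    · rw [hreg _ (by decide) (by decide) (by decide), n11]
    · rw [hreg _ (by decide) (by decide) (by decide), n14]; rfl
    · rw [hreg _ (by decide) (by decide) (by decide), n15]; simp
    · rw [hreg _ (by decide) (by decide) (by decide), n16]
    · rw [hreg _ (by decide) (by decide) (by decide), n17]; omega
    · rw [hreg _ (by decide) (by decide) (by decide), n18]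
  refine Runs.seq (Q := 0) (Q' := 0) (runs_while_count (D.Inv l s0)
    (18 * D.realBody.length + 4 * D.natBody.length + 9) l.length (fun k s hk hI => ⟨?_, ?_⟩)
    (fun s hI => ?_) h0) ?_
  · simp only [Test.Holds, hI.n14, hI.n18]; omega
  · exact D.runs_body l s0 hs he k s hk hI
  · simp only [Test.Holds, hI.n14, hI.n18]; omega
  intro s4 hI
  refine Runs.seq (Q := 0) (Q' := 0) (post := fun s5 => s5.nreg = s4.nreg ∧ s5.rmem = s4.rmem ∧
    s5.nmem = s4.nmem ∧ s5.rreg 3 = s4.rreg 3 ∧ s5.rreg 4 = 0 ∧ s5.rreg 5 = 0 ∧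
    s5.rreg 6 = s4.rreg 6 ∧ s5.rreg 7 = s4.rreg 7) (runs_block _ _ ?_) ?_
  · simp [runBlock, Instr.apply]
  rintro s5 ⟨en, em, enm, e3, e4, e5, e6, e7⟩
  refine Runs.seq (Q := 0) (Q' := 0) (runs_emits _ s5 (by rw [en, hI.n11])) ?_
  rintro s6 ⟨hb, hbn, hbr, hbf⟩
  refine (runs_nemits _ s6 (by rw [hbf 11 (by decide), en, hI.n11])).mono le_rfl le_rfl ?_
  rintro s7 ⟨hb', hbm', hbr', hbf'⟩
  rw [e3, e4, e5, e6, e7, hI.r3, hI.r6, hI.r7] at hb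
  rw [hbf 15 (by decide), en, hI.n15] at hb'
  refine ⟨?_, ?_, ?_⟩
  · refine hI.app.trans ⟨?_, fun a h => ?_, ?_⟩
    · rw [hbf' 2 (by decide) (by decide), hb.ptr, en]; rfl
    · rw [hbm', hb.below a (by rwa [en]), em]
    · rw [hbm', ← en]; exact hb.seg
  · have h3 : s6.nreg 3 = s4.nreg 3 := by rw [hbf 3 (by decide), en]
    refine hI.napp.trans ⟨by rw [hb'.ptr, h3], fun a h => ?_, by rw [← h3]; exact hb'.seg⟩
    rw [hb'.below a (by rwa [h3]), hbn, enm]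
  · rw [hbf' 16 (by decide) (by decide), hbf 16 (by decide), en, hI.n16]

end Template

/-! ### Correctness and running time of the reduction -/

theorem runs_query {P : Problem} {L d a m b k : ℕ} {s : State} {post : State → Prop} (I : P.Inst)
    (hI : P.encode I = s.queryWord a m b k) (hL : (s.queryWord a m b k).size ≤ L)
    (h : ∀ s' : State, (P.Yes I → s'.nreg d = 1) → (¬ P.Yes I → s'.nreg d = 0) → post s') :
    Runs P L (.query d a m b k) s 1 1 post :=
  ⟨_, _, _, .query d a m b k s I hI hL, le_rfl, le_rfl,
    h _ (fun hy => by simp [hy]) fun hy => by simp [hy]⟩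

theorem log_add_two_sq_le (n : ℕ) : (Nat.log 2 n + 2) ^ 2 ≤ 16 * (n + 1) := by
  -- The summand 2 is slack: without it the induction step fails at `j = 0`.
  have h : ∀ j : ℕ, (j + 2) ^ 2 + 2 ≤ 16 * 2 ^ j := by
    intro j
    induction j with
    | zero => norm_num
    | succ j ih => rw [pow_succ 2 j]; nlinarith
  rcases Nat.eq_zero_or_pos n with rfl | hn
  · simp
  · have := h (Nat.log 2 n)
    have := Nat.pow_log_le_self 2 hn.ne'
    omega

/-- The logarithm is absorbed by a square root, `log n + 2 ≤ 4 √(n + 1)`. This is where `ε = 1 / 2`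
comes from. -/
theorem linearithmic_le (n : ℕ) :
    (((n + 1) * (Nat.log 2 n + 2) : ℕ) : ℝ) ≤ 4 * ((n : ℝ) + 1) ^ (2 - (1 / 2 : ℝ)) := by
  have hn : (0 : ℝ) < (n : ℝ) + 1 := by positivity
  have h1 : ((n : ℝ) + 1) ^ (2 - (1 / 2 : ℝ)) = ((n : ℝ) + 1) * √((n : ℝ) + 1) := by
    rw [show (2 - (1 / 2 : ℝ)) = 1 + 1 / 2 by norm_num, Real.rpow_add hn, Real.rpow_one,
      Real.sqrt_eq_rpow]
  have h2 : ((Nat.log 2 n : ℝ) + 2) ≤ 4 * √((n : ℝ) + 1) := by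
    have h := log_add_two_sq_le n
    have h' : ((Nat.log 2 n : ℝ) + 2) ^ 2 ≤ 16 * ((n : ℝ) + 1) := by exact_mod_cast h
    have := Real.sq_sqrt hn.le
    exact abs_le_of_sq_le_sq' (by nlinarith) (by positivity) |>.2
  rw [h1]
  push_cast
  nlinarith [Real.sqrt_nonneg ((n : ℝ) + 1)]

/-- The machine sorts reals, whereas the templates speak of integer lists. A sorted permutation is
unique, so the machine's result is the cast of the sorted integer list; distinctness of the entries
makes the order strict. -/
theorem exists_sorted (l : List ℤ) (hl : l.Nodup) (l' : List ℝ)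
    (hp : l'.Perm (l.map fun a : ℤ => (a : ℝ))) (hs : l'.Pairwise (· ≤ ·)) :
    ∃ m : List ℤ, m.Perm l ∧ m.Pairwise (· < ·) ∧ l' = m.map fun a : ℤ => (a : ℝ) := by
  refine ⟨l.insertionSort (· ≤ ·), l.perm_insertionSort _, ?_, ?_⟩
  · have h1 := List.pairwise_insertionSort (· ≤ ·) l
    have h2 : (l.insertionSort (· ≤ ·)).Nodup := (l.perm_insertionSort (· ≤ ·)).nodup_iff.2 hl
    exact (h1.and h2).imp fun h => lt_of_le_of_ne h.1 h.2
  · refine (hp.trans ((l.perm_insertionSort (· ≤ ·)).map _).symm).eq_of_pairwise ?_ hs ?_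
    · intro a b _ _ h h'
      exact le_antisymm h h'
    · rw [List.pairwise_map]
      exact (List.pairwise_insertionSort (· ≤ ·) l).imp fun h => by exact_mod_cast h

/-- 3SUM depends only on the set of entries, so the instance built from the sorted list has the
right answer. The integer part of a 3SUM input is empty, hence the integer part of the word can
start at address 0. -/
theorem Template.runs_prog {P : Problem} (D : Template)
    (hD : ∀ l : List ℤ, l ≠ [] → l.Pairwise (· < ·) → ∃ I : P.Inst, P.encode I = D.word l ∧
      (P.Yes I ↔ ∃ a ∈ l, ∃ b ∈ l, ∃ c ∈ l, a + b + c = 0)) (x : threeSum.Inst) :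
    Runs P (D.sizeFactor * (x.1.length + 1)) D.prog (State.start (threeSum.encode x))
      ((24 + 18 * D.realBody.length + 4 * D.natBody.length + 8 +
        18 * (D.realHead.length + D.realTail.length) +
        4 * (D.natHead.length + D.natTail.length) + 32) *
        ((x.1.length + 1) * (Nat.log 2 x.1.length + 2))) 1 fun s =>
      (threeSum.Yes x → s.nreg 0 = 1) ∧ (¬ threeSum.Yes x → s.nreg 0 = 0) := by
  obtain ⟨l, hnd⟩ := x
  change List ℤ at l
  set rl := l.map fun a : ℤ => (a : ℝ) with hrl
  have hlen : rl.length = l.length := by simp [hrl]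
  change Runs P (D.sizeFactor * (l.length + 1)) D.prog (State.start ⟨[], rl⟩) _ 1 fun s =>
      ((∃ a ∈ l, ∃ b ∈ l, ∃ c ∈ l, a + b + c = 0) → s.nreg 0 = 1) ∧
        ((¬ ∃ a ∈ l, ∃ b ∈ l, ∃ c ∈ l, a + b + c = 0) → s.nreg 0 = 0)
  have i0 : (State.start ⟨[], rl⟩).nreg 0 = 0 := by simp [State.start]
  have i1 : (State.start ⟨[], rl⟩).nreg 1 = l.length := by simp [State.start, hlen]
  have i3 : (State.start ⟨[], rl⟩).nreg 3 = 0 := by simp [State.start]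
  have im : Seg (State.start ⟨[], rl⟩).rmem 0 rl :=
    seg_of_get fun k hk => by simp [State.start, hk]
  generalize State.start ⟨[], rl⟩ = s at i0 i1 i3 im
  refine (runs_ite (T := 1 + ((Nat.log 2 l.length + 1) * (24 * rl.length + 8) + 4 +
    (l.length * (18 * D.realBody.length + 4 * D.natBody.length + 10) +
        18 * (D.realHead.length + D.realTail.length) +
        4 * (D.natHead.length + D.natTail.length) + 22 + (2 + 1)))) (fun hlt => ?_)
    fun hlt => ?_).mono ?_ le_rfl fun _ h => h
  · have hpos : 0 < l.length := by simpa [Test.Holds, i0, i1] using hlt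
    refine Runs.seq (Q := 0) (Q' := 1) (post := fun s1 => s1.rmem = s.rmem ∧
      s1.nreg 1 = l.length ∧ s1.nreg 2 = l.length ∧ s1.nreg 3 = 0) (runs_block _ _ ?_) ?_
    · simp [runBlock, Instr.apply, i0, i1, i3]
    rintro s1 ⟨em, e1, e2, e3⟩
    refine Runs.seq (Q := 0) (Q' := 1) (runs_sortProg rl (Nat.log 2 l.length + 1) ?_ s1
      (by rwa [em]) (by rw [e1, hlen]) (by rw [e2, hlen])) ?_
    · rw [hlen]
      exact (Nat.lt_pow_succ_log_self (by norm_num) _).le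
    rintro s2 ⟨⟨l', hperm, hsort, hseg, hend⟩, f1, f3, f11⟩
    obtain ⟨m, hml, hmlt, rfl⟩ := exists_sorted l hnd l' hperm hsort
    have hmlen := hml.length_eq
    obtain ⟨I, hI, hyes⟩ := hD m (List.ne_nil_of_length_pos (by omega)) hmlt
    simp only [hml.mem_iff] at hyes
    refine Runs.seq (Q := 0) (Q' := 1) (T' := 2 + 1)
      ((D.runs_writeProg m (List.ne_nil_of_length_pos (by omega)) s2 hseg (by simpa using hend)
      f11).mono (by rw [hmlen]) le_rfl fun _ h => h) ?_
    rintro s3 ⟨ha, hn, h16⟩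
    refine Runs.seq (Q := 0) (Q' := 1) (post := fun s4 => s4.rmem = s3.rmem ∧
      s4.nmem = s3.nmem ∧ s4.nreg 3 = s3.nreg 3 ∧ s4.nreg 16 = s3.nreg 16 ∧ s4.nreg 12 = 0 ∧
      s4.nreg 19 = s3.nreg 2 - s3.nreg 16) (runs_block _ _ ?_) ?_
    · simp [runBlock, Instr.apply]
    rintro s4 ⟨g1, g2, g3, g16, g12, g19⟩
    have hw : s4.queryWord 12 3 16 19 = D.word m := by
      have hr := ha.seg.range_map
      have hn' := hn.seg.range_map
      have hp := hn.ptr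
      rw [f3, e3] at hn' hp
      rw [Nat.zero_add] at hp
      rw [State.queryWord, g12, g3, g16, g19, g1, g2, ha.ptr, h16, hp, Nat.add_sub_cancel_left, hr,
        hn']
    refine runs_query I (by rw [hI, hw]) ?_ ?_
    · rw [hw, ← hmlen]
      exact D.size_word_le m
    · intro s' hy hn
      rw [hyes] at hy hn
      exact ⟨hy, hn⟩
  -- On the empty list no query is made: register 0 still holds the number of naturals in the input,
  -- which is 0 and means "no".
  · have hpos : l = [] := by
      simpa [Test.Holds, i0, i1] using hlt
    subst hpos
    refine (runs_skip (post := fun s : State => _ ∧ _) ⟨?_, ?_⟩).mono (Nat.zero_le _)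
      (Nat.zero_le _) fun _ h => h
    · simp
    · simp [i0]
  · rw [hlen]
    have e : ∀ n j R N A B : ℕ, 1 + ((j + 1) * (24 * n + 8) + 4 + (n * (18 * R + 4 * N + 10) + 18 * A +
        4 * B + 22 + (2 + 1))) + 1 ≤
        (24 + 18 * R + 4 * N + 8 + 18 * A + 4 * B + 32) * ((n + 1) * (j + 2)) := by
      intro n j R N A B
      ring_nf
      have h1 : ∀ a b c : ℕ, 0 ≤ a * b * c := fun _ _ _ => Nat.zero_le _
      nlinarith [Nat.zero_le (n * j), Nat.zero_le (n * R), Nat.zero_le (n * N),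
        Nat.zero_le (n * A), Nat.zero_le (n * B), Nat.zero_le (j * A), Nat.zero_le (j * B),
        Nat.zero_le (j * R), Nat.zero_le (j * N), h1 n j R, h1 n j N, h1 n j A, h1 n j B]
    exact e _ _ _ _ _ _

/-- A problem is 3SUM-hard if a template turns sorted lists into equivalent instances. -/
theorem isThreeSumHard_of_template {P : Problem} (D : Template)
    (hD : ∀ l : List ℤ, l ≠ [] → l.Pairwise (· < ·) → ∃ I : P.Inst, P.encode I = D.word l ∧
      (P.Yes I ↔ ∃ a ∈ l, ∃ b ∈ l, ∃ c ∈ l, a + b + c = 0)) : IsThreeSumHard P := by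
  refine ⟨1 / 2, by norm_num, D.prog, 1, D.sizeFactor, ?_⟩
  refine ⟨((24 + 18 * D.realBody.length + 4 * D.natBody.length + 8 +
        18 * (D.realHead.length + D.realTail.length) +
        4 * (D.natHead.length + D.natTail.length) + 32 : ℕ) : ℝ) * 4, fun x => ?_⟩
  have hsize : (threeSum.encode x).size = x.1.length := by simp [threeSum, Word.size]
  rw [hsize]
  obtain ⟨t, q, s, he, ht, hq, h1, h2⟩ := D.runs_prog hD x
  refine ⟨t, q, s, he, hq, ?_, h1, h2⟩
  refine (Nat.cast_le.2 ht).trans ?_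
  rw [Nat.cast_mul, mul_assoc]
  exact mul_le_mul_of_nonneg_left (linearithmic_le _) (Nat.cast_nonneg _)

/-! ### Sorted lists of integers -/

section Sorted

variable {l : List ℤ}

theorem up_mem {i : ℕ} (hi : i < l.length) : up l i ∈ l := by
  rw [up, List.getD_eq_getElem _ _ hi]; exact List.getElem_mem hi

theorem down_mem {i : ℕ} (hi : i < l.length) : down l i ∈ l := up_mem (by omega)

theorem exists_up_eq {a : ℤ} (ha : a ∈ l) : ∃ i < l.length, up l i = a := by
  obtain ⟨i, hi, h⟩ := List.getElem_of_mem ha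
  exact ⟨i, hi, by rw [up, List.getD_eq_getElem _ _ hi, h]⟩

theorem exists_down_eq {a : ℤ} (ha : a ∈ l) : ∃ i < l.length, down l i = a := by
  obtain ⟨i, hi, h⟩ := exists_up_eq ha
  refine ⟨l.length - 1 - i, by omega, ?_⟩
  rw [← h, down, up]; congr 1; omega

theorem up_lt (hl : l.Pairwise (· < ·)) {i j : ℕ} (hij : i < j) (hj : j < l.length) :
    up l i < up l j := by
  rw [up, up, List.getD_eq_getElem _ _ hj, List.getD_eq_getElem _ _ (hij.trans hj)]
  exact List.pairwise_iff_getElem.1 hl _ _ _ _ hij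

theorem down_lt (hl : l.Pairwise (· < ·)) {i j : ℕ} (hij : i < j) (hj : j < l.length) :
    down l j < down l i := up_lt hl (by omega) (by omega)

theorem one_le_bigM (l : List ℤ) : 1 ≤ bigM l := by
  unfold bigM
  nlinarith [mul_self_nonneg (l.getD 0 0), mul_self_nonneg (l.getD (l.length - 1) 0)]

/-- The extreme entries of a sorted list are at its ends, and an integer satisfies `|x| ≤ x * x`.
Squares avoid a case distinction on signs in the program. -/
theorem abs_lt_bigM (hl : l.Pairwise (· < ·)) {a : ℤ} (ha : a ∈ l) : |a| < bigM l := by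
  obtain ⟨i, hi, rfl⟩ := exists_up_eq ha
  have h1 : up l 0 ≤ up l i := by
    rcases Nat.eq_zero_or_pos i with rfl | h
    · rfl
    · exact (up_lt hl h hi).le
  have h2 : up l i ≤ up l (l.length - 1) := by
    rcases Nat.lt_or_ge i (l.length - 1) with h | h
    · exact (up_lt hl h (by omega)).le
    · rw [show i = l.length - 1 by omega]
  have e : bigM l = 1 + up l 0 * up l 0 + up l (l.length - 1) * up l (l.length - 1) := rfl
  have q : ∀ x : ℤ, x ≤ x * x ∧ -x ≤ x * x := fun x => by
    constructor
    · rcases le_or_gt x 0 with h | h <;> nlinarith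
    · rcases le_or_gt 0 x with h | h <;> nlinarith
  rw [abs_lt, e]
  constructor <;> linarith [(q (up l 0)).1, (q (up l 0)).2, (q (up l (l.length - 1))).1,
    (q (up l (l.length - 1))).2, mul_self_nonneg (up l 0), mul_self_nonneg (up l (l.length - 1))]

theorem abs_cast_lt_bigM (hl : l.Pairwise (· < ·)) {a : ℤ} (ha : a ∈ l) :
    |(a : ℝ)| < bigM l := by exact_mod_cast abs_lt_bigM hl ha

end Sorted

/-- The gap centers of the outer rows of walls, with two sentinels. -/
def centerUp (l : List ℤ) (i : ℕ) : ℤ :=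
  if i = l.length + 1 then 160 * bigM l else 16 * prevUp l i

/-- The gap centers of the middle row of walls, with two sentinels. -/
def centerDown (l : List ℤ) (i : ℕ) : ℤ :=
  if i = l.length + 1 then 80 * bigM l else -8 * prevDown l i

/-! ### Spacing of the gap centers -/

section Centers

variable {l : List ℤ}

theorem centerUp_succ {i : ℕ} (hi : i < l.length) : centerUp l (i + 1) = 16 * up l i := by
  rw [centerUp, if_neg (by omega), prevUp, if_neg (by omega), Nat.add_sub_cancel]

theorem centerDown_succ {i : ℕ} (hi : i < l.length) : centerDown l (i + 1) = -8 * down l i := by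
  rw [centerDown, if_neg (by omega), prevDown, if_neg (by omega), Nat.add_sub_cancel]

theorem centerUp_zero (l : List ℤ) : centerUp l 0 = -160 * bigM l := by
  simp [centerUp, prevUp]; ring

theorem centerDown_zero (l : List ℤ) : centerDown l 0 = -80 * bigM l := by
  simp [centerDown, prevDown]; ring

theorem centerUp_last (l : List ℤ) : centerUp l (l.length + 1) = 160 * bigM l := by
  simp [centerUp]

theorem centerDown_last (l : List ℤ) : centerDown l (l.length + 1) = 80 * bigM l := by
  simp [centerDown]

theorem centerUp_step (hl : l.Pairwise (· < ·)) {i : ℕ} (hi : i < l.length + 1) :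
    centerUp l i + 8 ≤ centerUp l (i + 1) := by
  have hM := one_le_bigM l
  rcases Nat.lt_or_ge i l.length with h | h
  · rw [centerUp_succ h]
    have h1 := abs_lt.1 (abs_lt_bigM hl (up_mem h))
    cases i with
    | zero => rw [centerUp_zero]; omega
    | succ i =>
      rw [centerUp_succ (by omega)]
      have := up_lt hl (Nat.lt_add_one i) h
      omega
  · obtain rfl : i = l.length := by omega
    rw [centerUp_last]
    rcases Nat.eq_zero_or_pos l.length with h0 | h0
    · rw [h0, centerUp_zero]; omega
    · obtain ⟨k, hk⟩ := Nat.exists_eq_succ_of_ne_zero h0.ne'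
      rw [hk, Nat.succ_eq_add_one, centerUp_succ (by omega)]
      have h1 := abs_lt.1 (abs_lt_bigM hl (up_mem (l := l) (i := k) (by omega)))
      omega

/-- The factor -8 turns the decreasing order into an increasing one, and distinct integers differ by
at least 1. This row determines the common spacing 8, which leaves walls of width at least 6; the
outer rows have spacing 16. The sentinels are far outside of the range of the true centers. -/
theorem centerDown_step (hl : l.Pairwise (· < ·)) {i : ℕ} (hi : i < l.length + 1) :
    centerDown l i + 8 ≤ centerDown l (i + 1) := by
  have hM := one_le_bigM l
  rcases Nat.lt_or_ge i l.length with h | h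
  · rw [centerDown_succ h]
    have h1 := abs_lt.1 (abs_lt_bigM hl (down_mem h))
    cases i with
    | zero => rw [centerDown_zero]; omega
    | succ i =>
      rw [centerDown_succ (by omega)]
      have := down_lt hl (Nat.lt_add_one i) h
      omega
  · obtain rfl : i = l.length := by omega
    rw [centerDown_last]
    rcases Nat.eq_zero_or_pos l.length with h0 | h0
    · rw [h0, centerDown_zero]; omega
    · obtain ⟨k, hk⟩ := Nat.exists_eq_succ_of_ne_zero h0.ne'
      rw [hk, Nat.succ_eq_add_one, centerDown_succ (by omega)]
      have h1 := abs_lt.1 (abs_lt_bigM hl (down_mem (l := l) (i := k) (by omega)))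
      omega

end Centers

/-- A sequence with steps of length at least `8` is increasing. -/
theorem add_le_of_steps {c : ℕ → ℤ} {m : ℕ} (hc : ∀ i < m, c i + 8 ≤ c (i + 1)) {i j : ℕ}
    (hij : i < j) (hj : j ≤ m) : c i + 8 ≤ c j := by
  induction j, hij using Nat.le_induction with
  | base => exact hc i (by omega)
  | succ j hij ih => linarith [ih (by omega), hc j (by omega)]

theorem le_of_steps {c : ℕ → ℤ} {m : ℕ} (hc : ∀ i < m, c i + 8 ≤ c (i + 1)) {i j : ℕ}
    (hij : i ≤ j) (hj : j ≤ m) : c i ≤ c j := by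
  rcases hij.eq_or_lt with rfl | h
  · rfl
  · linarith [add_le_of_steps hc h hj]

/-- A point that is in no wall is close to the center of a gap. -/
theorem exists_center_near {c : ℕ → ℤ} {m : ℕ} {x : ℝ} (h0 : (c 0 : ℝ) ≤ x) (hm : x ≤ c m)
    (hx : ∀ i < m, ¬ ((c i : ℝ) + 1 < x ∧ x < c (i + 1) - 1)) : ∃ i ≤ m, |x - c i| ≤ 1 := by
  induction m with
  | zero => exact ⟨0, le_rfl, by rw [abs_le]; constructor <;> linarith⟩
  | succ m ih =>
    rcases le_or_gt x (c m) with h | h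
    · obtain ⟨i, hi, h'⟩ := ih h fun i hi => hx i (by omega)
      exact ⟨i, by omega, h'⟩
    · rcases le_or_gt x (c m + 1) with h' | h'
      · exact ⟨m, by omega, by rw [abs_le]; constructor <;> linarith⟩
      · refine ⟨m + 1, le_rfl, ?_⟩
        have := hx m (by omega)
        rw [not_and, not_lt] at this
        have := this h'
        rw [abs_le]; constructor <;> linarith

/-- A center is in no wall. -/
theorem center_not_between {c : ℕ → ℤ} {m : ℕ} (hc : ∀ i < m, c i + 8 ≤ c (i + 1)) {i j : ℕ}
    (hi : i < m) (hj : j ≤ m) (h1 : (c i : ℝ) < c j) (h2 : (c j : ℝ) < c (i + 1)) : False := by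
  rw [Int.cast_lt] at h1 h2
  rcases Nat.lt_or_ge i j with h | h
  · exact absurd (le_of_steps hc (Nat.succ_le_of_lt h) hj) (by simpa using h2)
  · exact absurd (le_of_steps hc h (by omega)) (by simpa using h1)

/-! ### Axis-parallel rectangles -/

/-- The boundary polygon of a rectangle. -/
def rect (x₀ x₁ y₀ y₁ : ℝ) : List (ℝ × ℝ) := [(x₀, y₀), (x₁, y₀), (x₁, y₁), (x₀, y₁)]

section Rect

variable {x₀ x₁ y₀ y₁ : ℝ}

theorem mem_segment_horizontal {a b c : ℝ} (h : a ≤ b) {p : ℝ × ℝ} :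
    p ∈ segment ℝ (a, c) (b, c) ↔ (a ≤ p.1 ∧ p.1 ≤ b) ∧ p.2 = c := by
  rw [← Prod.image_mk_segment_left, segment_eq_Icc h]
  constructor
  · rintro ⟨x, hx, rfl⟩; exact ⟨hx, rfl⟩
  · rintro ⟨hx, hy⟩; exact ⟨p.1, hx, Prod.ext rfl hy.symm⟩

theorem mem_segment_vertical {a b c : ℝ} (h : a ≤ b) {p : ℝ × ℝ} :
    p ∈ segment ℝ (c, a) (c, b) ↔ p.1 = c ∧ (a ≤ p.2 ∧ p.2 ≤ b) := by
  rw [← Prod.image_mk_segment_right, segment_eq_Icc h]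
  constructor
  · rintro ⟨x, hx, rfl⟩; exact ⟨rfl, hx⟩
  · rintro ⟨hx, hy⟩; exact ⟨p.2, hy, Prod.ext hx.symm rfl⟩

theorem mem_edge_rect_zero (hx : x₀ ≤ x₁) {p : ℝ × ℝ} :
    p ∈ edge (rect x₀ x₁ y₀ y₁) 0 ↔ (x₀ ≤ p.1 ∧ p.1 ≤ x₁) ∧ p.2 = y₀ :=
  mem_segment_horizontal hx

theorem mem_edge_rect_one (hy : y₀ ≤ y₁) {p : ℝ × ℝ} :
    p ∈ edge (rect x₀ x₁ y₀ y₁) 1 ↔ p.1 = x₁ ∧ (y₀ ≤ p.2 ∧ p.2 ≤ y₁) :=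
  mem_segment_vertical hy

theorem mem_edge_rect_two (hx : x₀ ≤ x₁) {p : ℝ × ℝ} :
    p ∈ edge (rect x₀ x₁ y₀ y₁) 2 ↔ (x₀ ≤ p.1 ∧ p.1 ≤ x₁) ∧ p.2 = y₁ := by
  rw [← mem_segment_horizontal hx, segment_symm]; rfl

theorem mem_edge_rect_three (hy : y₀ ≤ y₁) {p : ℝ × ℝ} :
    p ∈ edge (rect x₀ x₁ y₀ y₁) 3 ↔ p.1 = x₀ ∧ (y₀ ≤ p.2 ∧ p.2 ≤ y₁) := by
  rw [← mem_segment_vertical hy, segment_symm]; simp [edge, vertex, rect]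

/-- Opposite edges differ in a fixed coordinate; adjacent edges fix both coordinates, which leaves
only the common corner. -/
theorem isSimplePolygon_rect (hx : x₀ < x₁) (hy : y₀ < y₁) :
    IsSimplePolygon (rect x₀ x₁ y₀ y₁) := by
  refine ⟨by simp [rect], by simp [rect, hx.ne, hy.ne, hx.ne'], ?_⟩
  intro i hi j hj hij p hp
  rw [Set.mem_inter_iff] at hp
  have hi : i < 4 := hi
  have hj : j < 4 := hj
  rcases p with ⟨x, y⟩
  interval_cases i <;> interval_cases j <;> first | exact absurd rfl hij | skip
  all_goals
    simp only [mem_edge_rect_zero hx.le, mem_edge_rect_one hy.le, mem_edge_rect_two hx.le,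
      mem_edge_rect_three hy.le] at hp
    first
    | (exfalso; linarith [hp.1.1, hp.1.2, hp.2.1, hp.2.2])
    | (obtain ⟨⟨h1, rfl⟩, ⟨rfl, h4⟩⟩ := hp
       simp [vertex, rect])
    | (obtain ⟨⟨rfl, h4⟩, ⟨h1, rfl⟩⟩ := hp
       simp [vertex, rect])

theorem mem_boundary_rect (hx : x₀ ≤ x₁) (hy : y₀ ≤ y₁) {p : ℝ × ℝ} :
    p ∈ boundary (rect x₀ x₁ y₀ y₁) ↔
      ((x₀ ≤ p.1 ∧ p.1 ≤ x₁) ∧ y₀ ≤ p.2 ∧ p.2 ≤ y₁) ∧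
        ¬ ((x₀ < p.1 ∧ p.1 < x₁) ∧ y₀ < p.2 ∧ p.2 < y₁) := by
  have h4 : p ∈ boundary (rect x₀ x₁ y₀ y₁) ↔ ∃ j < 4, p ∈ edge (rect x₀ x₁ y₀ y₁) j := by
    simp [boundary, rect]
  rw [h4]
  constructor
  · rintro ⟨j, hj, h⟩
    interval_cases j
    · rw [mem_edge_rect_zero hx] at h
      exact ⟨⟨h.1, by linarith [h.2], by linarith [h.2]⟩, fun h' => by linarith [h.2, h'.2.1]⟩
    · rw [mem_edge_rect_one hy] at h
      exact ⟨⟨⟨by linarith [h.1], by linarith [h.1]⟩, h.2⟩, fun h' => by linarith [h.1, h'.1.2]⟩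
    · rw [mem_edge_rect_two hx] at h
      exact ⟨⟨h.1, by linarith [h.2], by linarith [h.2]⟩, fun h' => by linarith [h.2, h'.2.2]⟩
    · rw [mem_edge_rect_three hy] at h
      exact ⟨⟨⟨by linarith [h.1], by linarith [h.1]⟩, h.2⟩, fun h' => by linarith [h.1, h'.1.1]⟩
  · rintro ⟨⟨h1, h2⟩, h⟩
    by_contra! hne
    have n0 := hne 0 (by norm_num)
    have n1 := hne 1 (by norm_num)
    have n2 := hne 2 (by norm_num)
    have n3 := hne 3 (by norm_num)
    rw [mem_edge_rect_zero hx] at n0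
    rw [mem_edge_rect_one hy] at n1
    rw [mem_edge_rect_two hx] at n2
    rw [mem_edge_rect_three hy] at n3
    exact h ⟨⟨lt_of_le_of_ne h1.1 fun e => n3 ⟨e.symm, h2⟩,
      lt_of_le_of_ne h1.2 fun e => n1 ⟨e, h2⟩⟩,
      lt_of_le_of_ne h2.1 fun e => n0 ⟨h1, e.symm⟩, lt_of_le_of_ne h2.2 fun e => n2 ⟨h1, e⟩⟩

/-- An unbounded convex set that avoids the curve has no points inside. -/
theorem not_mem_inside {V : List (ℝ × ℝ)} {x : ℝ × ℝ} {s : Set (ℝ × ℝ)} (hs : Convex ℝ s)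
    (hx : x ∈ s) (hd : s ⊆ (boundary V)ᶜ) (hu : ¬ Bornology.IsBounded s) : x ∉ inside V :=
  fun h => hu (h.2.subset (hs.isPreconnected.subset_connectedComponentIn hx hd))

/-- From a point outside the closed box some axis-parallel ray runs away from the box, and this is
an unbounded convex set that misses the boundary. Conversely, the complement of the boundary is the
disjoint union of the open box and the complement of the closed box, both open, so the component of
a point of the open box cannot leave it. -/
theorem mem_inside_rect (hx : x₀ ≤ x₁) (hy : y₀ ≤ y₁) {p : ℝ × ℝ} :
    p ∈ inside (rect x₀ x₁ y₀ y₁) ↔ (x₀ < p.1 ∧ p.1 < x₁) ∧ y₀ < p.2 ∧ p.2 < y₁ := by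
  have unb : ∀ (f : ℝ → ℝ × ℝ) (s : Set ℝ), (∀ t ∈ s, f t ∈ (boundary (rect x₀ x₁ y₀ y₁))ᶜ) →
      Convex ℝ (f '' s) → p ∈ f '' s → (∀ C, ∃ t ∈ s, C < ‖f t‖) →
      p ∉ inside (rect x₀ x₁ y₀ y₁) := by
    intro f s h1 h2 h3 h4
    refine not_mem_inside h2 h3 (by rintro _ ⟨t, ht, rfl⟩; exact h1 t ht) fun hb => ?_
    obtain ⟨C, hC⟩ := hb.exists_norm_le
    obtain ⟨t, ht, hlt⟩ := h4 C
    exact absurd (hC _ ⟨t, ht, rfl⟩) (not_le.2 hlt)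
  constructor
  · intro h
    by_contra hn
    by_cases hc : (x₀ ≤ p.1 ∧ p.1 ≤ x₁) ∧ y₀ ≤ p.2 ∧ p.2 ≤ y₁
    · exact h.1 ((mem_boundary_rect hx hy).2 ⟨hc, hn⟩)
    have hcases : p.1 < x₀ ∨ x₁ < p.1 ∨ p.2 < y₀ ∨ y₁ < p.2 := by
      by_contra! h'
      exact hc ⟨⟨h'.1, h'.2.1⟩, h'.2.2.1, h'.2.2.2⟩
    have left_conv : ∀ s : Set ℝ, Convex ℝ s → Convex ℝ ((fun t => (t, p.2)) '' s) := by
      intro s hs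
      have : (fun t => (t, p.2)) '' s = s ×ˢ {p.2} := by
        ext q; constructor
        · rintro ⟨t, ht, rfl⟩; exact ⟨ht, rfl⟩
        · rintro ⟨h1, h2⟩; exact ⟨q.1, h1, Prod.ext rfl h2.symm⟩
      rw [this]; exact hs.prod (convex_singleton _)
    have right_conv : ∀ s : Set ℝ, Convex ℝ s → Convex ℝ ((fun t => (p.1, t)) '' s) := by
      intro s hs
      have : (fun t => (p.1, t)) '' s = {p.1} ×ˢ s := by
        ext q; constructor
        · rintro ⟨t, ht, rfl⟩; exact ⟨rfl, ht⟩
        · rintro ⟨h1, h2⟩; exact ⟨q.2, h2, Prod.ext h1.symm rfl⟩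
      rw [this]; exact (convex_singleton _).prod hs
    have neg : ∀ a C : ℝ, ∃ t ∈ Set.Iic a, C < |t| := fun a C =>
      ⟨-(|a| + |C| + 1), by
        simp only [Set.mem_Iic]; linarith [neg_abs_le a, abs_nonneg C], by
        rw [abs_neg, abs_of_nonneg (by positivity)]; linarith [le_abs_self C, abs_nonneg a]⟩
    have pos : ∀ a C : ℝ, ∃ t ∈ Set.Ici a, C < |t| := fun a C =>
      ⟨|a| + |C| + 1, by
        simp only [Set.mem_Ici]; linarith [le_abs_self a, abs_nonneg C], by
        rw [abs_of_nonneg (by positivity)]; linarith [le_abs_self C, abs_nonneg a]⟩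
    have nl : ∀ t C : ℝ, C < |t| → C < ‖(t, p.2)‖ := fun t C h =>
      h.trans_le (norm_fst_le (t, p.2))
    have nr : ∀ t C : ℝ, C < |t| → C < ‖(p.1, t)‖ := fun t C h =>
      h.trans_le (norm_snd_le (p.1, t))
    rcases hcases with h' | h' | h' | h'
    · refine unb (fun t => (t, p.2)) (Set.Iic p.1) (fun t ht hb => ?_)
        (left_conv _ (convex_Iic _)) ⟨p.1, by simp, rfl⟩ (fun C => ?_) h
      · have := ((mem_boundary_rect hx hy).1 hb).1.1.1
        simp only [Set.mem_Iic] at ht this; linarith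
      · obtain ⟨t, ht, h⟩ := neg p.1 C
        exact ⟨t, ht, nl _ _ h⟩
    · refine unb (fun t => (t, p.2)) (Set.Ici p.1) (fun t ht hb => ?_)
        (left_conv _ (convex_Ici _)) ⟨p.1, by simp, rfl⟩ (fun C => ?_) h
      · have := ((mem_boundary_rect hx hy).1 hb).1.1.2
        simp only [Set.mem_Ici] at ht this; linarith
      · obtain ⟨t, ht, h⟩ := pos p.1 C
        exact ⟨t, ht, nl _ _ h⟩
    · refine unb (fun t => (p.1, t)) (Set.Iic p.2) (fun t ht hb => ?_)
        (right_conv _ (convex_Iic _)) ⟨p.2, by simp, rfl⟩ (fun C => ?_) h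
      · have := ((mem_boundary_rect hx hy).1 hb).1.2.1
        simp only [Set.mem_Iic] at ht this; linarith
      · obtain ⟨t, ht, h⟩ := neg p.2 C
        exact ⟨t, ht, nr _ _ h⟩
    · refine unb (fun t => (p.1, t)) (Set.Ici p.2) (fun t ht hb => ?_)
        (right_conv _ (convex_Ici _)) ⟨p.2, by simp, rfl⟩ (fun C => ?_) h
      · have := ((mem_boundary_rect hx hy).1 hb).1.2.2
        simp only [Set.mem_Ici] at ht this; linarith
      · obtain ⟨t, ht, h⟩ := pos p.2 C
        exact ⟨t, ht, nr _ _ h⟩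
  · intro h
    refine ⟨fun hb => ((mem_boundary_rect hx hy).1 hb).2 h, ?_⟩
    have hpc : IsPreconnected (connectedComponentIn (boundary (rect x₀ x₁ y₀ y₁))ᶜ p) :=
      isPreconnected_connectedComponentIn
    have hU : IsOpen (Set.Ioo x₀ x₁ ×ˢ Set.Ioo y₀ y₁) := isOpen_Ioo.prod isOpen_Ioo
    have hV : IsOpen (Set.Icc x₀ x₁ ×ˢ Set.Icc y₀ y₁)ᶜ :=
      (isClosed_Icc.prod isClosed_Icc).isOpen_compl
    refine Bornology.IsBounded.subset
      ((Metric.isBounded_Icc x₀ x₁).prod (Metric.isBounded_Icc y₀ y₁)) ?_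
    refine (hpc.subset_left_of_subset_union hU hV ?_ ?_ ?_).trans
      (Set.prod_mono Set.Ioo_subset_Icc_self Set.Ioo_subset_Icc_self)
    · rw [Set.disjoint_left]
      exact fun q hq hq' => hq' (Set.prod_mono Set.Ioo_subset_Icc_self Set.Ioo_subset_Icc_self hq)
    · intro q hq
      have hq := connectedComponentIn_subset _ _ hq
      rw [Set.mem_compl_iff, mem_boundary_rect hx hy] at hq
      by_cases hi : q ∈ Set.Icc x₀ x₁ ×ˢ Set.Icc y₀ y₁
      · exact Or.inl (by by_contra hn; exact hq ⟨hi, hn⟩)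
      · exact Or.inr hi
    · exact ⟨p, mem_connectedComponentIn fun hb => ((mem_boundary_rect hx hy).1 hb).2 h, h⟩

theorem mem_region_rect (hx : x₀ ≤ x₁) (hy : y₀ ≤ y₁) {p : ℝ × ℝ} :
    p ∈ region (rect x₀ x₁ y₀ y₁) ↔ (x₀ ≤ p.1 ∧ p.1 ≤ x₁) ∧ y₀ ≤ p.2 ∧ p.2 ≤ y₁ := by
  rw [region, Set.mem_union, mem_boundary_rect hx hy, mem_inside_rect hx hy]
  constructor
  · rintro (h | h)
    · exact h.1
    · exact ⟨⟨h.1.1.le, h.1.2.le⟩, h.2.1.le, h.2.2.le⟩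
  · intro h
    by_cases h' : (x₀ < p.1 ∧ p.1 < x₁) ∧ y₀ < p.2 ∧ p.2 < y₁
    · exact Or.inr h'
    · exact Or.inl ⟨h, h'⟩

end Rect

/-! ### The polygonal domain of a sorted list -/

/-- Wall `i` of a row of walls: it reaches from one gap to the next one. -/
def wall (c : ℕ → ℤ) (y : ℝ) (i : ℕ) : List (ℝ × ℝ) :=
  rect (c i + 1) (c (i + 1) - 1) (y - 1) (y + 1)

/-- The walls number `i` of the three rows. -/
def walls (l : List ℤ) (i : ℕ) : List (List (ℝ × ℝ)) :=
  [wall (centerUp l) (32 * bigM l) i, wall (centerDown l) (64 * bigM l) i,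
    wall (centerUp l) (96 * bigM l) i]

/-- The outer polygon. -/
def outerRect (l : List ℤ) : List (ℝ × ℝ) :=
  rect (-200 * bigM l) (200 * bigM l) (-2) (128 * bigM l + 2)

/-- The hole below the walls; its upper edge is the first given edge. -/
def lowerHole (l : List ℤ) : List (ℝ × ℝ) := rect (-60 * bigM l) (60 * bigM l) (-1) 0

/-- The hole above the walls; its lower edge is the second given edge. -/
def upperHole (l : List ℤ) : List (ℝ × ℝ) :=
  rect (-60 * bigM l) (60 * bigM l) (128 * bigM l) (128 * bigM l + 1)

/-- All holes. -/
def wallHoles (l : List ℤ) : List (List (ℝ × ℝ)) :=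
  lowerHole l :: upperHole l :: (List.range (l.length + 1)).flatMap (walls l)

/-! ### Planar walls: validity, visibility and encoding -/

section Domain

variable {l : List ℤ}

theorem mem_walls {i : ℕ} {V : List (ℝ × ℝ)} (h : V ∈ walls l i) :
    ∃ c y, V = wall c y i ∧ (c = centerUp l ∨ c = centerDown l) ∧
      (y = 32 * bigM l ∨ y = 64 * bigM l ∨ y = 96 * (bigM l : ℝ)) := by
  simp only [walls, List.mem_cons, List.not_mem_nil, or_false] at h
  rcases h with rfl | rfl | rfl
  · exact ⟨_, _, rfl, .inl rfl, .inl rfl⟩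
  · exact ⟨_, _, rfl, .inr rfl, .inr (.inl rfl)⟩
  · exact ⟨_, _, rfl, .inl rfl, .inr (.inr rfl)⟩

theorem center_step (hl : l.Pairwise (· < ·)) {c : ℕ → ℤ}
    (hc : c = centerUp l ∨ c = centerDown l) : ∀ i < l.length + 1, c i + 8 ≤ c (i + 1) := by
  rcases hc with rfl | rfl
  · exact fun i hi => centerUp_step hl hi
  · exact fun i hi => centerDown_step hl hi

theorem center_step_real (hl : l.Pairwise (· < ·)) {c : ℕ → ℤ}
    (hc : c = centerUp l ∨ c = centerDown l) {i : ℕ} (hi : i < l.length + 1) :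
    (c i : ℝ) + 8 ≤ c (i + 1) := by exact_mod_cast center_step hl hc i hi

/-- The sentinel gaps are beyond `±80 M`, out of the reach of sight lines, which stay within `±60
M`; they are within `±160 M`, so that the walls fit into the outer rectangle of half-width `200 M`.
-/
theorem center_ends {c : ℕ → ℤ} (hc : c = centerUp l ∨ c = centerDown l) :
    (-160 * bigM l ≤ c 0 ∧ c 0 ≤ -80 * bigM l) ∧
      80 * bigM l ≤ c (l.length + 1) ∧ c (l.length + 1) ≤ 160 * bigM l := by
  have := one_le_bigM l
  rcases hc with rfl | rfl
  · rw [centerUp_zero, centerUp_last]; omega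
  · rw [centerDown_zero, centerDown_last]; omega

theorem center_bounds (hl : l.Pairwise (· < ·)) {c : ℕ → ℤ}
    (hc : c = centerUp l ∨ c = centerDown l) {i : ℕ} (hi : i ≤ l.length + 1) :
    -160 * (bigM l : ℝ) ≤ c i ∧ (c i : ℝ) ≤ 160 * bigM l := by
  have h1 := le_of_steps (center_step hl hc) (Nat.zero_le i) hi
  have h2 := le_of_steps (center_step hl hc) hi le_rfl
  have h3 := center_ends hc
  constructor
  · exact_mod_cast h3.1.1.trans h1
  · exact_mod_cast h2.trans h3.2.2

theorem one_le_bigM_real (l : List ℤ) : (1 : ℝ) ≤ bigM l := by exact_mod_cast one_le_bigM l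

theorem mem_wallHoles {V : List (ℝ × ℝ)} (h : V ∈ wallHoles l) :
    V = lowerHole l ∨ V = upperHole l ∨ ∃ i < l.length + 1, V ∈ walls l i := by
  simpa [wallHoles, List.mem_flatMap] using h

/-- Every hole is a nondegenerate rectangle inside the outer one. -/
theorem exists_rect_of_mem_wallHoles (hl : l.Pairwise (· < ·)) {V : List (ℝ × ℝ)}
    (h : V ∈ wallHoles l) : ∃ x₀ x₁ y₀ y₁, V = rect x₀ x₁ y₀ y₁ ∧ x₀ < x₁ ∧ y₀ < y₁ ∧
      -200 * bigM l < x₀ ∧ x₁ < 200 * bigM l ∧ -2 < y₀ ∧ y₁ < 128 * bigM l + 2 := by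
  have hM := one_le_bigM_real l
  rcases mem_wallHoles h with rfl | rfl | ⟨i, hi, hV⟩
  · exact ⟨_, _, _, _, rfl, by linarith, by linarith, by linarith, by linarith, by linarith,
      by linarith⟩
  · exact ⟨_, _, _, _, rfl, by linarith, by linarith, by linarith, by linarith, by linarith,
      by linarith⟩
  · obtain ⟨c, y, rfl, hc, hy⟩ := mem_walls hV
    have h1 := center_step_real hl hc hi
    have h2 := center_bounds hl hc hi.le
    have h3 := center_bounds hl hc (i := i + 1) (by omega)
    exact ⟨_, _, _, _, rfl, by linarith, by linarith, by linarith, by linarith,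
      by rcases hy with rfl | rfl | rfl <;> linarith,
      by rcases hy with rfl | rfl | rfl <;> linarith⟩

theorem disjoint_region_rect {x₀ x₁ y₀ y₁ x₀' x₁' y₀' y₁' : ℝ} (hx : x₀ ≤ x₁) (hy : y₀ ≤ y₁)
    (hx' : x₀' ≤ x₁') (hy' : y₀' ≤ y₁') (h : x₁ < x₀' ∨ y₁ < y₀' ∨ y₁' < y₀) :
    Disjoint (region (rect x₀ x₁ y₀ y₁)) (region (rect x₀' x₁' y₀' y₁')) := by
  rw [Set.disjoint_left]
  intro p hp hp'
  rw [mem_region_rect hx hy] at hp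
  rw [mem_region_rect hx' hy'] at hp'
  rcases h with h | h | h
  · linarith [hp.1.2, hp'.1.1]
  · linarith [hp.2.2, hp'.2.1]
  · linarith [hp'.2.2, hp.2.1]

/-- Walls of one row are separated by a gap, walls of different rows by their heights. -/
theorem disjoint_walls (hl : l.Pairwise (· < ·)) {i i' : ℕ} (hi : i < l.length + 1)
    (hi' : i' < l.length + 1) {c c' : ℕ → ℤ} {y y' : ℝ} (hc : c = centerUp l ∨ c = centerDown l)
    (hc' : c' = centerUp l ∨ c' = centerDown l)
    (h : (c = c' ∧ i < i') ∨ y + 2 < y' ∨ y' + 2 < y) :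
    Disjoint (region (wall c y i)) (region (wall c' y' i')) := by
  have h1 := center_step_real hl hc hi
  have h2 := center_step_real hl hc' hi'
  refine disjoint_region_rect (by linarith) (by linarith) (by linarith) (by linarith) ?_
  rcases h with ⟨rfl, h⟩ | h | h
  · left
    have : c (i + 1) ≤ c i' := le_of_steps (center_step hl hc) h hi'.le
    have : (c (i + 1) : ℝ) ≤ c i' := by exact_mod_cast this
    linarith
  · right; left; linarith
  · right; right; linarith

theorem pairwise_wallHoles (hl : l.Pairwise (· < ·)) :
    (wallHoles l).Pairwise fun H H' => Disjoint (region H) (region H') := by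
  have hM := one_le_bigM_real l
  have hw : ∀ V ∈ (List.range (l.length + 1)).flatMap (walls l), ∃ x₀ x₁ y₀ y₁,
      V = rect x₀ x₁ y₀ y₁ ∧ x₀ ≤ x₁ ∧ y₀ ≤ y₁ ∧ 0 < y₀ ∧ y₁ < 128 * bigM l := by
    intro V hV
    obtain ⟨i, hi, hV⟩ := List.mem_flatMap.1 hV
    rw [List.mem_range] at hi
    obtain ⟨c, y, rfl, hc, hy⟩ := mem_walls hV
    have h1 := center_step_real hl hc hi
    exact ⟨_, _, _, _, rfl, by linarith, by linarith,
      by rcases hy with rfl | rfl | rfl <;> linarith,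
      by rcases hy with rfl | rfl | rfl <;> linarith⟩
  rw [wallHoles, List.pairwise_cons, List.pairwise_cons]
  refine ⟨?_, ?_, ?_⟩
  · intro V hV
    rw [List.mem_cons] at hV
    rcases hV with rfl | hV
    · exact disjoint_region_rect (by linarith) (by linarith) (by linarith) (by linarith)
        (.inr (.inl (by linarith)))
    · obtain ⟨x₀, x₁, y₀, y₁, rfl, hx, hy, h0, h1⟩ := hw V hV
      exact disjoint_region_rect (by linarith) (by linarith) hx hy (.inr (.inl h0))
  · intro V hV
    obtain ⟨x₀, x₁, y₀, y₁, rfl, hx, hy, h0, h1⟩ := hw V hV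
    exact disjoint_region_rect (by linarith) (by linarith) hx hy (.inr (.inr h1))
  · rw [List.pairwise_flatMap]
    refine ⟨fun i hi => ?_, ?_⟩
    · rw [List.mem_range] at hi
      simp only [walls, List.pairwise_cons, List.mem_cons, List.not_mem_nil, or_false,
        forall_eq_or_imp, forall_eq, List.Pairwise.nil, and_true, IsEmpty.forall_iff, implies_true]
      exact ⟨⟨disjoint_walls hl hi hi (.inl rfl) (.inr rfl) (.inr (.inl (by linarith))),
        disjoint_walls hl hi hi (.inl rfl) (.inl rfl) (.inr (.inl (by linarith)))⟩,
        disjoint_walls hl hi hi (.inr rfl) (.inl rfl) (.inr (.inl (by linarith)))⟩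
    · refine (List.pairwise_lt_range (n := l.length + 1)).imp_of_mem ?_
      intro i i' hi hi' hlt V hV V' hV'
      rw [List.mem_range] at hi hi'
      simp only [walls, List.mem_cons, List.not_mem_nil, or_false] at hV hV'
      rcases hV with rfl | rfl | rfl <;> rcases hV' with rfl | rfl | rfl <;>
        refine disjoint_walls hl hi hi' (by simp) (by simp) ?_ <;>
        first
        | exact .inl ⟨rfl, hlt⟩
        | exact .inr (.inl (by linarith))
        | exact .inr (.inr (by linarith))

/-- The polygonal domain of a sorted list. -/
def wallDomain (l : List ℤ) (hl : l.Pairwise (· < ·)) : PolygonalDomain where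
  outer := outerRect l
  holes := wallHoles l
  outer_simple := by
    have := one_le_bigM_real l
    exact isSimplePolygon_rect (by linarith) (by linarith)
  holes_simple := by
    intro V hV
    obtain ⟨x₀, x₁, y₀, y₁, rfl, hx, hy, -⟩ := exists_rect_of_mem_wallHoles hl hV
    exact isSimplePolygon_rect hx hy
  holes_inside := by
    have := one_le_bigM_real l
    intro V hV p hp
    obtain ⟨x₀, x₁, y₀, y₁, rfl, hx, hy, h1, h2, h3, h4⟩ := exists_rect_of_mem_wallHoles hl hV
    rw [mem_region_rect hx.le hy.le] at hp
    rw [outerRect, mem_inside_rect (by linarith) (by linarith)]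
    exact ⟨⟨by linarith [hp.1.1], by linarith [hp.1.2]⟩, by linarith [hp.2.1],
      by linarith [hp.2.2]⟩
  holes_disjoint := pairwise_wallHoles hl

/-- The instance for a sorted list. -/
def wallInstance (l : List ℤ) (hl : l.Pairwise (· < ·)) : DomainInstance where
  dom := wallDomain l hl
  e := (1, 2)
  e' := (2, 0)
  isEdge := by
    constructor
    · simp [PolygonalDomain.polys, wallDomain, wallHoles]
    · simp [PolygonalDomain.polys, wallDomain, wallHoles, lowerHole, rect]
  isEdge' := by
    constructor
    · simp [PolygonalDomain.polys, wallDomain, wallHoles]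
    · simp [PolygonalDomain.polys, wallDomain, wallHoles, upperHole, rect]
  ne := by simp

theorem mem_wallDomain (hl : l.Pairwise (· < ·)) {p : ℝ × ℝ} :
    p ∈ (wallDomain l hl).carrier ↔ p ∈ region (outerRect l) ∧ p ∉ inside (lowerHole l) ∧
      p ∉ inside (upperHole l) ∧ ∀ i < l.length + 1, ∀ V ∈ walls l i, p ∉ inside V := by
  simp only [PolygonalDomain.carrier, wallDomain, wallHoles, Set.mem_sdiff, Set.mem_iUnion,
    List.mem_cons, List.mem_flatMap, List.mem_range, exists_prop, not_exists, not_and]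
  constructor
  · rintro ⟨h, h'⟩
    exact ⟨h, h' _ (.inl rfl), h' _ (.inr (.inl rfl)),
      fun i hi V hV => h' V (.inr (.inr ⟨i, hi, hV⟩))⟩
  · rintro ⟨h, h1, h2, h3⟩
    refine ⟨h, ?_⟩
    rintro V (rfl | rfl | ⟨i, hi, hV⟩)
    · exact h1
    · exact h2
    · exact h3 i hi V hV

/-- On the middle line of a row of walls only the neighborhoods of the gap centers are free. -/
theorem exists_center_near_of_mem (hl : l.Pairwise (· < ·)) {c : ℕ → ℤ} {y : ℝ}
    (hc : c = centerUp l ∨ c = centerDown l) (hw : ∀ i, wall c y i ∈ walls l i) {p : ℝ × ℝ}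
    (hp : p ∈ (wallDomain l hl).carrier) (hy : p.2 = y)
    (hx : |p.1| ≤ 60 * bigM l) : ∃ i < l.length, |p.1 - c (i + 1)| ≤ 1 := by
  have hM := one_le_bigM_real l
  have hx := abs_le.1 hx
  have he := center_ends hc
  have e0 : (c 0 : ℝ) ≤ -80 * bigM l := by exact_mod_cast he.1.2
  have e1 : 80 * (bigM l : ℝ) ≤ c (l.length + 1) := by exact_mod_cast he.2.1
  obtain ⟨i, hi, h⟩ := exists_center_near (c := c) (m := l.length + 1) (x := p.1)
    (by linarith) (by linarith) fun i hi h => by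
      refine ((mem_wallDomain hl).1 hp).2.2.2 i hi _ (hw i) ?_
      have := center_step_real hl hc hi
      rw [wall, mem_inside_rect (by linarith) (by linarith)]
      exact ⟨h, by linarith, by linarith⟩
  have h' := abs_le.1 h
  rcases Nat.eq_zero_or_pos i with rfl | h0
  · linarith
  rcases hi.eq_or_lt with rfl | h1
  · linarith
  · refine ⟨i - 1, by omega, ?_⟩
    rwa [show i - 1 + 1 = i by omega]

/-- At parameters `1/4`, `1/2`, `3/4` a sight line crosses the middle lines of the three rows, and
its middle abscissa is the mean of the outer two. -/
theorem wallInstance_yes_iff (hl : l.Pairwise (· < ·)) :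
    domainEdgeVisibility.Yes (wallInstance l hl) ↔
      ∃ a ∈ l, ∃ b ∈ l, ∃ c ∈ l, a + b + c = 0 := by
  have hM := one_le_bigM_real l
  have edge1 : ∀ p : ℝ × ℝ, p ∈ (wallDomain l hl).edgeSet (1, 2) ↔
      (-60 * bigM l ≤ p.1 ∧ p.1 ≤ 60 * bigM l) ∧ p.2 = 0 := fun p =>
    mem_edge_rect_two (by linarith)
  have edge2 : ∀ p : ℝ × ℝ, p ∈ (wallDomain l hl).edgeSet (2, 0) ↔
      (-60 * bigM l ≤ p.1 ∧ p.1 ≤ 60 * bigM l) ∧ p.2 = 128 * bigM l := fun p =>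
    mem_edge_rect_zero (by linarith)
  change WeaklyVisible (wallDomain l hl).carrier ((wallDomain l hl).edgeSet (1, 2))
    ((wallDomain l hl).edgeSet (2, 0)) ↔ _
  constructor
  · rintro ⟨p, hp, p', hp', hseg⟩
    rw [edge1] at hp
    rw [edge2] at hp'
    have pt : ∀ t : ℝ, 0 ≤ t → t ≤ 1 → ((1 - t) • p + t • p') ∈ (wallDomain l hl).carrier ∧
        |((1 - t) • p + t • p').1| ≤ 60 * bigM l := by
      intro t h0 h1
      refine ⟨hseg ⟨1 - t, t, by linarith, h0, by ring, rfl⟩, ?_⟩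
      simp only [Prod.fst_add, Prod.smul_fst, smul_eq_mul]
      rw [abs_le]
      constructor <;> nlinarith
    have hy : ∀ t : ℝ, ((1 - t) • p + t • p').2 = t * (128 * bigM l) := by
      intro t
      simp only [Prod.snd_add, Prod.smul_snd, smul_eq_mul, hp.2, hp'.2]; ring
    obtain ⟨m1, b1⟩ := pt (1 / 4) (by norm_num) (by norm_num)
    obtain ⟨m2, b2⟩ := pt (1 / 2) (by norm_num) (by norm_num)
    obtain ⟨m3, b3⟩ := pt (3 / 4) (by norm_num) (by norm_num)
    obtain ⟨i, hi, n1⟩ := exists_center_near_of_mem hl (.inl rfl) (y := 32 * bigM l)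
      (by simp [walls]) m1 (by rw [hy]; ring) b1
    obtain ⟨j, hj, n2⟩ := exists_center_near_of_mem hl (.inr rfl) (y := 64 * bigM l)
      (by simp [walls]) m2 (by rw [hy]; ring) b2
    obtain ⟨k, hk, n3⟩ := exists_center_near_of_mem hl (.inl rfl) (y := 96 * bigM l)
      (by simp [walls]) m3 (by rw [hy]; ring) b3
    rw [centerUp_succ hi, abs_le] at n1
    rw [centerDown_succ hj, abs_le] at n2
    rw [centerUp_succ hk, abs_le] at n3
    simp only [Prod.fst_add, Prod.smul_fst, smul_eq_mul] at n1 n2 n3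
    push_cast at n1 n2 n3
    refine ⟨_, up_mem hi, _, up_mem hk, _, down_mem hj, ?_⟩
    -- The errors of the outer rows count once and that of the middle row twice, so 16 times the sum
    -- has absolute value at most 4.
    have h1 : ((up l i + up l k + down l j : ℤ) : ℝ) < 1 := by push_cast; linarith
    have h2 : (-1 : ℝ) < ((up l i + up l k + down l j : ℤ) : ℝ) := by push_cast; linarith
    have h1 : up l i + up l k + down l j < 1 := by exact_mod_cast h1
    have h2 : -1 < up l i + up l k + down l j := by exact_mod_cast h2
    omega
  · rintro ⟨a, ha, b, hb, c, hc, habc⟩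
    have habc : (a : ℝ) + b + c = 0 := by exact_mod_cast habc
    have ba := abs_lt.1 (abs_cast_lt_bigM hl ha)
    have bb := abs_lt.1 (abs_cast_lt_bigM hl hb)
    obtain ⟨i, hi, rfl⟩ := exists_up_eq ha
    obtain ⟨k, hk, rfl⟩ := exists_up_eq hb
    obtain ⟨j, hj, rfl⟩ := exists_down_eq hc
    set A : ℝ := ((up l i : ℤ) : ℝ) with hA
    set B : ℝ := ((up l k : ℤ) : ℝ) with hB
    set C : ℝ := ((down l j : ℤ) : ℝ) with hC
    set M : ℝ := ((bigM l : ℤ) : ℝ) with hM'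
    -- The line through `(16 A, 32 M)` and `(16 B, 96 M)`, extended to the heights 0 and `128 M`;
    -- the abscissas there are below `32 M` in absolute value, so they lie on the edges.
    refine ⟨(24 * A - 8 * B, 0), ?_, (24 * B - 8 * A, 128 * M), ?_, ?_⟩
    · rw [edge1]; exact ⟨⟨by linarith, by linarith⟩, rfl⟩
    · rw [edge2]; exact ⟨⟨by linarith, by linarith⟩, rfl⟩
    rintro _ ⟨u, t, hu, ht, hut, rfl⟩
    obtain rfl : u = 1 - t := by linarith
    have e1 : ((1 - t) • ((24 * A - 8 * B, 0) : ℝ × ℝ) + t • (24 * B - 8 * A, 128 * M)).1 =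
        24 * A - 8 * B + 32 * (t * (B - A)) := by
      simp only [Prod.fst_add, Prod.smul_fst, smul_eq_mul]; ring
    have e2 : ((1 - t) • ((24 * A - 8 * B, 0) : ℝ × ℝ) + t • (24 * B - 8 * A, 128 * M)).2 =
        128 * (t * M) := by
      simp only [Prod.snd_add, Prod.smul_snd, smul_eq_mul]; ring
    generalize (1 - t) • ((24 * A - 8 * B, 0) : ℝ × ℝ) + t • (24 * B - 8 * A, 128 * M) = z
      at e1 e2
    have t0 : 0 ≤ t * M := mul_nonneg ht (by linarith)
    have t1 : t * M ≤ M := by nlinarith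
    -- near the middle line of a row the segment is close to its gap center
    have far : ∀ (c : ℕ → ℤ) (y τ : ℝ) (r : ℕ), (c = centerUp l ∨ c = centerDown l) →
        r < l.length → y = 128 * (τ * M) → (c (r + 1) : ℝ) = 24 * A - 8 * B + 32 * (τ * (B - A)) →
        ∀ i < l.length + 1, z ∉ inside (wall c y i) := by
      intro c y τ r hc hr hy hcr i hi hz
      have hst := center_step_real hl hc hi
      rw [wall, mem_inside_rect (by linarith) (by linarith)] at hz
      obtain ⟨⟨z1, z2⟩, z3, z4⟩ := hz
      rw [hy, e2] at z3 z4
      -- The horizontal drift is at most half of the vertical offset, because `|B - A| ≤ 2 M`.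
      -- Inside a wall the offset is below 1, so the point is less than `1/2` from its gap center,
      -- and that center would lie strictly between two consecutive centers.
      have hd : |(t - τ) * (B - A)| ≤ |t - τ| * (2 * M) := by
        rw [abs_mul]
        refine mul_le_mul_of_nonneg_left ?_ (abs_nonneg _)
        rw [abs_le]; constructor <;> linarith
      have hd' : |t - τ| * M = |(t - τ) * M| := by
        rw [abs_mul, abs_of_nonneg (show (0 : ℝ) ≤ M by linarith)]
      have hd'' : |(t - τ) * M| < 1 / 128 := by
        rw [abs_lt]; constructor <;> linarith
      have h3 : |(t - τ) * (B - A)| < 1 / 64 := by linarith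
      have h4 := abs_lt.1 h3
      exact center_not_between (center_step hl hc) hi (j := r + 1) (by omega) (by linarith)
        (by linarith)
    rw [mem_wallDomain]
    refine ⟨?_, ?_, ?_, ?_⟩
    · rw [outerRect, mem_region_rect (by linarith) (by linarith), e1, e2]
      have : |t * (B - A)| ≤ 1 * (2 * M) := by
        rw [abs_mul]
        refine mul_le_mul (by rw [abs_of_nonneg ht]; linarith) ?_ (abs_nonneg _) (by norm_num)
        rw [abs_le]; constructor <;> linarith
      have := abs_le.1 this
      exact ⟨⟨by linarith, by linarith⟩, by linarith, by linarith⟩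
    · rw [lowerHole, mem_inside_rect (by linarith) (by linarith), e2]
      exact fun h => by linarith [h.2.2]
    · rw [upperHole, mem_inside_rect (by linarith) (by linarith), e2]
      exact fun h => by linarith [h.2.1]
    · intro i' hi' V hV
      simp only [walls, List.mem_cons, List.not_mem_nil, or_false] at hV
      rcases hV with rfl | rfl | rfl
      · refine far _ _ (1 / 4) i (.inl rfl) hi (by ring) ?_ i' hi'
        rw [centerUp_succ hi]; push_cast; ring
      · refine far _ _ (1 / 2) j (.inr rfl) hj (by ring) ?_ i' hi'
        rw [centerDown_succ hj]; push_cast; linarith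
      · refine far _ _ (3 / 4) k (.inl rfl) hk (by ring) ?_ i' hi'
        rw [centerUp_succ hk]; push_cast; ring

/-! ### Its encoding -/

/-- The coordinates of a rectangle. -/
def linRect (x₀ x₁ y₀ y₁ : Lin) : List Lin := [x₀, y₀, x₁, y₀, x₁, y₁, x₀, y₁]

theorem map_linRect (f : Lin → ℝ) (x₀ x₁ y₀ y₁ : Lin) :
    (linRect x₀ x₁ y₀ y₁).map f = coords (rect (f x₀) (f x₁) (f y₀) (f y₁)) := rfl

/-- The template of the polygonal domains. -/
def domainTemplate : Template where
  realHead := linRect { big := -200 } { big := 200 } { one := -2 } { one := 2, big := 128 } ++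
    (linRect { big := -60 } { big := 60 } { one := -1 } {} ++
    linRect { big := -60 } { big := 60 } { big := 128 } { one := 1, big := 128 })
  realBody :=
    linRect { one := 1, p := 16 } { one := -1, a := 16 } { one := -1, big := 32 }
      { one := 1, big := 32 } ++
    (linRect { one := 1, q := -8 } { one := -1, b := -8 } { one := -1, big := 64 }
      { one := 1, big := 64 } ++
    linRect { one := 1, p := 16 } { one := -1, a := 16 } { one := -1, big := 96 }
      { one := 1, big := 96 })
  realTail :=
    linRect { one := 1, p := 16 } { one := -1, big := 160 } { one := -1, big := 32 }
      { one := 1, big := 32 } ++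
    (linRect { one := 1, q := -8 } { one := -1, big := 80 } { one := -1, big := 64 }
      { one := 1, big := 64 } ++
    linRect { one := 1, p := 16 } { one := -1, big := 160 } { one := -1, big := 96 }
      { one := 1, big := 96 })
  -- The edge names `(1, 2)` and `(2, 0)`, followed by the vertex counts of the outer rectangle and
  -- of the two holes that carry the edges.
  natHead := [1, 2, 2, 0, 4, 4, 4]
  natBody := [4, 4, 4]
  natTail := [4, 4, 4]
  stride := 0

theorem coords_flatten (L : List (List (ℝ × ℝ))) : coords L.flatten = L.flatMap coords := by
  induction L with
  | nil => rfl
  | cons V L ih => rw [List.flatten_cons, List.flatMap_cons, ← ih, coords, List.flatMap_append]; rfl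

theorem centerUp_of_le {i : ℕ} (hi : i ≤ l.length) : centerUp l i = 16 * prevUp l i := by
  rw [centerUp, if_neg (by omega)]

theorem centerDown_of_le {i : ℕ} (hi : i ≤ l.length) : centerDown l i = -8 * prevDown l i := by
  rw [centerDown, if_neg (by omega)]

/-- Wall `i` reaches from the gap of the previous entry to that of the current one, so the body
needs only these two; the sentinel before the first entry fits the same formula. The last walls end
at the other sentinel and form the tail. -/
theorem encode_wallInstance (hl : l.Pairwise (· < ·)) :
    domainEdgeVisibility.encode (wallInstance l hl) = domainTemplate.word l := by
  have hp : (wallInstance l hl).dom.polys = [outerRect l, lowerHole l, upperHole l] ++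
      (List.range l.length).flatMap (walls l) ++ walls l l.length := by
    change outerRect l :: wallHoles l = _
    rw [wallHoles, List.range_succ, List.flatMap_append, List.flatMap_singleton]
    rfl
  change Word.mk ([1, 2, 2, 0] ++ (wallInstance l hl).dom.polys.map List.length)
    (coords (wallInstance l hl).dom.polys.flatten) = _
  rw [hp, Template.word, Word.mk.injEq]
  constructor
  · rw [List.map_append, List.map_append, List.map_flatMap]
    rfl
  · rw [coords_flatten, List.flatMap_append, List.flatMap_append, List.flatMap_assoc]
    refine congrArg₂ _ (congrArg₂ _ ?_ (List.flatMap_congr fun i hi => ?_)) ?_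
    · simp only [Template.headReals, domainTemplate, List.map_append, map_linRect, outerRect,
        lowerHole, upperHole, List.flatMap_cons, List.flatMap_nil, List.append_nil, Lin.eval]
      simp only [Int.cast_zero, Int.cast_neg, Int.cast_ofNat, Int.cast_one, zero_mul, mul_zero,
        add_zero, zero_add, add_comm]
    · rw [List.mem_range] at hi
      simp only [Template.bodyReals, domainTemplate, List.map_append, map_linRect, walls, wall,
        List.flatMap_cons, List.flatMap_nil, List.append_nil, Lin.eval, centerUp_of_le hi.le,
        centerDown_of_le hi.le, centerUp_succ hi, centerDown_succ hi]
      push_cast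
      ring_nf
    · simp only [Template.tailReals, domainTemplate, List.map_append, map_linRect, walls, wall,
        List.flatMap_cons, List.flatMap_nil, List.append_nil, Lin.eval, centerUp_of_le le_rfl,
        centerDown_of_le le_rfl, centerUp_last, centerDown_last]
      push_cast
      ring_nf

end Domain

theorem isThreeSumHard_domainEdgeVisibility : IsThreeSumHard domainEdgeVisibility :=
  isThreeSumHard_of_template domainTemplate fun l _ hl =>
    ⟨wallInstance l hl, encode_wallInstance hl, wallInstance_yes_iff hl⟩

/-! ### Convex hulls of indexed points -/

section Hull

/-- The function commutes with convex combinations. -/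
def IsAffineFun {E : Type*} [AddCommGroup E] [Module ℝ E] (g : E → ℝ) : Prop :=
  ∀ x y : E, ∀ a b : ℝ, a + b = 1 → g (a • x + b • y) = a * g x + b * g y

variable {E : Type*} [AddCommGroup E] [Module ℝ E] {g : E → ℝ} {pt : ℕ → E} {A B : Set ℕ}

/-- A point of a polytope at which an affine function has its minimum lies in the face of the minimum. -/
theorem mem_face (hg : IsAffineFun g) (hA : ∀ i ∈ A, 0 ≤ g (pt i)) {x : E}
    (hx : x ∈ convexHull ℝ (pt '' A)) (h : g x ≤ 0) :
    x ∈ convexHull ℝ (pt '' {i | i ∈ A ∧ g (pt i) = 0}) := by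
  -- The right side contains the vertices and is convex: a combination with positive weights of
  -- nonnegative values vanishes only if both values vanish.
  have key : convexHull ℝ (pt '' A) ⊆
      {x | 0 ≤ g x ∧ (g x = 0 → x ∈ convexHull ℝ (pt '' {i | i ∈ A ∧ g (pt i) = 0}))} := by
    refine convexHull_min ?_ ?_
    · rintro _ ⟨i, hi, rfl⟩
      exact ⟨hA i hi, fun h => subset_convexHull _ _ ⟨i, ⟨hi, h⟩, rfl⟩⟩
    · rw [convex_iff_forall_pos]
      rintro x ⟨hx, hx'⟩ y ⟨hy, hy'⟩ a b ha hb hab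
      have e := hg x y a b hab
      have h1 := mul_nonneg ha.le hx
      have h2 := mul_nonneg hb.le hy
      refine ⟨by rw [e]; positivity, fun h0 => ?_⟩
      rw [e] at h0
      have h3 : a * g x = 0 := by linarith
      have h4 : b * g y = 0 := by linarith
      exact convex_convexHull _ _ (hx' ((mul_eq_zero.1 h3).resolve_left ha.ne'))
        (hy' ((mul_eq_zero.1 h4).resolve_left hb.ne')) ha.le hb.le hab
  obtain ⟨h1, h2⟩ := key hx
  exact h2 (le_antisymm h h1)

/-- Two polytopes meet in the common face that is spanned by their common vertices. -/
def MeetFaceToFace (pt : ℕ → E) (A B : Set ℕ) : Prop :=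
  convexHull ℝ (pt '' A) ∩ convexHull ℝ (pt '' B) ⊆ convexHull ℝ (pt '' (A ∩ B))

theorem MeetFaceToFace.symm (h : MeetFaceToFace pt A B) : MeetFaceToFace pt B A := by
  intro x hx
  rw [Set.inter_comm B A]
  exact h ⟨hx.2, hx.1⟩

theorem MeetFaceToFace.of_subset (h : B ⊆ A) : MeetFaceToFace pt A B := by
  intro x hx
  rw [Set.inter_eq_right.2 h]
  exact hx.2

/-- Two polytopes on different sides of a hyperplane meet in the hyperplane. -/
theorem MeetFaceToFace.of_separated (hg : IsAffineFun g) (hA : ∀ i ∈ A, g (pt i) ≤ 0)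
    (hB : ∀ i ∈ B, 0 ≤ g (pt i))
    (h : MeetFaceToFace pt {i | i ∈ A ∧ g (pt i) = 0} {i | i ∈ B ∧ g (pt i) = 0}) :
    MeetFaceToFace pt A B := by
  rintro x ⟨hxA, hxB⟩
  have hg' : IsAffineFun fun x => -g x := fun x y a b hab => by
    simp only [hg x y a b hab]; ring
  have le : ∀ (f : E → ℝ) (C : Set ℕ), IsAffineFun f → (∀ i ∈ C, 0 ≤ f (pt i)) →
      x ∈ convexHull ℝ (pt '' C) → 0 ≤ f x := by
    intro f C hf hC hx
    by_contra hlt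
    have h1 := mem_face hf hC hx (by linarith)
    have : convexHull ℝ (pt '' {i | i ∈ C ∧ f (pt i) = 0}) ⊆ {x | f x = 0} := by
      refine convexHull_min ?_ fun y hy z hz a b _ _ hab => ?_
      · rintro _ ⟨i, hi, rfl⟩; exact hi.2
      · rw [Set.mem_ofPred_eq] at *; rw [hf y z a b hab, hy, hz]; ring
    exact hlt (this h1).ge
  have h1 := le g B hg hB hxB
  have h2 := le (fun x => -g x) A hg' (fun i hi => by linarith [hA i hi]) hxA
  -- Now `g x = 0`, so `x` lies in the zero face of either polytope and the hypothesis on these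
  -- faces applies.
  have h3 := mem_face hg hB hxB (by linarith)
  have h4 := mem_face hg' (fun i hi => by linarith [hA i hi]) hxA (by linarith)
  simp only [neg_eq_zero] at h4
  refine convexHull_mono (Set.image_mono ?_) (h ⟨h4, h3⟩)
  exact fun i hi => ⟨hi.1.1, hi.2.1⟩

/-- It suffices that the vertices of the one polytope in a separating hyperplane are common. -/
theorem MeetFaceToFace.of_separated_of_subset (hg : IsAffineFun g) (hA : ∀ i ∈ A, g (pt i) ≤ 0)
    (hB : ∀ i ∈ B, 0 ≤ g (pt i)) (h : ∀ i ∈ B, g (pt i) = 0 → i ∈ A) :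
    MeetFaceToFace pt A B :=
  .of_separated hg hA hB (.of_subset fun i hi => ⟨h i hi.1 hi.2, hi.2⟩)

theorem mem_convexHull_three {s : Set E} {p q r x : E} (hp : p ∈ s) (hq : q ∈ s) (hr : r ∈ s)
    {a b c : ℝ} (ha : 0 ≤ a) (hb : 0 ≤ b) (hc : 0 ≤ c) (h : a + b + c = 1)
    (hx : x = a • p + b • q + c • r) : x ∈ convexHull ℝ s := by
  have := (convex_convexHull ℝ s).sum_mem (t := Finset.univ) (w := ![a, b, c]) (z := ![p, q, r])
    (by simp [Fin.forall_fin_succ, ha, hb, hc]) (by simp [Fin.sum_univ_three, h])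
    (by
      simp only [Finset.mem_univ, Fin.forall_fin_succ, forall_true_left]
      exact ⟨subset_convexHull _ _ hp, subset_convexHull _ _ hq, subset_convexHull _ _ hr, by simp⟩)
  rw [Fin.sum_univ_three] at this
  rw [hx]
  exact this

end Hull

/-- If the points were collinear, both difference vectors would be multiples of one vector and the
determinant would vanish. -/
theorem affineIndependent_of_det {p q s : ℝ × ℝ}
    (h : (q.1 - p.1) * (s.2 - p.2) - (q.2 - p.2) * (s.1 - p.1) ≠ 0) :
    AffineIndependent ℝ ![p, q, s] := by
  rw [affineIndependent_iff_not_collinear_set,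
    collinear_iff_of_mem (p₀ := p) (by simp)]
  rintro ⟨v, hv⟩
  obtain ⟨a, ha⟩ := hv q (by simp)
  obtain ⟨b, hb⟩ := hv s (by simp)
  apply h
  rw [ha, hb]
  simp only [vadd_eq_add, Prod.fst_add, Prod.snd_add, Prod.smul_fst, Prod.smul_snd, smul_eq_mul]
  ring

/-- A discrete intermediate value theorem. -/
theorem exists_between_steps {w : ℕ → ℝ} {m : ℕ} (hm : 0 < m) {x : ℝ} (h0 : w 0 ≤ x)
    (h1 : x ≤ w m) : ∃ k < m, w k ≤ x ∧ x ≤ w (k + 1) := by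
  induction m with
  | zero => omega
  | succ m ih =>
    rcases le_or_gt (w m) x with h | h
    · exact ⟨m, by omega, h, h1⟩
    · rcases Nat.eq_zero_or_pos m with rfl | hm'
      · linarith
      · obtain ⟨k, hk, h⟩ := ih hm' h.le
        exact ⟨k, by omega, h⟩

/-! ### Terrains over a grid -/

/-- Rows of points at increasing heights in the plane, all with the same number of points and the same
first and last abscissa; `Z` is the height of the surface. -/
structure Grid where
  strips : ℕ
  cells : ℕ
  X : ℕ → ℕ → ℝ
  Y : ℕ → ℝ
  Z : ℕ → ℕ → ℝ
  left : ℝ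
  right : ℝ
  strips_pos : 0 < strips
  cells_pos : 0 < cells
  Y_lt : ∀ r r', r < r' → r' ≤ strips → Y r < Y r'
  X_lt : ∀ r ≤ strips, ∀ k k', k < k' → k' ≤ cells → X r k < X r k'
  X_left : ∀ r ≤ strips, X r 0 = left
  X_right : ∀ r ≤ strips, X r cells = right
  Z_nonneg : ∀ r k, 0 ≤ Z r k

namespace Grid

/-- The indices of the vertices of the lower triangle of a cell, if there are `m` rows. -/
def lower (m k r : ℕ) : ℕ × ℕ × ℕ := (k * m + r, (k + 1) * m + r, k * m + (r + 1))

/-- The indices of the vertices of the upper triangle of a cell. -/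
def upper (m k r : ℕ) : ℕ × ℕ × ℕ := ((k + 1) * m + r, k * m + (r + 1), (k + 1) * m + (r + 1))

/-- The triangles between two columns. -/
def cellTris (m k : ℕ) : List (ℕ × ℕ × ℕ) :=
  (List.range (m - 1)).flatMap fun r => [lower m k r, upper m k r]

variable (G : Grid)

/-- The index of a vertex. -/
def idx (k r : ℕ) : ℕ := k * (G.strips + 1) + r

/-- A vertex. -/
def point (k r : ℕ) : (ℝ × ℝ) × ℝ := ((G.X r k, G.Y r), G.Z r k)

/-- The vertices with the same number in all rows. -/
def column (k : ℕ) : List ((ℝ × ℝ) × ℝ) := (List.range (G.strips + 1)).map (G.point k)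

/-- All vertices. -/
def verts : List ((ℝ × ℝ) × ℝ) := (List.range (G.cells + 1)).flatMap G.column

/-- All triangles. -/
def tris : List (ℕ × ℕ × ℕ) := (List.range G.cells).flatMap (cellTris (G.strips + 1))

theorem mem_tris {t : ℕ × ℕ × ℕ} : t ∈ G.tris ↔ ∃ k < G.cells, ∃ r < G.strips,
    t = lower (G.strips + 1) k r ∨ t = upper (G.strips + 1) k r := by
  simp [tris, cellTris]

theorem length_verts : G.verts.length = (G.cells + 1) * (G.strips + 1) :=
  Template.length_flatMap_range _ _ _ fun i => by simp [column]

theorem getD_flatMap_range {α : Type*} (f : ℕ → List α) (c : ℕ) (h : ∀ i, (f i).length = c)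
    (d : α) {n k r : ℕ} (hk : k < n) (hr : r < c) :
    ((List.range n).flatMap f).getD (k * c + r) d = (f k).getD r d := by
  induction n with
  | zero => omega
  | succ n ih =>
    have hl := Template.length_flatMap_range f c n h
    rw [List.range_succ, List.flatMap_append, List.flatMap_singleton]
    rcases Nat.lt_or_ge k n with hkn | hkn
    · have : (k + 1) * c ≤ n * c := Nat.mul_le_mul_right c hkn
      rw [List.getD_append _ _ _ _ (by rw [hl]; rw [Nat.add_mul] at this; omega), ih hkn]
    · obtain rfl : k = n := by omega
      rw [List.getD_append_right _ _ _ _ (by rw [hl]; omega), hl, Nat.add_sub_cancel_left]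

theorem getD_verts {k r : ℕ} (hk : k ≤ G.cells) (hr : r ≤ G.strips) :
    G.verts.getD (G.idx k r) 0 = G.point k r := by
  rw [verts, idx, getD_flatMap_range _ _ (fun i => by simp [column]) _ (by omega) (by omega),
    column, List.getD_eq_getElem _ _ (by simp; omega)]
  simp

/-- The projection of a vertex. -/
def proj (i : ℕ) : ℝ × ℝ := (G.verts.getD i 0).1

theorem proj_idx {k r : ℕ} (hk : k ≤ G.cells) (hr : r ≤ G.strips) :
    G.proj (G.idx k r) = (G.X r k, G.Y r) := by rw [proj, G.getD_verts hk hr]; rfl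

theorem X_le {r k k' : ℕ} (hr : r ≤ G.strips) (h : k ≤ k') (hk : k' ≤ G.cells) :
    G.X r k ≤ G.X r k' := by
  rcases h.eq_or_lt with rfl | h
  · rfl
  · exact (G.X_lt r hr k k' h hk).le

theorem Y_le {r r' : ℕ} (h : r ≤ r') (hr : r' ≤ G.strips) : G.Y r ≤ G.Y r' := by
  rcases h.eq_or_lt with rfl | h
  · rfl
  · exact (G.Y_lt r r' h hr).le

/-- The indices of the vertices of a triangle. -/
theorem exists_idx_eq {k r : ℕ} {t : ℕ × ℕ × ℕ}
    (h : t = lower (G.strips + 1) k r ∨ t = upper (G.strips + 1) k r) :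
    ∀ i ∈ triIdx t, ∃ l s, i = G.idx l s ∧ (l = k ∨ l = k + 1) ∧ (s = r ∨ s = r + 1) := by
  rcases h with rfl | rfl
  · rintro i (rfl | rfl | rfl)
    · exact ⟨k, r, rfl, .inl rfl, .inl rfl⟩
    · exact ⟨k + 1, r, rfl, .inr rfl, .inl rfl⟩
    · exact ⟨k, r + 1, rfl, .inl rfl, .inr rfl⟩
  · rintro i (rfl | rfl | rfl)
    · exact ⟨k + 1, r, rfl, .inr rfl, .inl rfl⟩
    · exact ⟨k, r + 1, rfl, .inl rfl, .inr rfl⟩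
    · exact ⟨k + 1, r + 1, rfl, .inr rfl, .inr rfl⟩

theorem nondegenerate_aux {k r : ℕ} (hk : k < G.cells) (hr : r < G.strips) :
    AffineIndependent ℝ ![G.proj (G.idx k r), G.proj (G.idx (k + 1) r), G.proj (G.idx k (r + 1))] ∧
    AffineIndependent ℝ
      ![G.proj (G.idx (k + 1) r), G.proj (G.idx k (r + 1)), G.proj (G.idx (k + 1) (r + 1))] := by
  rw [G.proj_idx (by omega) (by omega), G.proj_idx (by omega) (by omega),
    G.proj_idx (by omega) (by omega), G.proj_idx (by omega) (by omega)]
  have hy := sub_pos.2 (G.Y_lt r (r + 1) (by omega) (by omega))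
  have h1 := sub_pos.2 (G.X_lt r (by omega) k (k + 1) (by omega) (by omega))
  have h2 := sub_pos.2 (G.X_lt (r + 1) (by omega) k (k + 1) (by omega) (by omega))
  refine ⟨affineIndependent_of_det ?_, affineIndependent_of_det ?_⟩
  · have := mul_pos h1 hy
    simp only []
    nlinarith
  · have := mul_pos h2 hy
    simp only []
    nlinarith

theorem isAffineFun_snd (c : ℝ) : IsAffineFun fun p : ℝ × ℝ => p.2 - c := by
  intro x y a b hab
  simp only [Prod.snd_add, Prod.smul_snd, smul_eq_mul]
  linear_combination c * hab

theorem isAffineFun_fst (c : ℝ) : IsAffineFun fun p : ℝ × ℝ => p.1 - c := by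
  intro x y a b hab
  simp only [Prod.fst_add, Prod.smul_fst, smul_eq_mul]
  linear_combination c * hab

/-- Triangles of one strip meet face to face. -/
theorem meet_same_strip {k k' r : ℕ} (hk : k < G.cells) (hk' : k' < G.cells) (hr : r < G.strips)
    {t t' : ℕ × ℕ × ℕ}
    (h : (t = lower (G.strips + 1) k r ∧ k < k' ∧ t' = lower (G.strips + 1) k' r) ∨
      (t = lower (G.strips + 1) k r ∧ k ≤ k' ∧ t' = upper (G.strips + 1) k' r) ∨
      (t = upper (G.strips + 1) k r ∧ k < k' ∧ t' = lower (G.strips + 1) k' r) ∨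
      (t = upper (G.strips + 1) k r ∧ k < k' ∧ t' = upper (G.strips + 1) k' r)) :
    MeetFaceToFace G.proj (triIdx t) (triIdx t') := by
  have hy := sub_pos.2 (G.Y_lt r (r + 1) (by omega) (by omega))
  -- the line through point `a` of row `r` and point `b` of row `r + 1`
  set g : ℕ → ℕ → ℝ × ℝ → ℝ := fun a b p =>
    (p.1 - G.X r a) * (G.Y (r + 1) - G.Y r) - (G.X (r + 1) b - G.X r a) * (p.2 - G.Y r) with hgdef
  have hg : ∀ a b, IsAffineFun (g a b) := by
    intro a b x y u v huv
    simp only [hgdef, Prod.fst_add, Prod.smul_fst, Prod.snd_add, Prod.smul_snd, smul_eq_mul]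
    linear_combination (G.X r a * (G.Y (r + 1) - G.Y r) -
      (G.X (r + 1) b - G.X r a) * G.Y r) * huv
  have e1 : ∀ a b l, l ≤ G.cells → g a b (G.proj (G.idx l r)) =
      (G.X r l - G.X r a) * (G.Y (r + 1) - G.Y r) := by
    intro a b l hl
    rw [G.proj_idx hl (by omega)]
    simp only [hgdef]; ring
  have e2 : ∀ a b l, l ≤ G.cells → g a b (G.proj (G.idx l (r + 1))) =
      (G.X (r + 1) l - G.X (r + 1) b) * (G.Y (r + 1) - G.Y r) := by
    intro a b l hl
    rw [G.proj_idx hl (by omega)]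
    simp only [hgdef]; ring
  have neg : ∀ s l a, s ≤ G.strips → l ≤ a → a ≤ G.cells →
      (G.X s l - G.X s a) * (G.Y (r + 1) - G.Y r) ≤ 0 := by
    intro s l a hs hl ha
    exact mul_nonpos_of_nonpos_of_nonneg (sub_nonpos.2 (G.X_le hs hl ha)) hy.le
  have pos : ∀ s l a, s ≤ G.strips → a ≤ l → l ≤ G.cells →
      0 ≤ (G.X s l - G.X s a) * (G.Y (r + 1) - G.Y r) := by
    intro s l a hs hl ha
    exact mul_nonneg (sub_nonneg.2 (G.X_le hs hl ha)) hy.le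
  have zero : ∀ s l a, s ≤ G.strips → a ≤ l → l ≤ G.cells →
      (G.X s l - G.X s a) * (G.Y (r + 1) - G.Y r) = 0 → l = a := by
    intro s l a hs hl ha h0
    by_contra hne
    have := G.X_lt s hs a l (by omega) ha
    exact (mul_pos (sub_pos.2 this) hy).ne' h0
  rcases h with ⟨rfl, hkk, rfl⟩ | ⟨rfl, hkk, rfl⟩ | ⟨rfl, hkk, rfl⟩ | ⟨rfl, hkk, rfl⟩
  -- From left to right the triangles of a strip alternate between lower and upper ones. A lower
  -- triangle is separated from all later ones by the diagonal of its cell.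
  · refine .of_separated_of_subset (hg (k + 1) k) ?_ ?_ ?_
    · rintro i (rfl | rfl | rfl)
      · exact (e1 _ _ k (by omega)).trans_le (neg _ _ _ (by omega) (by omega) (by omega))
      · exact (e1 _ _ (k + 1) (by omega)).trans_le (neg _ _ _ (by omega) (by omega) (by omega))
      · exact (e2 _ _ k (by omega)).trans_le (neg _ _ _ (by omega) (by omega) (by omega))
    · rintro i (rfl | rfl | rfl)
      · exact (pos _ _ _ (by omega) (by omega) (by omega)).trans_eq (e1 _ _ k' (by omega)).symm
      · exact (pos _ _ _ (by omega) (by omega) (by omega)).trans_eq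
          (e1 _ _ (k' + 1) (by omega)).symm
      · exact (pos _ _ _ (by omega) (by omega) (by omega)).trans_eq (e2 _ _ k' (by omega)).symm
    · rintro i (rfl | rfl | rfl) h0
      · have := zero _ _ _ (by omega) (by omega) (by omega) ((e1 _ _ k' (by omega)).symm.trans h0)
        subst this; exact .inr (.inl rfl)
      · have := zero _ _ _ (by omega) (by omega) (by omega)
          ((e1 _ _ (k' + 1) (by omega)).symm.trans h0)
        omega
      · have := zero _ _ _ (by omega) (by omega) (by omega) ((e2 _ _ k' (by omega)).symm.trans h0)
        omega
  · refine .of_separated_of_subset (hg (k + 1) k) ?_ ?_ ?_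
    · rintro i (rfl | rfl | rfl)
      · exact (e1 _ _ k (by omega)).trans_le (neg _ _ _ (by omega) (by omega) (by omega))
      · exact (e1 _ _ (k + 1) (by omega)).trans_le (neg _ _ _ (by omega) (by omega) (by omega))
      · exact (e2 _ _ k (by omega)).trans_le (neg _ _ _ (by omega) (by omega) (by omega))
    · rintro i (rfl | rfl | rfl)
      · exact (pos _ _ _ (by omega) (by omega) (by omega)).trans_eq
          (e1 _ _ (k' + 1) (by omega)).symm
      · exact (pos _ _ _ (by omega) (by omega) (by omega)).trans_eq (e2 _ _ k' (by omega)).symm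
      · exact (pos _ _ _ (by omega) (by omega) (by omega)).trans_eq
          (e2 _ _ (k' + 1) (by omega)).symm
    · rintro i (rfl | rfl | rfl) h0
      · have := zero _ _ _ (by omega) (by omega) (by omega)
          ((e1 _ _ (k' + 1) (by omega)).symm.trans h0)
        obtain rfl : k' = k := by omega
        exact .inr (.inl rfl)
      · have := zero _ _ _ (by omega) (by omega) (by omega) ((e2 _ _ k' (by omega)).symm.trans h0)
        subst this; exact .inr (.inr rfl)
      · have := zero _ _ _ (by omega) (by omega) (by omega)
          ((e2 _ _ (k' + 1) (by omega)).symm.trans h0)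
        omega
  -- An upper triangle is separated from all later ones by the right side of its cell.
  · refine .of_separated_of_subset (hg (k + 1) (k + 1)) ?_ ?_ ?_
    · rintro i (rfl | rfl | rfl)
      · exact (e1 _ _ (k + 1) (by omega)).trans_le (neg _ _ _ (by omega) (by omega) (by omega))
      · exact (e2 _ _ k (by omega)).trans_le (neg _ _ _ (by omega) (by omega) (by omega))
      · exact (e2 _ _ (k + 1) (by omega)).trans_le (neg _ _ _ (by omega) (by omega) (by omega))
    · rintro i (rfl | rfl | rfl)
      · exact (pos _ _ _ (by omega) (by omega) (by omega)).trans_eq (e1 _ _ k' (by omega)).symm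
      · exact (pos _ _ _ (by omega) (by omega) (by omega)).trans_eq
          (e1 _ _ (k' + 1) (by omega)).symm
      · exact (pos _ _ _ (by omega) (by omega) (by omega)).trans_eq (e2 _ _ k' (by omega)).symm
    · rintro i (rfl | rfl | rfl) h0
      · have := zero _ _ _ (by omega) (by omega) (by omega) ((e1 _ _ k' (by omega)).symm.trans h0)
        subst this; exact .inl rfl
      · have := zero _ _ _ (by omega) (by omega) (by omega)
          ((e1 _ _ (k' + 1) (by omega)).symm.trans h0)
        omega
      · have := zero _ _ _ (by omega) (by omega) (by omega) ((e2 _ _ k' (by omega)).symm.trans h0)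
        subst this; exact .inr (.inr rfl)
  · refine .of_separated_of_subset (hg (k + 1) (k + 1)) ?_ ?_ ?_
    · rintro i (rfl | rfl | rfl)
      · exact (e1 _ _ (k + 1) (by omega)).trans_le (neg _ _ _ (by omega) (by omega) (by omega))
      · exact (e2 _ _ k (by omega)).trans_le (neg _ _ _ (by omega) (by omega) (by omega))
      · exact (e2 _ _ (k + 1) (by omega)).trans_le (neg _ _ _ (by omega) (by omega) (by omega))
    · rintro i (rfl | rfl | rfl)
      · exact (pos _ _ _ (by omega) (by omega) (by omega)).trans_eq
          (e1 _ _ (k' + 1) (by omega)).symm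
      · exact (pos _ _ _ (by omega) (by omega) (by omega)).trans_eq (e2 _ _ k' (by omega)).symm
      · exact (pos _ _ _ (by omega) (by omega) (by omega)).trans_eq
          (e2 _ _ (k' + 1) (by omega)).symm
    · rintro i (rfl | rfl | rfl) h0
      · have := zero _ _ _ (by omega) (by omega) (by omega)
          ((e1 _ _ (k' + 1) (by omega)).symm.trans h0)
        omega
      · have := zero _ _ _ (by omega) (by omega) (by omega) ((e2 _ _ k' (by omega)).symm.trans h0)
        subst this; exact .inr (.inr rfl)
      · have := zero _ _ _ (by omega) (by omega) (by omega)
          ((e2 _ _ (k' + 1) (by omega)).symm.trans h0)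
        omega

/-- Sets of points of a row on different sides of one of its points meet face to face. -/
theorem meet_row_separated {r m : ℕ} (hr : r ≤ G.strips) (hm : m ≤ G.cells) {A B : Set ℕ}
    (hA : ∀ i ∈ A, ∃ l ≤ m, i = G.idx l r)
    (hB : ∀ i ∈ B, ∃ l, m ≤ l ∧ l ≤ G.cells ∧ i = G.idx l r) : MeetFaceToFace G.proj A B := by
  have ev : ∀ c l, l ≤ G.cells → (G.proj (G.idx l r)).1 - c = G.X r l - c := by
    intro c l hl; rw [G.proj_idx hl hr]
  refine .of_separated (isAffineFun_fst (G.X r m)) ?_ ?_ ?_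
  · intro i hi
    obtain ⟨l, hl, rfl⟩ := hA i hi
    rw [ev _ _ (by omega)]
    exact sub_nonpos.2 (G.X_le hr hl hm)
  · intro i hi
    obtain ⟨l, hl, hl', rfl⟩ := hB i hi
    rw [ev _ _ hl']
    exact sub_nonneg.2 (G.X_le hr hl hl')
  · have hA0 : ∀ i ∈ {i | i ∈ A ∧ (G.proj i).1 - G.X r m = 0}, i = G.idx m r := by
      rintro i ⟨hi, h0⟩
      obtain ⟨l, hl, rfl⟩ := hA i hi
      rw [ev _ _ (by omega)] at h0
      rcases hl.eq_or_lt with rfl | h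
      · rfl
      · linarith [G.X_lt r hr l m h hm]
    have hB0 : ∀ i ∈ {i | i ∈ B ∧ (G.proj i).1 - G.X r m = 0}, i = G.idx m r := by
      rintro i ⟨hi, h0⟩
      obtain ⟨l, hl, hl', rfl⟩ := hB i hi
      rw [ev _ _ hl'] at h0
      rcases hl.eq_or_lt with rfl | h
      · rfl
      · linarith [G.X_lt r hr m l h hl']
    rintro x ⟨hx, hx'⟩
    obtain ⟨_, i, hi, -⟩ := convexHull_nonempty_iff.1 ⟨x, hx⟩
    refine MeetFaceToFace.of_subset (fun j hj => ?_) ⟨hx, hx'⟩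
    rwa [hB0 j hj, ← hA0 i hi]

/-- Sets of at most two consecutive points of a row meet face to face. -/
theorem meet_same_row {r k k' : ℕ} (hr : r ≤ G.strips) (hk : k < G.cells) (hk' : k' < G.cells)
    {A B : Set ℕ} (hA : ∀ i ∈ A, i = G.idx k r ∨ i = G.idx (k + 1) r)
    (hB : ∀ i ∈ B, i = G.idx k' r ∨ i = G.idx (k' + 1) r) (hkk : k ≤ k') :
    MeetFaceToFace G.proj A B := by
  rcases hkk.eq_or_lt with rfl | hlt
  -- Both sets are contained in one pair of points. If neither contains the other, they are distinct
  -- singletons.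
  · by_cases h1 : B ⊆ A
    · exact .of_subset h1
    by_cases h2 : A ⊆ B
    · exact (MeetFaceToFace.of_subset h2).symm
    obtain ⟨b, hb, hbA⟩ := Set.not_subset.1 h1
    obtain ⟨a, ha, haB⟩ := Set.not_subset.1 h2
    have hA' : ∀ i ∈ A, i = a := by
      intro i hi
      by_contra hne
      have hib : i ≠ b := fun h => hbA (h ▸ hi)
      have hab : a ≠ b := fun h => hbA (h ▸ ha)
      have := hA i hi
      have := hA a ha
      have := hB b hb
      omega
    have hB' : ∀ i ∈ B, i = b := by
      intro i hi
      by_contra hne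
      have hia : i ≠ a := fun h => haB (h ▸ hi)
      have hab : a ≠ b := fun h => hbA (h ▸ ha)
      have := hB i hi
      have := hA a ha
      have := hB b hb
      omega
    have hne : a ≠ b := fun h => hbA (h ▸ ha)
    rcases hA a ha with rfl | rfl <;> rcases hB b hb with rfl | rfl
    · exact absurd rfl hne
    · exact G.meet_row_separated hr hk.le (fun i hi => ⟨k, le_rfl, hA' i hi⟩)
        fun i hi => ⟨k + 1, by omega, by omega, hB' i hi⟩
    · exact (G.meet_row_separated hr hk.le (fun i hi => ⟨k, le_rfl, hB' i hi⟩)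
        fun i hi => ⟨k + 1, by omega, by omega, hA' i hi⟩).symm
    · exact absurd rfl hne
  · refine G.meet_row_separated hr hk'.le (fun i hi => ?_) fun i hi => ?_
    · rcases hA i hi with rfl | rfl
      · exact ⟨k, by omega, rfl⟩
      · exact ⟨k + 1, by omega, rfl⟩
    · rcases hB i hi with rfl | rfl
      · exact ⟨k', le_rfl, by omega, rfl⟩
      · exact ⟨k' + 1, by omega, by omega, rfl⟩

/-- Triangles of different strips meet face to face. -/
theorem meet_lt_strip {k k' r r' : ℕ} (hk : k < G.cells) (hk' : k' < G.cells) (hr' : r' < G.strips)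
    (hrr : r < r') {A B : Set ℕ}
    (hA : ∀ i ∈ A, ∃ l s, i = G.idx l s ∧ (l = k ∨ l = k + 1) ∧ (s = r ∨ s = r + 1))
    (hB : ∀ i ∈ B, ∃ l s, i = G.idx l s ∧ (l = k' ∨ l = k' + 1) ∧ (s = r' ∨ s = r' + 1)) :
    MeetFaceToFace G.proj A B := by
  have ev : ∀ c l s, l ≤ G.cells → s ≤ G.strips →
      (G.proj (G.idx l s)).2 - c = G.Y s - c := by
    intro c l s hl hs; rw [G.proj_idx hl hs]
  -- The lower boundary of the upper strip separates the two triangles, and only their vertices in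
  -- row `r'` can lie on it.
  refine .of_separated (isAffineFun_snd (G.Y r')) ?_ ?_ ?_
  · intro i hi
    obtain ⟨l, s, rfl, hl, hs⟩ := hA i hi
    rw [ev _ _ _ (by omega) (by omega)]
    exact sub_nonpos.2 (G.Y_le (by omega) (by omega))
  · intro i hi
    obtain ⟨l, s, rfl, hl, hs⟩ := hB i hi
    rw [ev _ _ _ (by omega) (by omega)]
    exact sub_nonneg.2 (G.Y_le (by omega) (by omega))
  · have hA0 : ∀ i ∈ {i | i ∈ A ∧ (G.proj i).2 - G.Y r' = 0},
        i = G.idx k r' ∨ i = G.idx (k + 1) r' := by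
      rintro i ⟨hi, h0⟩
      obtain ⟨l, s, rfl, hl, hs⟩ := hA i hi
      rw [ev _ _ _ (by omega) (by omega)] at h0
      obtain rfl : s = r' := by
        by_contra hne
        linarith [G.Y_lt s r' (by omega) (by omega)]
      rcases hl with rfl | rfl
      · exact .inl rfl
      · exact .inr rfl
    have hB0 : ∀ i ∈ {i | i ∈ B ∧ (G.proj i).2 - G.Y r' = 0},
        i = G.idx k' r' ∨ i = G.idx (k' + 1) r' := by
      rintro i ⟨hi, h0⟩
      obtain ⟨l, s, rfl, hl, hs⟩ := hB i hi
      rw [ev _ _ _ (by omega) (by omega)] at h0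
      obtain rfl : s = r' := by
        by_contra hne
        linarith [G.Y_lt r' s (by omega) (by omega)]
      rcases hl with rfl | rfl
      · exact .inl rfl
      · exact .inr rfl
    rcases le_total k k' with h | h
    · exact G.meet_same_row hr'.le hk hk' hA0 hB0 h
    · exact (G.meet_same_row hr'.le hk' hk hB0 hA0 h).symm

theorem meet_tris {t t' : ℕ × ℕ × ℕ} (ht : t ∈ G.tris) (ht' : t' ∈ G.tris) :
    MeetFaceToFace G.proj (triIdx t) (triIdx t') := by
  obtain ⟨k, hk, r, hr, h⟩ := G.mem_tris.1 ht
  obtain ⟨k', hk', r', hr', h'⟩ := G.mem_tris.1 ht'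
  rcases lt_trichotomy r r' with hlt | rfl | hlt
  · exact G.meet_lt_strip hk hk' hr' hlt (G.exists_idx_eq h) (G.exists_idx_eq h')
  · have refl : t = t' → MeetFaceToFace G.proj (triIdx t) (triIdx t') := by
      rintro rfl; exact .of_subset subset_rfl
    rcases lt_trichotomy k k' with hlt | rfl | hlt
    · refine G.meet_same_strip hk hk' hr ?_
      rcases h with h | h <;> rcases h' with h' | h' <;> simp [h, h', hlt, hlt.le]
    · rcases h with h | h <;> rcases h' with h' | h'
      · exact refl (h.trans h'.symm)
      · exact G.meet_same_strip hk hk' hr (.inr (.inl ⟨h, le_rfl, h'⟩))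
      · exact (G.meet_same_strip hk' hk hr (.inr (.inl ⟨h', le_rfl, h⟩))).symm
      · exact refl (h.trans h'.symm)
    · refine (G.meet_same_strip hk' hk hr ?_).symm
      rcases h with h | h <;> rcases h' with h' | h' <;> simp [h, h', hlt, hlt.le]
  · exact (G.meet_lt_strip hk' hk hr hlt (G.exists_idx_eq h') (G.exists_idx_eq h)).symm

end Grid

/-! ### Covering by the grid, and the free space at height zero -/

namespace Grid

variable (G : Grid)

/-- The two triangles of a cell cover it. -/
theorem cover_cell {k r : ℕ} (hk : k < G.cells) (hr : r < G.strips) {x y t : ℝ} (ht : 0 ≤ t)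
    (ht' : t ≤ 1) (hy : y = (1 - t) * G.Y r + t * G.Y (r + 1))
    (hx : (1 - t) * G.X r k + t * G.X (r + 1) k ≤ x)
    (hx' : x ≤ (1 - t) * G.X r (k + 1) + t * G.X (r + 1) (k + 1)) :
    (x, y) ∈ convexHull ℝ (G.proj '' triIdx (lower (G.strips + 1) k r)) ∨
      (x, y) ∈ convexHull ℝ (G.proj '' triIdx (upper (G.strips + 1) k r)) := by
  have p0 := G.proj_idx (k := k) (r := r) (by omega) (by omega)
  have p1 := G.proj_idx (k := k + 1) (r := r) (by omega) (by omega)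
  have q0 := G.proj_idx (k := k) (r := r + 1) (by omega) (by omega)
  have q1 := G.proj_idx (k := k + 1) (r := r + 1) (by omega) (by omega)
  -- The bound is the abscissa of the diagonal at this height: the lower triangle is to its left,
  -- the upper one to its right.
  rcases le_or_gt x ((1 - t) * G.X r (k + 1) + t * G.X (r + 1) k) with h | h
  · left
    obtain ⟨a, b, ha, hb, hab, he⟩ : x ∈ segment ℝ ((1 - t) * G.X r k + t * G.X (r + 1) k)
        ((1 - t) * G.X r (k + 1) + t * G.X (r + 1) k) := by
      rw [segment_eq_Icc (hx.trans h)]; exact ⟨hx, h⟩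
    refine mem_convexHull_three (p := (G.X r k, G.Y r)) (q := (G.X r (k + 1), G.Y r))
      (r := (G.X (r + 1) k, G.Y (r + 1))) (a := a * (1 - t)) (b := b * (1 - t)) (c := t)
      ⟨_, .inl rfl, p0⟩ ⟨_, .inr (.inl rfl), p1⟩ ⟨_, .inr (.inr rfl), q0⟩
      (mul_nonneg ha (by linarith)) (mul_nonneg hb (by linarith)) ht
      (by linear_combination (1 - t) * hab) ?_
    simp only [smul_eq_mul] at he
    refine Prod.ext ?_ ?_
    · simp only [Prod.fst_add, Prod.smul_fst, smul_eq_mul]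
      linear_combination -he + t * G.X (r + 1) k * hab
    · simp only [Prod.snd_add, Prod.smul_snd, smul_eq_mul]
      linear_combination hy - (1 - t) * G.Y r * hab
  · right
    obtain ⟨a, b, ha, hb, hab, he⟩ : x ∈ segment ℝ ((1 - t) * G.X r (k + 1) + t * G.X (r + 1) k)
        ((1 - t) * G.X r (k + 1) + t * G.X (r + 1) (k + 1)) := by
      rw [segment_eq_Icc (h.le.trans hx')]; exact ⟨h.le, hx'⟩
    refine mem_convexHull_three (p := (G.X r (k + 1), G.Y r)) (q := (G.X (r + 1) k, G.Y (r + 1)))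
      (r := (G.X (r + 1) (k + 1), G.Y (r + 1))) (a := 1 - t) (b := a * t) (c := b * t)
      ⟨_, .inl rfl, p1⟩ ⟨_, .inr (.inl rfl), q0⟩ ⟨_, .inr (.inr rfl), q1⟩
      (by linarith) (mul_nonneg ha ht) (mul_nonneg hb ht)
      (by linear_combination t * hab) ?_
    simp only [smul_eq_mul] at he
    refine Prod.ext ?_ ?_
    · simp only [Prod.fst_add, Prod.smul_fst, smul_eq_mul]
      linear_combination -he + (1 - t) * G.X r (k + 1) * hab
    · simp only [Prod.snd_add, Prod.smul_snd, smul_eq_mul]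
      linear_combination hy - t * G.Y (r + 1) * hab

/-- The triangles of a strip cover it. -/
theorem cover_strip {r : ℕ} (hr : r < G.strips) {x y : ℝ} (hy : G.Y r ≤ y) (hy' : y ≤ G.Y (r + 1))
    (hx : G.left ≤ x) (hx' : x ≤ G.right) : ∃ k < G.cells, ∃ t,
      (t = lower (G.strips + 1) k r ∨ t = upper (G.strips + 1) k r) ∧
        (x, y) ∈ convexHull ℝ (G.proj '' triIdx t) := by
  obtain ⟨a, t, ha, ht, hat, he⟩ : y ∈ segment ℝ (G.Y r) (G.Y (r + 1)) := by
    rw [segment_eq_Icc (hy.trans hy')]; exact ⟨hy, hy'⟩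
  obtain rfl : a = 1 - t := by linarith
  obtain ⟨k, hk, h1, h2⟩ := exists_between_steps
    (w := fun k => (1 - t) * G.X r k + t * G.X (r + 1) k) G.cells_pos (x := x)
    (by rw [G.X_left r (by omega), G.X_left (r + 1) (by omega)]; linarith)
    (by rw [G.X_right r (by omega), G.X_right (r + 1) (by omega)]; linarith)
  rcases G.cover_cell hk hr ht (by linarith) he.symm h1 h2 with h | h
  · exact ⟨k, hk, _, .inl rfl, h⟩
  · exact ⟨k, hk, _, .inr rfl, h⟩

theorem iUnion_tris : (⋃ t ∈ G.tris, convexHull ℝ (G.proj '' triIdx t)) =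
    Set.Icc G.left G.right ×ˢ Set.Icc (G.Y 0) (G.Y G.strips) := by
  refine Set.Subset.antisymm (Set.iUnion₂_subset fun t ht => ?_) ?_
  · refine convexHull_min ?_ ((convex_Icc _ _).prod (convex_Icc _ _))
    obtain ⟨k, hk, r, hr, h⟩ := G.mem_tris.1 ht
    rintro _ ⟨i, hi, rfl⟩
    obtain ⟨l, s, rfl, hl, hs⟩ := G.exists_idx_eq h i hi
    rw [G.proj_idx (by omega) (by omega)]
    refine ⟨⟨?_, ?_⟩, G.Y_le (by omega) (by omega), G.Y_le (by omega) (by omega)⟩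
    · rw [← G.X_left s (by omega)]; exact G.X_le (by omega) (by omega) (by omega)
    · rw [← G.X_right s (by omega)]; exact G.X_le (by omega) (by omega) (by omega)
  · rintro ⟨x, y⟩ ⟨hx, hy⟩
    obtain ⟨r, hr, h1, h2⟩ := exists_between_steps G.strips_pos hy.1 hy.2
    obtain ⟨k, hk, t, ht, h⟩ := G.cover_strip hr h1 h2 hx.1 hx.2
    exact Set.mem_iUnion₂.2 ⟨t, G.mem_tris.2 ⟨k, hk, r, hr, ht⟩, h⟩

/-- The terrain of a grid. -/
def terrain : Terrain where
  verts := G.verts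
  tris := G.tris
  tris_ne_nil := List.ne_nil_of_mem (G.mem_tris.2 ⟨0, G.cells_pos, 0, G.strips_pos, .inl rfl⟩)
  idx_lt := by
    intro t ht i hi
    obtain ⟨k, hk, r, hr, h⟩ := G.mem_tris.1 ht
    obtain ⟨l, s, rfl, hl, hs⟩ := G.exists_idx_eq h i hi
    rw [G.length_verts, idx]
    have : (l + 1) * (G.strips + 1) ≤ (G.cells + 1) * (G.strips + 1) :=
      Nat.mul_le_mul_right _ (by omega)
    rw [Nat.add_mul] at this
    omega
  idx_used := by
    intro i hi
    rw [G.length_verts] at hi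
    have hp := G.strips_pos
    have hc := G.cells_pos
    have hr : i % (G.strips + 1) < G.strips + 1 := Nat.mod_lt _ (by omega)
    have hk : i / (G.strips + 1) < G.cells + 1 := Nat.div_lt_of_lt_mul (by rwa [mul_comm])
    have he : i = G.idx (i / (G.strips + 1)) (i % (G.strips + 1)) := by
      rw [idx, mul_comm]; exact (Nat.div_add_mod _ _).symm
    generalize i / (G.strips + 1) = k at hk he
    generalize i % (G.strips + 1) = r at hr he
    subst he
    -- A vertex in the last column or in the last row belongs to no cell as its lower left corner;
    -- the preceding cell provides a triangle.
    rcases Nat.lt_or_ge k G.cells with hk' | hk' <;> rcases Nat.lt_or_ge r G.strips with hr' | hr'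
    · exact ⟨_, G.mem_tris.2 ⟨k, hk', r, hr', .inl rfl⟩, .inl rfl⟩
    · refine ⟨_, G.mem_tris.2 ⟨k, hk', r - 1, by omega, .inl rfl⟩, .inr (.inr ?_)⟩
      change G.idx k r = G.idx k (r - 1 + 1)
      rw [show r - 1 + 1 = r by omega]
    · refine ⟨_, G.mem_tris.2 ⟨k - 1, by omega, r, hr', .inl rfl⟩, .inr (.inl ?_)⟩
      change G.idx k r = G.idx (k - 1 + 1) r
      rw [show k - 1 + 1 = k by omega]
    · refine ⟨_, G.mem_tris.2 ⟨k - 1, by omega, r - 1, by omega, .inr rfl⟩, .inr (.inr ?_)⟩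
      change G.idx k r = G.idx (k - 1 + 1) (r - 1 + 1)
      rw [show r - 1 + 1 = r by omega, show k - 1 + 1 = k by omega]
  nondegenerate := by
    intro t ht
    obtain ⟨k, hk, r, hr, rfl | rfl⟩ := G.mem_tris.1 ht
    · exact (G.nondegenerate_aux hk hr).1
    · exact (G.nondegenerate_aux hk hr).2
  face_to_face := fun _ ht _ ht' => G.meet_tris ht ht'
  convex_region := by
    change Convex ℝ (⋃ t ∈ G.tris, convexHull ℝ (G.proj '' triIdx t))
    rw [G.iUnion_tris]
    exact (convex_Icc _ _).prod (convex_Icc _ _)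

/-- A vertex of the surface. -/
def vert (i : ℕ) : (ℝ × ℝ) × ℝ := G.verts.getD i 0

theorem vert_idx {k r : ℕ} (hk : k ≤ G.cells) (hr : r ≤ G.strips) :
    G.vert (G.idx k r) = G.point k r := G.getD_verts hk hr

theorem mem_surface {x : (ℝ × ℝ) × ℝ} : x ∈ G.terrain.surface ↔
    ∃ t ∈ G.tris, x ∈ convexHull ℝ (G.vert '' triIdx t) := by
  simp only [Terrain.surface, Set.mem_iUnion, exists_prop]; rfl

/-- Above a triangle with vertices of height zero the free space begins at height zero. -/
theorem mem_carrier_of_zero {k r : ℕ} (hk : k < G.cells) (hr : r < G.strips) {t : ℕ × ℕ × ℕ}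
    (ht : t = lower (G.strips + 1) k r ∨ t = upper (G.strips + 1) k r)
    (hz : ∀ i ∈ triIdx t, (G.vert i).2 = 0) {p : ℝ × ℝ}
    (hp : p ∈ convexHull ℝ (G.proj '' triIdx t)) : (p, (0 : ℝ)) ∈ G.terrain.carrier := by
  refine ⟨(p, 0), G.mem_surface.2 ⟨t, G.mem_tris.2 ⟨k, hk, r, hr, ht⟩, ?_⟩, rfl, le_rfl⟩
  -- The embedding of the plane at height zero is linear, so it commutes with convex hulls.
  have h1 : LinearMap.inl ℝ (ℝ × ℝ) ℝ p ∈
      LinearMap.inl ℝ (ℝ × ℝ) ℝ '' convexHull ℝ (G.proj '' triIdx t) := ⟨p, hp, rfl⟩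
  rw [LinearMap.image_convexHull, Set.image_image] at h1
  have h2 : (fun i => LinearMap.inl ℝ (ℝ × ℝ) ℝ (G.proj i)) '' triIdx t = G.vert '' triIdx t := by
    refine Set.image_congr fun i hi => ?_
    exact Prod.ext rfl (hz i hi).symm
  rw [h2] at h1
  exact h1

/-- In a row without two consecutive vertices of height zero, only these vertices are free at height
zero. -/
theorem exists_vertex_of_mem_carrier {r : ℕ} (hr : r ≤ G.strips)
    (hZ : ∀ k < G.cells, ¬ (G.Z r k = 0 ∧ G.Z r (k + 1) = 0)) {x : ℝ}
    (hx : ((x, G.Y r), (0 : ℝ)) ∈ G.terrain.carrier) :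
    ∃ k ≤ G.cells, G.Z r k = 0 ∧ x = G.X r k := by
  obtain ⟨w, hw, hw1, hw2⟩ := hx
  obtain ⟨t, ht, hw⟩ := G.mem_surface.1 hw
  obtain ⟨k, hk, r', hr', h⟩ := G.mem_tris.1 ht
  have hbox := G.exists_idx_eq h
  have az : IsAffineFun fun p : (ℝ × ℝ) × ℝ => p.2 := fun p q a b _ => by simp
  have ay : ∀ ε : ℝ, IsAffineFun fun p : (ℝ × ℝ) × ℝ => ε * (p.1.2 - G.Y r) := fun ε p q a b hab => by
    simp only [Prod.fst_add, Prod.smul_fst, Prod.snd_add, Prod.smul_snd, smul_eq_mul]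
    linear_combination ε * G.Y r * hab
  -- The surface point below has height at most 0 although all heights are nonnegative, so it lies
  -- in the hull of the zero-height vertices of its triangle. A second use of `mem_face` restricts
  -- these to the vertices in row `r`.
  have h1 := mem_face az (fun i hi => by
    obtain ⟨l, s, rfl, hl, hs⟩ := hbox i hi
    rw [G.vert_idx (by omega) (by omega)]
    exact G.Z_nonneg _ _) hw hw2
  -- all vertices of the triangle are on one side of the row
  obtain ⟨ε, hε, hside⟩ : ∃ ε : ℝ, ε ≠ 0 ∧ ∀ s, s = r' ∨ s = r' + 1 → 0 ≤ ε * (G.Y s - G.Y r) := by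
    rcases Nat.lt_or_ge r' r with hlt | hge
    · refine ⟨-1, by norm_num, fun s hs => ?_⟩
      have := G.Y_le (r := s) (r' := r) (by omega) hr
      linarith
    · refine ⟨1, by norm_num, fun s hs => ?_⟩
      have := G.Y_le (r := r) (r' := s) (by omega) (by omega)
      linarith
  have hwy : w.1.2 = G.Y r := by rw [hw1]
  have h2 := mem_face (ay ε) (fun i hi => by
    obtain ⟨l, s, rfl, hl, hs⟩ := hbox i hi.1
    rw [G.vert_idx (by omega) (by omega)]
    exact hside s hs) h1 (by simp only [hwy, sub_self, mul_zero]; exact le_rfl)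
  have hB : ∀ i ∈ {i | i ∈ {i | i ∈ triIdx t ∧ (G.vert i).2 = 0} ∧
      ε * ((G.vert i).1.2 - G.Y r) = 0}, ∃ l, i = G.idx l r ∧ (l = k ∨ l = k + 1) ∧ G.Z r l = 0 := by
    rintro i ⟨⟨hi, h0⟩, hy⟩
    obtain ⟨l, s, rfl, hl, hs⟩ := hbox i hi
    rw [G.vert_idx (by omega) (by omega)] at h0 hy
    have hy' : G.Y s - G.Y r = 0 := (mul_eq_zero.1 hy).resolve_left hε
    obtain rfl : s = r := by
      rcases lt_trichotomy s r with hlt | h | hlt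
      · linarith [G.Y_lt s r hlt hr]
      · exact h
      · linarith [G.Y_lt r s hlt (by omega)]
    exact ⟨l, rfl, hl, h0⟩
  obtain ⟨_, i, hi, -⟩ := convexHull_nonempty_iff.1 ⟨w, h2⟩
  obtain ⟨l, rfl, hl, hl0⟩ := hB i hi
  -- The remaining vertices are among two consecutive ones of the row, and `hZ` excludes that both
  -- have height zero.
  have hsub : G.vert '' {i | i ∈ {i | i ∈ triIdx t ∧ (G.vert i).2 = 0} ∧
      ε * ((G.vert i).1.2 - G.Y r) = 0} ⊆ {G.point l r} := by
    rintro _ ⟨j, hj, rfl⟩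
    obtain ⟨l', rfl, hl', hl0'⟩ := hB j hj
    obtain rfl : l' = l := by
      have := hZ k hk
      rcases hl with rfl | rfl <;> rcases hl' with rfl | rfl
      · rfl
      · exact absurd ⟨hl0, hl0'⟩ this
      · exact absurd ⟨hl0', hl0⟩ this
      · rfl
    exact G.vert_idx (by omega) hr
  have h3 := convexHull_min hsub (convex_singleton _) h2
  refine ⟨l, by omega, hl0, ?_⟩
  rw [Set.mem_singleton_iff] at h3
  rw [h3] at hw1
  exact (congrArg Prod.fst hw1).symm

end Grid

/-! ### The terrain of a sorted list -/

/-- The offset of a row from the middle line of the nearest wall. -/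
def rowShift (r : ℕ) : ℤ := if r % 3 = 1 then -1 else if r % 3 = 2 then 0 else 1

/-- The center of gap `i`, for the rows next to one wall. -/
def rowCenter (l : List ℤ) (r i : ℕ) : ℤ :=
  if (r + 2) / 3 = 1 ∨ (r + 2) / 3 = 3 then 16 * up l i
  -- In the first and in the last row the inner vertices are pushed to the right, so that the
  -- leftmost edge of the row is long enough for all sight lines.
  else if (r + 2) / 3 = 2 then -8 * down l i else 100 * bigM l + 16 * up l i

/-- The abscissa of vertex `k` of a row. -/
def gridX (l : List ℤ) (r k : ℕ) : ℤ :=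
  if k = 0 then -200 * bigM l
  else if k = 3 * l.length + 1 then 200 * bigM l
  -- Each gap has vertices at its center and at distance 2 on both sides, shifted by `rowShift` in
  -- the rows next to the middle line. Since all diagonals have the same direction, this shear makes
  -- the zero-height triangles below and above the center symmetric, with base from center - 1 to
  -- center + 1.
  else rowCenter l r ((k - 1) / 3) + (2 * ((k - 1) % 3 : ℕ) - 2 + rowShift r)

/-- The ordinate of a row. -/
def gridY (l : List ℤ) (r : ℕ) : ℤ := rowShift r + 32 * ((r + 2) / 3 : ℕ) * bigM l

/-- The heights: the walls are above the middle lines, except at the gap centers. -/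
def gridZ (r k : ℕ) : ℤ := if r % 3 = 2 ∧ k % 3 ≠ 2 then 1 else 0

theorem strictMono_of_steps {f : ℕ → ℤ} {m : ℕ} (h : ∀ i < m, f i < f (i + 1)) {i j : ℕ}
    (hij : i < j) (hj : j ≤ m) : f i < f j := by
  induction j, hij using Nat.le_induction with
  | base => exact h i (by omega)
  | succ j hij ih => exact (ih (by omega)).trans (h j (by omega))

/-! ### The terrain of walls: validity, visibility and encoding -/

section TerrainOfList

variable {l : List ℤ}

theorem rowShift_bounds (r : ℕ) : -1 ≤ rowShift r ∧ rowShift r ≤ 1 := by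
  unfold rowShift; split_ifs <;> omega

theorem rowCenter_step (hl : l.Pairwise (· < ·)) (r : ℕ) {i : ℕ} (hi : i + 1 < l.length) :
    rowCenter l r i + 8 ≤ rowCenter l r (i + 1) := by
  have h1 := up_lt hl (Nat.lt_add_one i) hi
  have h2 := down_lt hl (Nat.lt_add_one i) hi
  unfold rowCenter
  split_ifs <;> omega

theorem rowCenter_bounds (hl : l.Pairwise (· < ·)) (r : ℕ) {i : ℕ} (hi : i < l.length) :
    -16 * bigM l < rowCenter l r i ∧ rowCenter l r i < 116 * bigM l := by
  have hM := one_le_bigM l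
  have h1 := abs_lt.1 (abs_lt_bigM hl (up_mem hi))
  have h2 := abs_lt.1 (abs_lt_bigM hl (down_mem hi))
  unfold rowCenter
  split_ifs <;> omega

theorem gridX_inner (l : List ℤ) (r : ℕ) {i j : ℕ} (hi : i < l.length) (hj : j < 3) :
    gridX l r (3 * i + 1 + j) = rowCenter l r i + (2 * j - 2 + rowShift r) := by
  rw [gridX, if_neg (by omega), if_neg (by omega)]
  rw [show (3 * i + 1 + j - 1) / 3 = i by omega, show (3 * i + 1 + j - 1) % 3 = j by omega]

/-- Neighbors around one gap have distance 2; between successive gaps the spacing 8 of the centers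
leaves at least 4; the ends at `±200 M` are beyond all inner vertices. -/
theorem gridX_step (hl : l.Pairwise (· < ·)) (r : ℕ) :
    ∀ k < 3 * l.length + 1, gridX l r k < gridX l r (k + 1) := by
  intro k hk
  have hM := one_le_bigM l
  have hs := rowShift_bounds r
  have inner : ∀ k, 0 < k → k < 3 * l.length + 1 → ∃ i j, k = 3 * i + 1 + j ∧ i < l.length ∧
      j < 3 := fun k h1 h2 => ⟨(k - 1) / 3, (k - 1) % 3, by omega, by omega, by omega⟩
  rcases Nat.eq_zero_or_pos k with rfl | hk0
  · rw [gridX, if_pos rfl]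
    rcases Nat.eq_zero_or_pos l.length with h0 | h0
    · rw [gridX, if_neg (by omega), if_pos (by omega)]; omega
    · have := gridX_inner l r h0 (show 0 < 3 by norm_num)
      rw [Nat.mul_zero, Nat.zero_add, Nat.add_zero] at this
      rw [Nat.zero_add, this]
      have := rowCenter_bounds hl r h0
      push_cast; omega
  · obtain ⟨i, j, rfl, hi, hj⟩ := inner k hk0 hk
    rw [gridX_inner l r hi hj]
    rcases Nat.lt_or_ge j 2 with hj2 | hj2
    · rw [Nat.add_assoc _ j 1, gridX_inner l r hi (by omega)]
      push_cast; omega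
    · obtain rfl : j = 2 := by omega
      rcases Nat.lt_or_ge (i + 1) l.length with hi' | hi'
      · rw [show 3 * i + 1 + 2 + 1 = 3 * (i + 1) + 1 + 0 by ring,
          gridX_inner l r hi' (by norm_num)]
        have := rowCenter_step hl r hi'
        push_cast; omega
      · have hlast : gridX l r (3 * i + 1 + 2 + 1) = 200 * bigM l := by
          rw [gridX, if_neg (by omega), if_pos (by omega)]
        rw [hlast]
        have := rowCenter_bounds hl r hi
        push_cast; omega

theorem gridY_step (l : List ℤ) : ∀ r < 10, gridY l r < gridY l (r + 1) := by
  intro r hr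
  have hM := one_le_bigM l
  interval_cases r <;> simp [gridY, rowShift] <;> omega

/-- The grid of a sorted list. -/
def wallGrid (l : List ℤ) (hl : l.Pairwise (· < ·)) : Grid where
  strips := 10
  cells := 3 * l.length + 1
  X r k := gridX l r k
  Y r := gridY l r
  Z r k := gridZ r k
  left := -200 * bigM l
  right := 200 * bigM l
  strips_pos := by norm_num
  cells_pos := by omega
  Y_lt r r' h h' := by exact_mod_cast strictMono_of_steps (gridY_step l) h h'
  X_lt r _ k k' h h' := by exact_mod_cast strictMono_of_steps (gridX_step hl r) h h'
  X_left r _ := by rw [gridX, if_pos rfl]; push_cast; rfl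
  X_right r _ := by rw [gridX, if_neg (by omega), if_pos rfl]; push_cast; rfl
  Z_nonneg r k := by
    have : 0 ≤ gridZ r k := by unfold gridZ; split_ifs <;> omega
    exact_mod_cast this

/-- The terrain instance of a sorted list: the edges lie on the first and on the last row. -/
def terrainInstance (l : List ℤ) (hl : l.Pairwise (· < ·)) : TerrainInstance where
  ter := (wallGrid l hl).terrain
  -- A column has 11 vertices, so 0 and 11 are the first two vertices of row 0, and 10 and 21 those
  -- of row 10.
  e := (0, 11)
  e' := (10, 21)
  isEdge := ⟨by norm_num, _, (wallGrid l hl).mem_tris.2 ⟨0, by simp [wallGrid], 0, by simp [wallGrid],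
    .inl rfl⟩, .inl rfl, .inr (.inl rfl)⟩
  isEdge' := ⟨by norm_num, _, (wallGrid l hl).mem_tris.2 ⟨0, by simp [wallGrid], 9, by simp [wallGrid],
    .inr rfl⟩, .inr (.inl rfl), .inr (.inr rfl)⟩
  ne := by simp

theorem wallGrid_X (hl : l.Pairwise (· < ·)) (r : ℕ) {i j : ℕ} (hi : i < l.length) (hj : j < 3) :
    (wallGrid l hl).X r (3 * i + 1 + j) = rowCenter l r i + (2 * j - 2 + rowShift r) := by
  change ((gridX l r (3 * i + 1 + j) : ℤ) : ℝ) = _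
  rw [gridX_inner l r hi hj]; push_cast; rfl

theorem wallGrid_Y (hl : l.Pairwise (· < ·)) (r : ℕ) :
    (wallGrid l hl).Y r = rowShift r + 32 * ((r + 2) / 3 : ℕ) * bigM l := by
  change ((gridY l r : ℤ) : ℝ) = _
  rw [gridY]; push_cast; rfl

theorem wallGrid_Z_eq_zero (hl : l.Pairwise (· < ·)) {r k : ℕ} :
    (wallGrid l hl).Z r k = 0 ↔ r % 3 = 2 → k % 3 = 2 := by
  change ((gridZ r k : ℤ) : ℝ) = 0 ↔ _
  rw [Int.cast_eq_zero, gridZ]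
  split_ifs with h
  · simp [h.1, h.2]
  · simp only [true_iff]; tauto

theorem vert_wallGrid (hl : l.Pairwise (· < ·)) {r k : ℕ} (hk : k ≤ 3 * l.length + 1)
    (hr : r ≤ 10) : (wallGrid l hl).vert ((wallGrid l hl).idx k r) =
      (((wallGrid l hl).X r k, (wallGrid l hl).Y r), (wallGrid l hl).Z r k) :=
  (wallGrid l hl).vert_idx hk hr

/-- Between the walls the terrain is flat. -/
theorem mem_carrier_flat (hl : l.Pairwise (· < ·)) {r : ℕ} (hr : r < 10) (hr3 : r % 3 = 0) {x y : ℝ}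
    (hx : |x| ≤ 200 * bigM l) (hy : (wallGrid l hl).Y r ≤ y) (hy' : y ≤ (wallGrid l hl).Y (r + 1)) :
    ((x, y), (0 : ℝ)) ∈ (wallGrid l hl).terrain.carrier := by
  have hx := abs_le.1 hx
  obtain ⟨k, hk, t, ht, h⟩ := (wallGrid l hl).cover_strip hr hy hy' (x := x)
    (by change -200 * (bigM l : ℝ) ≤ x; linarith) hx.2
  refine (wallGrid l hl).mem_carrier_of_zero hk hr ht (fun i hi => ?_) h
  have hk : k < 3 * l.length + 1 := hk
  obtain ⟨m, s, rfl, hm, hs⟩ := (wallGrid l hl).exists_idx_eq ht i hi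
  rw [vert_wallGrid hl (by omega) (by omega)]
  exact (wallGrid_Z_eq_zero hl).2 fun h => by omega

/-- The free cone below a gap center. -/
theorem mem_carrier_below (hl : l.Pairwise (· < ·)) {r i : ℕ} (hr : r < 10) (hr3 : r % 3 = 1)
    (hi : i < l.length) {x y : ℝ} (hy : (wallGrid l hl).Y r ≤ y)
    (hx : |x - rowCenter l r i| ≤ (wallGrid l hl).Y (r + 1) - y) :
    ((x, y), (0 : ℝ)) ∈ (wallGrid l hl).terrain.carrier := by
  have hx := abs_le.1 hx
  have e1 := wallGrid_Y hl r
  have e2 := wallGrid_Y hl (r + 1)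
  have s1 : rowShift r = -1 := by rw [rowShift, if_pos hr3]
  have s2 : rowShift (r + 1) = 0 := by rw [rowShift, if_neg (by omega), if_pos (by omega)]
  have hc : rowCenter l (r + 1) i = rowCenter l r i := by
    rw [rowCenter, rowCenter, show (r + 1 + 2) / 3 = (r + 2) / 3 by omega]
  rw [show (r + 1 + 2) / 3 = (r + 2) / 3 by omega, s2] at e2
  rw [s1] at e1
  push_cast at e1 e2
  -- The lower triangle of this cell has its apex at the gap center and its base of length 2 in the
  -- row below; all three heights are zero. The barycentric coordinates below are those of a point
  -- at vertical distance `τ` from the apex.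
  refine (wallGrid l hl).mem_carrier_of_zero (k := 3 * i + 1 + 1) (r := r)
    (by change _ < 3 * l.length + 1; omega) hr (.inl rfl) ?_ ?_
  · rintro j (rfl | rfl | rfl)
    · exact congrArg Prod.snd (vert_wallGrid hl (by omega) (by omega)) |>.trans
        ((wallGrid_Z_eq_zero hl).2 fun h => by omega)
    · exact congrArg Prod.snd (vert_wallGrid hl (by omega) (by omega)) |>.trans
        ((wallGrid_Z_eq_zero hl).2 fun h => by omega)
    · exact congrArg Prod.snd (vert_wallGrid hl (by omega) (by omega)) |>.trans
        ((wallGrid_Z_eq_zero hl).2 fun h => by omega)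
  · have p0 := (wallGrid l hl).proj_idx (k := 3 * i + 1 + 1) (r := r)
      (by change _ ≤ 3 * l.length + 1; omega) hr.le
    have p1 := (wallGrid l hl).proj_idx (k := 3 * i + 1 + 2) (r := r)
      (by change _ ≤ 3 * l.length + 1; omega) hr.le
    have p2 := (wallGrid l hl).proj_idx (k := 3 * i + 1 + 1) (r := r + 1)
      (by change _ ≤ 3 * l.length + 1; omega) hr
    rw [wallGrid_X hl _ hi (by norm_num), s1] at p0 p1
    rw [wallGrid_X hl _ hi (by norm_num), s2, hc] at p2
    push_cast at p0 p1 p2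
    set τ := (wallGrid l hl).Y (r + 1) - y with hτ
    refine mem_convexHull_three ⟨_, .inl rfl, p0⟩ ⟨_, .inr (.inl rfl), p1⟩
      ⟨_, .inr (.inr rfl), p2⟩ (a := (τ - (x - rowCenter l r i)) / 2)
      (b := (τ + (x - rowCenter l r i)) / 2) (c := 1 - τ) (by linarith) (by linarith) (by linarith)
      (by ring) (Prod.ext ?_ ?_)
    · simp only [Prod.fst_add, Prod.smul_fst, smul_eq_mul]; ring
    · simp only [Prod.snd_add, Prod.smul_snd, smul_eq_mul]
      rw [hτ, e1, e2]; ring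

/-- The free cone above a gap center. -/
theorem mem_carrier_above (hl : l.Pairwise (· < ·)) {r i : ℕ} (hr : r < 10) (hr3 : r % 3 = 2)
    (hi : i < l.length) {x y : ℝ} (hy : y ≤ (wallGrid l hl).Y (r + 1))
    (hx : |x - rowCenter l r i| ≤ y - (wallGrid l hl).Y r) :
    ((x, y), (0 : ℝ)) ∈ (wallGrid l hl).terrain.carrier := by
  have hx := abs_le.1 hx
  have e1 := wallGrid_Y hl r
  have e2 := wallGrid_Y hl (r + 1)
  have s1 : rowShift r = 0 := by rw [rowShift, if_neg (by omega), if_pos (by omega)]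
  have s2 : rowShift (r + 1) = 1 := by rw [rowShift, if_neg (by omega), if_neg (by omega)]
  have hc : rowCenter l (r + 1) i = rowCenter l r i := by
    rw [rowCenter, rowCenter, show (r + 1 + 2) / 3 = (r + 2) / 3 by omega]
  rw [show (r + 1 + 2) / 3 = (r + 2) / 3 by omega, s2] at e2
  rw [s1] at e1
  push_cast at e1 e2
  -- Now it is the upper triangle of the cell to the left of the center, with the base in the row
  -- above.
  refine (wallGrid l hl).mem_carrier_of_zero (k := 3 * i + 1 + 0) (r := r)
    (by change _ < 3 * l.length + 1; omega) hr (.inr rfl) ?_ ?_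
  · rintro j (rfl | rfl | rfl)
    · exact congrArg Prod.snd (vert_wallGrid hl (by omega) (by omega)) |>.trans
        ((wallGrid_Z_eq_zero hl).2 fun h => by omega)
    · exact congrArg Prod.snd (vert_wallGrid hl (by omega) (by omega)) |>.trans
        ((wallGrid_Z_eq_zero hl).2 fun h => by omega)
    · exact congrArg Prod.snd (vert_wallGrid hl (by omega) (by omega)) |>.trans
        ((wallGrid_Z_eq_zero hl).2 fun h => by omega)
  · have p0 := (wallGrid l hl).proj_idx (k := 3 * i + 1 + 1) (r := r)
      (by change _ ≤ 3 * l.length + 1; omega) hr.le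
    have p1 := (wallGrid l hl).proj_idx (k := 3 * i + 1 + 0) (r := r + 1)
      (by change _ ≤ 3 * l.length + 1; omega) hr
    have p2 := (wallGrid l hl).proj_idx (k := 3 * i + 1 + 1) (r := r + 1)
      (by change _ ≤ 3 * l.length + 1; omega) hr
    rw [wallGrid_X hl _ hi (by norm_num), s1] at p0
    rw [wallGrid_X hl _ hi (by norm_num), s2, hc] at p1 p2
    push_cast at p0 p1 p2
    set τ := y - (wallGrid l hl).Y r with hτ
    refine mem_convexHull_three ⟨_, .inl rfl, p0⟩ ⟨_, .inr (.inl rfl), p1⟩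
      ⟨_, .inr (.inr rfl), p2⟩ (b := (τ - (x - rowCenter l r i)) / 2)
      (c := (τ + (x - rowCenter l r i)) / 2) (a := 1 - τ) (by linarith) (by linarith) (by linarith)
      (by ring) (Prod.ext ?_ ?_)
    · simp only [Prod.fst_add, Prod.smul_fst, smul_eq_mul]; ring
    · simp only [Prod.snd_add, Prod.smul_snd, smul_eq_mul]
      rw [hτ, e1, e2]; ring

/-- On the middle line of a wall only the gap centers are free. -/
theorem exists_center_of_mem_carrier (hl : l.Pairwise (· < ·)) {r : ℕ} (hr : r ≤ 10)
    (hr3 : r % 3 = 2) {x y : ℝ} (hy : y = (wallGrid l hl).Y r)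
    (hx : ((x, y), (0 : ℝ)) ∈ (wallGrid l hl).terrain.carrier) :
    ∃ i < l.length, x = rowCenter l r i := by
  rw [hy] at hx
  obtain ⟨k, hk, hz, hxk⟩ := (wallGrid l hl).exists_vertex_of_mem_carrier hr (fun k _ h => by
    have h1 := (wallGrid_Z_eq_zero hl).1 h.1 hr3
    have h2 := (wallGrid_Z_eq_zero hl).1 h.2 hr3
    omega) hx
  have hk : k ≤ 3 * l.length + 1 := hk
  have h1 := (wallGrid_Z_eq_zero hl).1 hz hr3
  obtain ⟨i, rfl⟩ : ∃ i, k = 3 * i + 1 + 1 := ⟨(k - 2) / 3, by omega⟩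
  refine ⟨i, by omega, ?_⟩
  rw [hxk, wallGrid_X hl r (by omega) (by norm_num), rowShift, if_neg (by omega), if_pos hr3]
  push_cast; ring

theorem rowCenter_two (l : List ℤ) (i : ℕ) : rowCenter l 2 i = 16 * up l i := rfl

theorem rowCenter_five (l : List ℤ) (i : ℕ) : rowCenter l 5 i = -8 * down l i := rfl

theorem rowCenter_eight (l : List ℤ) (i : ℕ) : rowCenter l 8 i = 16 * up l i := rfl

theorem mem_segment_row {x x' c : ℝ} (h : x ≤ x') {p : (ℝ × ℝ) × ℝ} :
    p ∈ segment ℝ (((x, c), 0) : (ℝ × ℝ) × ℝ) ((x', c), 0) ↔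
      (x ≤ p.1.1 ∧ p.1.1 ≤ x') ∧ p.1.2 = c ∧ p.2 = 0 := by
  rw [← Prod.image_mk_segment_left]
  constructor
  · rintro ⟨q, hq, rfl⟩
    rw [mem_segment_horizontal h] at hq
    exact ⟨hq.1, hq.2, rfl⟩
  · rintro ⟨h1, h2, h3⟩
    exact ⟨p.1, (mem_segment_horizontal h).2 ⟨h1, h2⟩, Prod.ext rfl h3.symm⟩

theorem mem_edgeSet_first (hl : l.Pairwise (· < ·)) {p : (ℝ × ℝ) × ℝ} :
    p ∈ (wallGrid l hl).terrain.edgeSet (0, 11) ↔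
      ((wallGrid l hl).X 0 0 ≤ p.1.1 ∧ p.1.1 ≤ (wallGrid l hl).X 0 1) ∧ p.1.2 = 1 ∧ p.2 = 0 := by
  have h := (wallGrid l hl).X_lt 0 (Nat.zero_le _) 0 1 one_pos (by simp [wallGrid])
  rw [← mem_segment_row h.le]
  have e : (wallGrid l hl).Y 0 = 1 := by rw [wallGrid_Y]; simp [rowShift]
  have z0 : (wallGrid l hl).Z 0 0 = 0 := (wallGrid_Z_eq_zero hl).2 (by simp)
  have z1 : (wallGrid l hl).Z 0 1 = 0 := (wallGrid_Z_eq_zero hl).2 (by simp)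
  have v0 := vert_wallGrid hl (r := 0) (k := 0) (by omega) (by omega)
  have v1 := vert_wallGrid hl (r := 0) (k := 1) (by omega) (by omega)
  rw [e, z0] at v0
  rw [e, z1] at v1
  rw [← v0, ← v1]
  rfl

theorem mem_edgeSet_last (hl : l.Pairwise (· < ·)) {p : (ℝ × ℝ) × ℝ} :
    p ∈ (wallGrid l hl).terrain.edgeSet (10, 21) ↔
      ((wallGrid l hl).X 10 0 ≤ p.1.1 ∧ p.1.1 ≤ (wallGrid l hl).X 10 1) ∧
        p.1.2 = 128 * bigM l - 1 ∧ p.2 = 0 := by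
  have h := (wallGrid l hl).X_lt 10 (le_refl 10) 0 1 one_pos (by simp [wallGrid])
  rw [← mem_segment_row h.le]
  have e : (wallGrid l hl).Y 10 = 128 * bigM l - 1 := by
    rw [wallGrid_Y]; simp [rowShift]; ring
  have z0 : (wallGrid l hl).Z 10 0 = 0 := (wallGrid_Z_eq_zero hl).2 (by simp)
  have z1 : (wallGrid l hl).Z 10 1 = 0 := (wallGrid_Z_eq_zero hl).2 (by simp)
  have v0 := vert_wallGrid hl (r := 10) (k := 0) (by omega) (by omega)
  have v1 := vert_wallGrid hl (r := 10) (k := 1) (by omega) (by omega)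
  rw [e, z0] at v0
  rw [e, z1] at v1
  rw [← v0, ← v1]
  rfl

/-- The given edges are long. -/
theorem first_cell_bounds (hl : l.Pairwise (· < ·)) (hne : l ≠ []) {r : ℕ} (hr : r = 0 ∨ r = 10) :
    (wallGrid l hl).X r 0 = -200 * bigM l ∧ 80 * bigM l ≤ (wallGrid l hl).X r 1 := by
  have hr' : r ≤ 10 := by omega
  refine ⟨(wallGrid l hl).X_left r hr', ?_⟩
  have h0 : 0 < l.length := List.length_pos_iff.2 hne
  have h1 := abs_lt.1 (abs_lt_bigM hl (up_mem h0))
  have h2 := rowShift_bounds r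
  have hM := one_le_bigM l
  have e : gridX l r 1 = rowCenter l r 0 + (2 * (0 : ℕ) - 2 + rowShift r) :=
    gridX_inner l r (j := 0) h0 (by norm_num)
  have e' : rowCenter l r 0 = 100 * bigM l + 16 * up l 0 := by
    rcases hr with rfl | rfl <;> rfl
  have : 80 * bigM l ≤ gridX l r 1 := by rw [e, e']; push_cast; omega
  change 80 * (bigM l : ℝ) ≤ ((gridX l r 1 : ℤ) : ℝ)
  exact_mod_cast this

/-- Both edges have height zero, hence so has the whole sight line, and on the middle line of a wall
it must hit a gap center exactly. -/
theorem terrainInstance_yes_iff (hl : l.Pairwise (· < ·)) (hne : l ≠ []) :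
    terrainEdgeVisibility.Yes (terrainInstance l hl) ↔
      ∃ a ∈ l, ∃ b ∈ l, ∃ c ∈ l, a + b + c = 0 := by
  have hM := one_le_bigM_real l
  change WeaklyVisible (wallGrid l hl).terrain.carrier ((wallGrid l hl).terrain.edgeSet (0, 11))
    ((wallGrid l hl).terrain.edgeSet (10, 21)) ↔ _
  constructor
  · rintro ⟨p, hp, p', hp', hseg⟩
    rw [mem_edgeSet_first] at hp
    rw [mem_edgeSet_last] at hp'
    obtain ⟨⟨x, y⟩, z⟩ := p
    obtain ⟨⟨x', y'⟩, z'⟩ := p'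
    obtain ⟨-, rfl, rfl⟩ := hp
    obtain ⟨-, rfl, rfl⟩ := hp'
    have pt : ∀ t : ℝ, 0 ≤ t → t ≤ 1 → (((1 - t) * x + t * x', 1 + t * (128 * bigM l - 2)), (0 : ℝ)) ∈
        (wallGrid l hl).terrain.carrier := by
      intro t h0 h1
      refine hseg ⟨1 - t, t, by linarith, h0, by ring, ?_⟩
      refine Prod.ext (Prod.ext ?_ ?_) ?_
      · simp
      · simp; ring
      · simp
    have hpos : (0 : ℝ) < 128 * bigM l - 2 := by linarith
    -- The parameter at which the ordinate is `32 M`; the edges are at ordinates 1 and `128 M - 1`,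
    -- so by symmetry `1 - t₁` belongs to `96 M`.
    set t₁ : ℝ := (32 * bigM l - 1) / (128 * bigM l - 2) with ht₁
    have e1 : t₁ * (128 * bigM l - 2) = 32 * bigM l - 1 := div_mul_cancel₀ _ hpos.ne'
    have t0 : 0 ≤ t₁ := div_nonneg (by linarith) hpos.le
    have t1 : t₁ ≤ 1 := by rw [ht₁, div_le_one hpos]; linarith
    obtain ⟨i, hi, h1⟩ := exists_center_of_mem_carrier hl (r := 2) (by norm_num) (by norm_num)
      (by rw [e1, wallGrid_Y]; simp [rowShift]) (pt t₁ t0 t1)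
    obtain ⟨j, hj, h2⟩ := exists_center_of_mem_carrier hl (r := 5) (by norm_num) (by norm_num)
      (by rw [wallGrid_Y]; simp [rowShift]; ring) (pt (1 / 2) (by norm_num) (by norm_num))
    obtain ⟨k, hk, h3⟩ := exists_center_of_mem_carrier hl (r := 8) (by norm_num) (by norm_num)
      (by rw [sub_mul, e1, wallGrid_Y]; simp [rowShift]; ring)
      (pt (1 - t₁) (by linarith) (by linarith))
    rw [rowCenter_two] at h1
    rw [rowCenter_five] at h2
    rw [rowCenter_eight] at h3
    push_cast at h1 h2 h3
    refine ⟨_, up_mem hi, _, up_mem hk, _, down_mem hj, ?_⟩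
    have : ((up l i + up l k + down l j : ℤ) : ℝ) = 0 := by push_cast; linarith
    exact_mod_cast this
  · rintro ⟨a, ha, b, hb, c, hc, habc⟩
    have habc : (a : ℝ) + b + c = 0 := by exact_mod_cast habc
    have ba := abs_lt.1 (abs_cast_lt_bigM hl ha)
    have bb := abs_lt.1 (abs_cast_lt_bigM hl hb)
    obtain ⟨i, hi, rfl⟩ := exists_up_eq ha
    obtain ⟨k, hk, rfl⟩ := exists_up_eq hb
    obtain ⟨j, hj, rfl⟩ := exists_down_eq hc
    have rc2 : (rowCenter l 2 i : ℝ) = 16 * (up l i : ℤ) := by rw [rowCenter_two]; push_cast; rfl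
    have rc5 : (rowCenter l 5 j : ℝ) = -8 * (down l j : ℤ) := by rw [rowCenter_five]; push_cast; rfl
    have rc8 : (rowCenter l 8 k : ℝ) = 16 * (up l k : ℤ) := by rw [rowCenter_eight]; push_cast; rfl
    have hY := wallGrid_Y hl
    obtain ⟨f1, f2⟩ := first_cell_bounds hl hne (r := 0) (.inl rfl)
    obtain ⟨g1, g2⟩ := first_cell_bounds hl hne (r := 10) (.inr rfl)
    set A : ℝ := ((up l i : ℤ) : ℝ) with hA
    set B : ℝ := ((up l k : ℤ) : ℝ) with hB
    set C : ℝ := ((down l j : ℤ) : ℝ) with hC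
    set M : ℝ := ((bigM l : ℤ) : ℝ) with hM'
    -- The slope of the line through `(16 A, 32 M)` and `(16 B, 96 M)`, as abscissa per ordinate.
    set s : ℝ := (B - A) / (4 * M) with hs
    have hsM : s * M = (B - A) / 4 := by rw [hs]; field_simp
    have hs1 : |s| ≤ 1 / 2 := by
      rw [hs, abs_div, abs_of_pos (show (0 : ℝ) < 4 * M by linarith), div_le_iff₀ (by linarith),
        abs_le]
      constructor <;> linarith
    have hs2 := abs_le.1 hs1
    set f : ℝ → ℝ := fun y => 16 * A + (y - 32 * M) * s with hf
    -- The sight line has slope at most 1, which is the opening of the free cones at the gap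
    -- centers.
    have near : ∀ y y' : ℝ, |f y - f y'| ≤ |y - y'| := by
      intro y y'
      rw [show f y - f y' = (y - y') * s by simp only [hf]; ring, abs_mul]
      nlinarith [abs_nonneg (y - y')]
    have f32 : f (32 * M) = 16 * A := by simp [hf]
    have f64 : f (64 * M) = -8 * C := by simp only [hf]; linarith
    have f96 : f (96 * M) = 16 * B := by simp only [hf]; linarith
    have bound : ∀ y, 1 ≤ y → y ≤ 128 * M - 1 → |f y| ≤ 200 * M := by
      intro y h1 h2
      have h3 := abs_le.1 (near y (64 * M))
      have h4 : |y - 64 * M| ≤ 64 * M := by rw [abs_le]; constructor <;> linarith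
      rw [f64] at h3
      rw [abs_le]
      constructor <;> linarith
    have free : ∀ y, 1 ≤ y → y ≤ 128 * M - 1 →
        ((f y, y), (0 : ℝ)) ∈ (wallGrid l hl).terrain.carrier := by
      intro y h1 h2
      obtain ⟨r, hr, hy1, hy2⟩ := exists_between_steps (w := (wallGrid l hl).Y) (m := 10) (x := y)
        (by norm_num) (by rw [hY]; simpa [rowShift] using h1)
        (by rw [hY]; simp [rowShift]; linarith)
      -- near a wall
      have wallCase : ∀ q m : ℕ, m < l.length → (r = q ∨ r + 1 = q) → q % 3 = 2 →
          (wallGrid l hl).Y q = 32 * ((q + 2) / 3 : ℕ) * M →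
          (rowCenter l q m : ℝ) = f (32 * ((q + 2) / 3 : ℕ) * M) →
          ((f y, y), (0 : ℝ)) ∈ (wallGrid l hl).terrain.carrier := by
        rintro q m hm hrq hq hyq hcq
        have hn := near y (32 * ((q + 2) / 3 : ℕ) * M)
        rw [← hcq, ← hyq] at hn
        rcases hrq with rfl | rfl
        · refine mem_carrier_above hl hr hq hm hy2 (hn.trans_eq ?_)
          rw [abs_of_nonneg (by linarith)]
        · have hcr : rowCenter l (r + 1) m = rowCenter l r m := by
            rw [rowCenter, rowCenter, show (r + 1 + 2) / 3 = (r + 2) / 3 by omega]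
          rw [hcr] at hn
          refine mem_carrier_below hl hr (by omega) hm hy1 (hn.trans_eq ?_)
          rw [abs_of_nonpos (by linarith), neg_sub]
      have w2 : r = 2 ∨ r + 1 = 2 → ((f y, y), (0 : ℝ)) ∈ (wallGrid l hl).terrain.carrier :=
        fun h => wallCase 2 i hi h (by norm_num) (by rw [hY]; simp [rowShift])
          (by rw [rc2, ← f32]; norm_num)
      have w5 : r = 5 ∨ r + 1 = 5 → ((f y, y), (0 : ℝ)) ∈ (wallGrid l hl).terrain.carrier :=
        fun h => wallCase 5 j hj h (by norm_num) (by rw [hY]; simp [rowShift])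
          (by rw [rc5, ← f64]; norm_num)
      have w8 : r = 8 ∨ r + 1 = 8 → ((f y, y), (0 : ℝ)) ∈ (wallGrid l hl).terrain.carrier :=
        fun h => wallCase 8 k hk h (by norm_num) (by rw [hY]; simp [rowShift])
          (by rw [rc8, ← f96]; norm_num)
      have flat : r % 3 = 0 → ((f y, y), (0 : ℝ)) ∈ (wallGrid l hl).terrain.carrier :=
        fun h => mem_carrier_flat hl hr h (bound y h1 h2) hy1 hy2
      interval_cases r
      · exact flat rfl
      · exact w2 (.inr rfl)
      · exact w2 (.inl rfl)
      · exact flat rfl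
      · exact w5 (.inr rfl)
      · exact w5 (.inl rfl)
      · exact flat rfl
      · exact w8 (.inr rfl)
      · exact w8 (.inl rfl)
      · exact flat rfl
    have b1 : |f 1| ≤ 80 * M := by
      have := abs_le.1 (near 1 (64 * M))
      have h4 : |1 - 64 * M| ≤ 64 * M := by rw [abs_le]; constructor <;> linarith
      rw [f64] at this
      rw [abs_le]; constructor <;> linarith
    have b2 : |f (128 * M - 1)| ≤ 80 * M := by
      have := abs_le.1 (near (128 * M - 1) (64 * M))
      have h4 : |128 * M - 1 - 64 * M| ≤ 64 * M := by rw [abs_le]; constructor <;> linarith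
      rw [f64] at this
      rw [abs_le]; constructor <;> linarith
    rw [abs_le] at b1 b2
    refine ⟨((f 1, 1), 0), ?_, ((f (128 * M - 1), 128 * M - 1), 0), ?_, ?_⟩
    · rw [mem_edgeSet_first, f1]
      exact ⟨⟨by linarith, by linarith⟩, rfl, rfl⟩
    · rw [mem_edgeSet_last, g1]
      exact ⟨⟨by linarith, by linarith⟩, rfl, rfl⟩
    · rintro _ ⟨u, t, hu, ht, hut, rfl⟩
      obtain rfl : u = 1 - t := by linarith
      have hfree := free (1 + t * (128 * M - 2)) (by nlinarith) (by nlinarith)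
      convert hfree using 1
      refine Prod.ext (Prod.ext ?_ ?_) ?_
      · simp only [hf, Prod.fst_add, Prod.smul_fst, smul_eq_mul]; ring
      · simp only [Prod.fst_add, Prod.smul_fst, Prod.snd_add, Prod.smul_snd, smul_eq_mul]; ring
      · simp

/-! ### Its encoding -/

/-- The coordinates of a column with the given abscissas; the column has the heights of column `k`. -/
def linColumn (x : ℕ → Lin) (k : ℕ) : List Lin :=
  (List.range 11).flatMap fun r =>
    [x r, { one := rowShift r, big := 32 * ((r + 2) / 3 : ℕ) }, { one := gridZ r k }]

/-- The abscissas of an inner column. -/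
def linX (c : ℤ) (r : ℕ) : Lin :=
  if (r + 2) / 3 = 1 ∨ (r + 2) / 3 = 3 then { one := c + rowShift r, a := 16 }
  else if (r + 2) / 3 = 2 then { one := c + rowShift r, b := -8 }
  else { one := c + rowShift r, big := 100, a := 16 }

/-- The template of the terrains. -/
def terrainTemplate : Template where
  realHead := linColumn (fun _ => { big := -200 }) 0
  realBody := linColumn (linX (-2)) 1 ++ (linColumn (linX 0) 2 ++ linColumn (linX 2) 3)
  realTail := linColumn (fun _ => { big := 200 }) 1
  natHead := [0, 11, 10, 21]
  natBody := triCode (Grid.cellTris 11 0) ++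
    (triCode (Grid.cellTris 11 1) ++ triCode (Grid.cellTris 11 2))
  natTail := triCode (Grid.cellTris 11 0)
  -- Every entry contributes three columns of 11 vertices.
  stride := 33

theorem flatMap_range_three {α : Type*} (f : ℕ → List α) (n : ℕ) :
    (List.range (3 * n)).flatMap f =
      (List.range n).flatMap fun i => f (3 * i) ++ (f (3 * i + 1) ++ f (3 * i + 2)) := by
  induction n with
  | zero => rfl
  | succ n ih =>
    rw [show 3 * (n + 1) = 3 * n + 1 + 1 + 1 by ring, List.range_succ, List.range_succ,
      List.range_succ, List.range_succ]
    simp [List.flatMap_append, ih]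

/-- Vertices are numbered column by column, so a move by `d` columns adds the same number `d * m` to
every index. -/
theorem triCode_cellTris_add (m k d : ℕ) :
    triCode (Grid.cellTris m (k + d)) = (triCode (Grid.cellTris m k)).map (· + d * m) := by
  rw [triCode, triCode, Grid.cellTris, Grid.cellTris, List.flatMap_assoc, List.flatMap_assoc,
    List.map_flatMap]
  refine List.flatMap_congr fun r _ => ?_
  simp only [Grid.lower, Grid.upper, List.flatMap_cons, List.flatMap_nil, List.append_nil,
    List.cons_append, List.nil_append, List.map_cons, List.map_nil, List.cons.injEq, and_true]
  refine ⟨?_, ?_, ?_, ?_, ?_, ?_⟩ <;> ring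

theorem gridZ_congr {r k k' : ℕ} (h : k % 3 = k' % 3) : gridZ r k = gridZ r k' := by
  rw [gridZ, gridZ, h]

/-- The heights repeat with period 3 in the column number, so a fixed body of three columns
describes every gap. -/
theorem map_linColumn (hl : l.Pairwise (· < ·)) (x : ℕ → Lin) (k k' : ℕ) (a b p q : ℝ)
    (hx : ∀ r, (x r).eval (bigM l) a b p q = gridX l r k) (hk : k % 3 = k' % 3) :
    (linColumn x k').map (fun e => e.eval (bigM l) a b p q) =
      coordsThree ((wallGrid l hl).column k) := by
  rw [linColumn, coordsThree, Grid.column, List.map_flatMap, List.flatMap_map]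
  refine List.flatMap_congr fun r _ => ?_
  have hy : (({ one := rowShift r, big := 32 * ((r + 2) / 3 : ℕ) } : Lin)).eval (bigM l) a b p q =
      (wallGrid l hl).Y r := by
    rw [wallGrid_Y]
    generalize (r + 2) / 3 = m
    simp [Lin.eval]
  have hz : (({ one := gridZ r k' } : Lin)).eval (bigM l) a b p q = (wallGrid l hl).Z r k := by
    rw [gridZ_congr hk.symm]; simp [Lin.eval, wallGrid]
  simp only [List.map_cons, List.map_nil, hx, hy, hz]
  rfl

theorem eval_linX (c : ℤ) (r i j : ℕ) (p q : ℝ) (hi : i < l.length) (hj : j < 3)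
    (hc : c = 2 * j - 2) :
    (linX c r).eval (bigM l) (up l i) (down l i) p q = gridX l r (3 * i + 1 + j) := by
  rw [gridX_inner l r hi hj, linX, rowCenter, hc]
  split_ifs <;> simp only [Lin.eval] <;> push_cast <;> ring

/-- Column 0 is the head, columns `3 * i + 1` to `3 * i + 3` belong to entry `i`, and the last
column is the tail. The triangles are grouped by cells `3 * i` to `3 * i + 2`, with the last cell in
the tail. -/
theorem encode_terrainInstance (hl : l.Pairwise (· < ·)) :
    terrainEdgeVisibility.encode (terrainInstance l hl) = terrainTemplate.word l := by
  have ht : (wallGrid l hl).tris =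
      (List.range (3 * l.length + 1)).flatMap (Grid.cellTris 11) := rfl
  have hv : (wallGrid l hl).verts =
      (List.range (3 * l.length + 1 + 1)).flatMap (wallGrid l hl).column := rfl
  change Word.mk ([0, 11, 10, 21] ++ triCode (wallGrid l hl).tris)
    (coordsThree (wallGrid l hl).verts) = _
  rw [Template.word, Word.mk.injEq]
  constructor
  · rw [ht, List.range_succ, List.flatMap_append, List.flatMap_singleton, flatMap_range_three,
      triCode, List.flatMap_append, List.flatMap_assoc, ← List.append_assoc]
    refine congrArg₂ _ (congrArg₂ _ rfl (List.flatMap_congr fun i _ => ?_)) ?_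
    · have h0 := triCode_cellTris_add 11 0 (3 * i)
      have h1 := triCode_cellTris_add 11 1 (3 * i)
      have h2 := triCode_cellTris_add 11 2 (3 * i)
      rw [show 3 * i * 11 = i * 33 by ring] at h0 h1 h2
      rw [show 0 + 3 * i = 3 * i by ring] at h0
      rw [show 1 + 3 * i = 3 * i + 1 by ring] at h1
      rw [show 2 + 3 * i = 3 * i + 2 by ring] at h2
      rw [List.flatMap_append, List.flatMap_append]
      change triCode _ ++ (triCode _ ++ triCode _) = _
      rw [h0, h1, h2, ← List.map_append, ← List.map_append]
      rfl
    · have h0 := triCode_cellTris_add 11 0 (3 * l.length)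
      rw [show 3 * l.length * 11 = l.length * 33 by ring, Nat.zero_add] at h0
      exact h0
  · rw [hv, List.range_succ, List.flatMap_append, List.flatMap_singleton, List.range_succ_eq_map,
      List.flatMap_cons, List.flatMap_map, flatMap_range_three, coordsThree, List.flatMap_append,
      List.flatMap_append, List.flatMap_assoc]
    refine congrArg₂ _ (congrArg₂ _ ?_ (List.flatMap_congr fun i hi => ?_)) ?_
    · simp only [Template.headReals, terrainTemplate]
      refine (map_linColumn hl _ 0 0 _ _ _ _ (fun r => ?_) rfl).symm
      rw [gridX, if_pos rfl]; simp [Lin.eval]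
    · rw [List.mem_range] at hi
      rw [List.flatMap_append, List.flatMap_append]
      simp only [Template.bodyReals, terrainTemplate, List.map_append]
      refine congrArg₂ _ ?_ (congrArg₂ _ ?_ ?_)
      · exact (map_linColumn hl _ (3 * i + 1) 1 _ _ _ _
          (fun r => eval_linX _ r i 0 _ _ hi (by norm_num) (by norm_num)) (by omega)).symm
      · exact (map_linColumn hl _ (3 * i + 2) 2 _ _ _ _
          (fun r => eval_linX _ r i 1 _ _ hi (by norm_num) (by norm_num)) (by omega)).symm
      · exact (map_linColumn hl _ (3 * i + 3) 3 _ _ _ _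
          (fun r => eval_linX _ r i 2 _ _ hi (by norm_num) (by norm_num)) (by omega)).symm
    · simp only [Template.tailReals, terrainTemplate]
      refine (map_linColumn hl _ (3 * l.length + 1) 1 _ _ _ _ (fun r => ?_) (by omega)).symm
      rw [gridX, if_neg (by omega), if_pos rfl]; simp [Lin.eval]

end TerrainOfList

theorem isThreeSumHard_terrainEdgeVisibility : IsThreeSumHard terrainEdgeVisibility :=
  isThreeSumHard_of_template terrainTemplate fun l hne hl =>
    ⟨terrainInstance l hl, encode_terrainInstance hl, terrainInstance_yes_iff hl hne⟩

end ThreeSumVis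

end

theorem mainTheorem10 :
    ThreeSumVis.IsThreeSumHard ThreeSumVis.domainEdgeVisibility ∧
      ThreeSumVis.IsThreeSumHard ThreeSumVis.terrainEdgeVisibility :=
  ⟨ThreeSumVis.isThreeSumHard_domainEdgeVisibility,
    ThreeSumVis.isThreeSumHard_terrainEdgeVisibility⟩
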